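/- A digraph here is a finite, nonempty directed graph without loops and without two distinct arcs having the same tail and the same head (two arcs with the same pair of ends but opposite directions are allowed). An orientation of $K_4$ is a digraph obtained from the complete graph $K_4$ by replacing each edge $uv$ by exactly one of the arcs $(u,v)$, $(v,u)$. A subdivision of a digraph $H$ is a digraph obtained from $H$ by replacing each arc $(u,v)$ by a directed path (of length at least one) from $u$ to $v$, where the inner vertices of these paths are new and the paths are pairwise internally disjoint. A digraph contains a subdivision of $H$ if it has a subdigraph isomorphic to a subdivision of $H$. **Corollary.** Let $G$ be a digraph in which every vertex has out-degree at least $3$ and in-degree at least $3$. Then $G$ contains a subdivision of every orientation of $K_4$. -/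

import Mathlib

namespace Digraph

/-- The digraph has no loops. (Parallel arcs do not exist for `Digraph`; opposite arcs are
allowed.) Thus a loopless `Digraph` is a simple digraph. -/
def Loopless {V : Type*} (G : Digraph V) : Prop :=
  ∀ v, ¬ G.Adj v v

/-- The number of out-neighbours of `v`. -/
noncomputable def outDegree {V : Type*} (G : Digraph V) (v : V) : ℕ :=
  {w | G.Adj v w}.ncard

/-- The number of in-neighbours of `v`. -/
noncomputable def inDegree {V : Type*} (G : Digraph V) (v : V) : ℕ :=
  {w | G.Adj w v}.ncard

/-- `D` is an orientation of the graph `K`: each edge of `K` is replaced by exactly one of its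
two possible arcs, and there are no other arcs. -/
def IsOrientation {V : Type*} (D : Digraph V) (K : SimpleGraph V) : Prop :=
  (∀ u v, K.Adj u v ↔ D.Adj u v ∨ D.Adj v u) ∧ ∀ u v, ¬ (D.Adj u v ∧ D.Adj v u)

/-- The list `p` is the vertex sequence of a directed path of `G` from `a` to `b`. -/
structure IsDirPath {V : Type*} (G : Digraph V) (p : List V) (a b : V) : Prop where
  chain : p.IsChain G.Adj
  nodup : p.Nodup
  head_eq : p.head? = some a
  last_eq : p.getLast? = some b

/-- `S` is a subdivision of the simple digraph `H`: it arises from `H` (whose vertices are placed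
by `f`) by replacing each arc `(u, v)` with a directed path `P u v` from `f u` to `f v`, where the
paths have pairwise disjoint interiors that avoid the vertices of `H`, and `S` has
no further vertices and arcs. -/
def IsSubdivision {W U : Type*} (S : Digraph W) (H : Digraph U) : Prop :=
  ∃ (f : U → W) (P : U → U → List W),
    Function.Injective f ∧
    (∀ u v, H.Adj u v → S.IsDirPath (P u v) (f u) (f v)) ∧
    -- inner vertices of the paths are new vertices
    (∀ u v, H.Adj u v → ∀ x ∈ P u v, x ≠ f u → x ≠ f v → x ∉ Set.range f) ∧
    -- an inner vertex of one path is on no other path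
    (∀ u v u' v', H.Adj u v → H.Adj u' v' → (u, v) ≠ (u', v') →
      ∀ x ∈ P u v, x ≠ f u → x ≠ f v → x ∉ P u' v') ∧
    -- there are no other vertices
    (∀ x, x ∈ Set.range f ∨ ∃ u v, H.Adj u v ∧ x ∈ P u v) ∧
    -- the arcs are exactly those of the paths
    (∀ x y, S.Adj x y ↔ ∃ u v, H.Adj u v ∧ [x, y] <:+: P u v)

/-- `G` contains a subdivision of `H`: some subdigraph of `G`, with vertex set `s` and arcs
given by `S`, is a subdivision of `H`. -/
def ContainsSubdivision {V U : Type*} (G : Digraph V) (H : Digraph U) : Prop :=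
  ∃ (s : Set V) (S : Digraph s),
    (∀ x y : s, S.Adj x y → G.Adj x y) ∧ S.IsSubdivision H

end Digraph

/-! There are four tournaments on four vertices: the transitive one, the strong one, a directed
triangle plus a source, and the reverse of the latter, a directed triangle plus a sink
(`IsOrientation.classification`). Out-degree at least 3 alone yields the first three; the fourth is
the third in the reversed digraph, and only there in-degrees matter.

Strong and source tournaments (`IsTailPath.hasModel`). All out-neighbours of the end `v m` of a
maximal path lie on the path; choose three, `v i`, `v j`, `v k` with `i < j < k`, the first and last
being extreme. If `v k` reaches the stretch from `v i` to just before `v j` while avoiding `v j` and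
`v m`, both subdivisions can be read off. Otherwise the set reached from `v k` can be left only
towards `v j` and `v m`, and the argument restarts in this smaller set with a path beginning `v m`,
`v j`.

Transitive tournament (`Config.exists_hasTransitive`). The claim is strengthened to configurations,
in which two vertices `p → q → x` are exempt from the degree condition, and a minimal counterexample
is studied. Two forces work against each other. A proper subset of `R` with two exits, one leading
to the other outside the set, gives a smaller configuration once its outside is contracted, and a
transitive subdivision found there lifts back (`HasTransitive.lift`); hence there is no such set
(`MinConfig.not_out_two`). On the other hand, if an arc is not the longest arc of a transitive
subdivision, Menger's theorem for two paths provides a set with few exits (`exists_separator`).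
Uncrossing these sets shows that within `R` the vertex `q` has one in-neighbour and `p` has two
(`MinConfig.exists_tokens`). After suppressing `p`, the in-neighbour of `x` in `R` is unique, and
everything outside a smallest suitable set `Y` is contracted to a hub
(`TokenConfig.exists_hubConfig`).

The contradiction is a double count in `HubConfig.false`. The set `Y` splits into maximal sets with
a single entry. An entry has at most two in-neighbours outside its part, whereas the hub and all
counted parts but at most one lead to at least two entries. -/

namespace Digraph

/-! ### Walks with prescribed vertex sets -/

section Reach

variable {V : Type*} {D D' : Digraph V} {S T A B X : Set V} {u v w a b : V}

/-- `v` can be reached from `u` by a walk all of whose vertices, except possibly `u`, lie in `T`. -/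
def Reach (D : Digraph V) (T : Set V) : V → V → Prop :=
  Relation.ReflTransGen fun a b => D.Adj a b ∧ b ∈ T

theorem Reach.refl : D.Reach T u u := Relation.ReflTransGen.refl

theorem Reach.trans (h : D.Reach T u v) (h' : D.Reach T v w) : D.Reach T u w :=
  Relation.ReflTransGen.trans h h'

theorem Reach.tail (h : D.Reach T u v) (h' : D.Adj v w) (hw : w ∈ T) : D.Reach T u w :=
  Relation.ReflTransGen.tail h ⟨h', hw⟩

theorem Reach.head (h' : D.Adj u v) (hv : v ∈ T) (h : D.Reach T v w) : D.Reach T u w :=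
  Relation.ReflTransGen.head ⟨h', hv⟩ h

theorem Reach.of_adj (h : D.Adj u v) (hv : v ∈ T) : D.Reach T u v :=
  Reach.refl.tail h hv

theorem Reach.of_adj_insert (h : D.Adj u v) : D.Reach (insert v T) u v :=
  Reach.of_adj h (Set.mem_insert _ _)

/-- If `A` is closed under the arcs into `T` and these are arcs of `D'` into `S`, then a walk of `D`
starting in `A` is a walk of `D'`. -/
theorem Reach.induct (h : D.Reach T u v) (hu : u ∈ A)
    (hA : ∀ a ∈ A, ∀ b ∈ T, D.Adj a b → b ∈ A ∧ b ∈ S ∧ D'.Adj a b) :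
    v ∈ A ∧ D'.Reach S u v := by
  induction h with
  | refl => exact ⟨hu, Reach.refl⟩
  | tail _ h ih =>
    obtain ⟨h1, h2, h3⟩ := hA _ ih.1 _ h.2 h.1
    exact ⟨h1, ih.2.tail h3 h2⟩

theorem Reach.mem_of_closed (h : D.Reach T u v) (hu : u ∈ A)
    (hA : ∀ a ∈ A, ∀ b ∈ T, D.Adj a b → b ∈ A) : v ∈ A := by
  induction h with
  | refl => exact hu
  | tail _ h ih => exact hA _ ih _ h.2 h.1

theorem Reach.mono (h : D.Reach S u v) (hST : S ⊆ T) : D.Reach T u v :=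
  (h.induct (Set.mem_univ u) fun _ _ _ hb hab => ⟨Set.mem_univ _, hST hb, hab⟩).2

theorem Reach.mono_adj (h : D.Reach S u v) (hST : S ⊆ T) (hD : ∀ a b, D.Adj a b → D'.Adj a b) :
    D'.Reach T u v :=
  (h.induct (Set.mem_univ u) fun _ _ _ hb hab => ⟨Set.mem_univ _, hST hb, hD _ _ hab⟩).2

theorem Reach.eq_or_mem (h : D.Reach T u v) : u = v ∨ v ∈ T := by
  cases h with
  | refl => exact Or.inl rfl
  | tail _ h => exact Or.inr h.2

theorem Reach.mem_of_mem (h : D.Reach T u v) (hu : u ∈ T) : v ∈ T :=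
  h.eq_or_mem.elim (fun h => h ▸ hu) id

theorem Reach.eq_or_head (h : D.Reach T u v) : u = v ∨ ∃ w ∈ T, D.Adj u w ∧ D.Reach T w v := by
  rcases Relation.ReflTransGen.cases_head h with h | ⟨w, h, h'⟩
  · exact Or.inl h
  · exact Or.inr ⟨w, h.2, h.1, h'⟩

/-- Last exit from `A` before the first entry to `B`. -/
theorem Reach.exists_exit_entry (h : D.Reach S u v) (hu : u ∈ A) (hv : v ∈ B)
    (hAB : Disjoint A B) :
    ∃ b ∈ A, ∃ c ∈ B, c ∈ S ∧ D.Reach (insert c (S \ (A ∪ B))) b c := by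
  have key : (∃ b ∈ A, ∃ c ∈ B, c ∈ S ∧ D.Reach (insert c (S \ (A ∪ B))) b c) ∨
      ∃ b ∈ A, D.Reach (S \ (A ∪ B)) b v := by
    clear hv
    induction h with
    | refl => exact Or.inr ⟨u, hu, Reach.refl⟩
    | @tail w w' _ h ih =>
      rcases ih with ih | ⟨b, hb, ih⟩
      · exact Or.inl ih
      · by_cases hB : w' ∈ B
        · exact Or.inl ⟨b, hb, w', hB, h.2,
            (ih.mono (Set.subset_insert _ _)).tail h.1 (Set.mem_insert _ _)⟩
        · by_cases hA : w' ∈ A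
          · exact Or.inr ⟨w', hA, Reach.refl⟩
          · exact Or.inr ⟨b, hb, ih.tail h.1 ⟨h.2, by simp [hA, hB]⟩⟩
  rcases key with key | ⟨b, hb, h⟩
  · exact key
  · rcases h.eq_or_mem with rfl | h
    · exact absurd hv (Set.disjoint_left.mp hAB hb)
    · exact absurd (Or.inr hv) h.2

/-- First entry to `B`. -/
theorem Reach.exists_first (h : D.Reach S u v) (hv : v ∈ B) (hu : u ∉ B) :
    ∃ w, D.Reach (S \ B) u w ∧ ∃ c ∈ B, c ∈ S ∧ D.Adj w c := by
  have key : (∃ w, D.Reach (S \ B) u w ∧ ∃ c ∈ B, c ∈ S ∧ D.Adj w c) ∨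
      D.Reach (S \ B) u v := by
    clear hv
    induction h with
    | refl => exact Or.inr Reach.refl
    | @tail w w' _ h ih =>
      rcases ih with ih | ih
      · exact Or.inl ih
      · by_cases hB : w' ∈ B
        · exact Or.inl ⟨w, ih, w', hB, h.2, h.1⟩
        · exact Or.inr (ih.tail h.1 ⟨h.2, hB⟩)
  rcases key with key | h
  · exact key
  · rcases h.eq_or_mem with rfl | h
    · exact absurd hv hu
    · exact absurd hv h.2

/-- A walk contains a simple path. -/
theorem Reach.exists_chain (h : D.Reach T u v) :
    ∃ l : List V, (u :: l).IsChain D.Adj ∧ (u :: l).Nodup ∧ (∀ x ∈ l, x ∈ T) ∧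
      (u :: l).getLast? = some v := by
  induction h using Relation.ReflTransGen.head_induction_on with
  | refl => exact ⟨[], by simp⟩
  | @head a c h _ ih =>
    obtain ⟨l, h1, h2, h3, h4⟩ := ih
    by_cases ha : a ∈ c :: l
    · obtain ⟨s, t, hst⟩ := List.append_of_mem ha
      refine ⟨t, ?_, ?_, ?_, ?_⟩
      · rw [hst] at h1
        exact (List.isChain_append.mp h1).2.1
      · rw [hst] at h2
        exact (List.nodup_append.mp h2).2.1
      · intro x hx
        have : x ∈ c :: l := by rw [hst]; simp [hx]
        rcases List.mem_cons.mp this with rfl | hx'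
        · exact h.2
        · exact h3 x hx'
      · rw [hst] at h4
        simpa using h4
    · refine ⟨c :: l, ?_, ?_, ?_, ?_⟩
      · simpa using ⟨h.1, h1⟩
      · exact List.nodup_cons.mpr ⟨ha, h2⟩
      · intro x hx
        rcases List.mem_cons.mp hx with rfl | hx'
        · exact h.2
        · exact h3 x hx'
      · simpa using h4

theorem Reach.exists_interior (h : D.Reach (insert b T) a b) (hab : a ≠ b) :
    ∃ l : List V, (a :: (l ++ [b])).IsChain D.Adj ∧ (a :: (l ++ [b])).Nodup ∧ ∀ x ∈ l, x ∈ T := by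
  obtain ⟨l, h1, h2, h3, h4⟩ := h.exists_chain
  rcases List.eq_nil_or_concat l with rfl | ⟨l', y, rfl⟩
  · simp at h4; exact absurd h4 hab
  · have : y = b := by
      rw [List.concat_eq_append, ← List.cons_append, List.getLast?_append] at h4
      simpa using h4
    subst this
    rw [List.concat_eq_append] at *
    refine ⟨l', h1, h2, fun x hx => ?_⟩
    rcases h3 x (by simp [hx]) with rfl | h
    · exfalso
      have := (List.nodup_cons.mp h2).2
      simp [List.nodup_append] at this
      exact this.2 _ hx rfl
    · exact h

theorem Reach.of_isChain {l : List V} (h : (u :: l).IsChain D.Adj) (hT : ∀ x ∈ l, x ∈ T) :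
    ∀ x ∈ u :: l, D.Reach T u x := by
  induction l generalizing u with
  | nil => intro x hx; simp at hx; subst hx; exact Reach.refl
  | cons c l ih =>
    intro x hx
    rw [List.isChain_cons_cons] at h
    rcases List.mem_cons.mp hx with rfl | hx
    · exact Reach.refl
    · exact Reach.head h.1 (hT c (by simp)) (ih h.2 (fun y hy => hT y (by simp [hy])) x hx)

/-- The digraph with all arcs reversed. -/
def reversed (D : Digraph V) : Digraph V := ⟨fun a b => D.Adj b a⟩

theorem Reach.reverse (h : D.Reach T u v) : D.reversed.Reach (insert u T) v u := by
  induction h with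
  | refl => exact Reach.refl
  | @tail w w' hw h ih =>
    have : w ∈ insert u T := by
      rcases Reach.eq_or_mem hw with h | h
      · simp [h]
      · simp [h]
    exact Reach.head (D := D.reversed) h.1 this ih

/-- The reversed walk is cut between its last visit to `v` and the following visit to `u`, so that
`v` is not needed as an inner vertex. -/
theorem Reach.reverse_insert (h : D.Reach (insert v T) u v) (huv : u ≠ v) :
    D.reversed.Reach (insert u T) v u := by
  obtain ⟨b, hb, c, hc, -, h⟩ := h.reverse.exists_exit_entry (A := {v}) (B := {u}) rfl rfl
    (by simpa using huv.symm)
  rw [Set.mem_singleton_iff] at hb hc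
  subst hb hc
  refine h.mono ?_
  rintro x (rfl | ⟨hx, hx'⟩)
  · simp
  · simp at hx hx' ⊢
    tauto

end Reach

/-! ### Subdivisions from disjoint walks; the four tournaments -/

section Model

variable {V : Type*} {G : Digraph V} {H : Digraph (Fin 4)} {A : Fin 6 → Fin 4 × Fin 4}

theorem isInfix_of_map_val {α : Type*} {p : α → Prop} {x y : Subtype p} {l : List (Subtype p)}
    (h : [x.1, y.1] <:+: l.map Subtype.val) : [x, y] <:+: l := by
  obtain ⟨s, t, h⟩ := h
  rw [eq_comm, List.map_eq_append_iff] at h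
  obtain ⟨l1, l2, rfl, h1, h2⟩ := h
  rw [List.map_eq_append_iff] at h1
  obtain ⟨l3, l4, rfl, h3, h4⟩ := h1
  have : l4 = [x, y] := by
    have : l4.map Subtype.val = [x, y].map Subtype.val := by simpa using h4
    exact List.map_injective_iff.mpr Subtype.val_injective this
  subst this
  exact ⟨l3, l2, rfl⟩

/-- A system of paths of `G` modelling `H`, given by the placement of the vertices and the
interiors of the paths. -/
theorem containsSubdivision_of_interiors {U : Type*} {H : Digraph U} (f : U → V)
    (I : U → U → List V)
    (hf : Function.Injective f)
    (hI : ∀ u v, H.Adj u v → (f u :: (I u v ++ [f v])).IsChain G.Adj)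
    (hn : ∀ u v, H.Adj u v → (f u :: (I u v ++ [f v])).Nodup)
    (hr : ∀ u v, H.Adj u v → ∀ x ∈ I u v, x ∉ Set.range f)
    (hd : ∀ u v u' v', H.Adj u v → H.Adj u' v' → (u, v) ≠ (u', v') → ∀ x ∈ I u v, x ∉ I u' v') :
    G.ContainsSubdivision H := by
  classical
  set P : U → U → List V := fun u v => f u :: (I u v ++ [f v]) with hP
  set s : Set V := {x | x ∈ Set.range f ∨ ∃ u v, H.Adj u v ∧ x ∈ P u v} with hs
  have hmem : ∀ u v, H.Adj u v → ∀ x ∈ P u v, x ∈ s := fun u v h x hx => Or.inr ⟨u, v, h, hx⟩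
  set P' : U → U → List s := fun u v =>
    if h : H.Adj u v then (P u v).pmap Subtype.mk (hmem u v h) else [] with hP'
  have hval : ∀ u v, H.Adj u v → (P' u v).map Subtype.val = P u v := by
    intro u v h
    simp [hP', h, List.map_pmap]
  have hmemP : ∀ u v, H.Adj u v → ∀ x : s, x ∈ P' u v ↔ x.1 ∈ P u v := by
    intro u v h x
    rw [← hval u v h]
    simp
  refine ⟨s, ⟨fun x y => ∃ u v, H.Adj u v ∧ [x.1, y.1] <:+: P u v⟩, ?_,
    fun u => ⟨f u, Or.inl ⟨u, rfl⟩⟩, P', ?_, ?_, ?_, ?_, ?_, ?_⟩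
  · rintro x y ⟨u, v, h, hi⟩
    have := (hI u v h).infix hi
    simpa using this
  · intro u v h
    exact hf (congrArg Subtype.val h)
  · intro u v h
    refine ⟨?_, ?_, ?_, ?_⟩
    · have h1 := (List.isChain_isInfix (P' u v))
      refine h1.imp fun x y hxy => ⟨u, v, h, ?_⟩
      have := hxy.map Subtype.val
      rwa [hval u v h] at this
    · have := hn u v h
      change (P u v).Nodup at this
      rw [← hval u v h] at this
      exact this.of_map _
    · have h1 := congrArg List.head? (hval u v h)
      rw [List.head?_map] at h1
      have : (P u v).head? = some (f u) := rfl
      rw [this, Option.map_eq_some_iff] at h1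
      obtain ⟨a, h2, h3⟩ := h1
      rw [h2]
      exact congrArg some (Subtype.ext h3)
    · have h1 := congrArg List.getLast? (hval u v h)
      rw [List.getLast?_map] at h1
      have : (P u v).getLast? = some (f v) := by
        change (f u :: (I u v ++ [f v])).getLast? = _
        rw [← List.cons_append, List.getLast?_append]
        simp
      rw [this, Option.map_eq_some_iff] at h1
      obtain ⟨a, h2, h3⟩ := h1
      rw [h2]
      exact congrArg some (Subtype.ext h3)
  · rintro u v h x hx hxu hxv ⟨w, hw⟩
    rw [hmemP u v h] at hx
    simp only [hP, List.mem_cons, List.mem_append, List.not_mem_nil, or_false] at hx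
    rcases hx with hx | hx | hx
    · exact hxu (Subtype.ext hx)
    · exact hr u v h x.1 hx ⟨w, congrArg Subtype.val hw⟩
    · exact hxv (Subtype.ext hx)
  · rintro u v u' v' h h' hne x hx hxu hxv hx'
    rw [hmemP u v h] at hx
    rw [hmemP u' v' h'] at hx'
    simp only [hP, List.mem_cons, List.mem_append, List.not_mem_nil, or_false] at hx hx'
    rcases hx with hx | hx | hx
    · exact hxu (Subtype.ext hx)
    · rcases hx' with hx' | hx' | hx'
      · exact hr u v h x.1 hx ⟨_, hx'.symm⟩
      · exact hd u v u' v' h h' hne x.1 hx hx'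
      · exact hr u v h x.1 hx ⟨_, hx'.symm⟩
    · exact hxv (Subtype.ext hx)
  · rintro ⟨x, hx | ⟨u, v, h, hx⟩⟩
    · obtain ⟨u, rfl⟩ := hx
      exact Or.inl ⟨u, rfl⟩
    · exact Or.inr ⟨u, v, h, (hmemP u v h _).mpr hx⟩
  · intro x y
    refine exists_congr fun u => exists_congr fun v => and_congr_right fun h => ?_
    constructor
    · intro hi
      rw [← hval u v h] at hi
      exact isInfix_of_map_val hi
    · intro hi
      have := hi.map Subtype.val
      rwa [hval u v h] at this

/-- `G` has four distinct vertices and pairwise disjoint sets, avoiding these vertices, such that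
for each of the six listed pairs a path joins the ends through the corresponding set. -/
def HasModel (G : Digraph V) (A : Fin 6 → Fin 4 × Fin 4) : Prop :=
  ∃ f : Fin 4 → V, Function.Injective f ∧ ∃ T : Fin 6 → Set V,
    (∀ i j, i < j → Disjoint (T i) (T j)) ∧ (∀ i k, f k ∉ T i) ∧
    ∀ i, G.Reach (insert (f (A i).2) (T i)) (f (A i).1) (f (A i).2)

/-- Simple paths extracted inside the disjoint sets `T i` are automatically internally disjoint, so
walks suffice in `HasModel`. -/
theorem HasModel.containsSubdivision (h : G.HasModel A) (hA : ∀ i, (A i).1 ≠ (A i).2)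
    {τ : Fin 4 → Fin 4} (hτ : Function.Injective τ)
    (hH : ∀ u v, H.Adj u v → ∃ i, A i = (τ u, τ v)) : G.ContainsSubdivision H := by
  obtain ⟨f, hf, T, hT, hfT, hr⟩ := h
  have h1 : ∀ u v, ∃ l : List V, H.Adj u v → ∃ i, A i = (τ u, τ v) ∧
      (f (τ u) :: (l ++ [f (τ v)])).IsChain G.Adj ∧ (f (τ u) :: (l ++ [f (τ v)])).Nodup ∧
      ∀ x ∈ l, x ∈ T i := by
    intro u v
    by_cases huv : H.Adj u v
    · obtain ⟨i, hi⟩ := hH u v huv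
      have h2 := hr i
      have h3 := hA i
      rw [hi] at h2 h3
      obtain ⟨l, hl⟩ := h2.exists_interior (fun h => h3 (hf h))
      exact ⟨l, fun _ => ⟨i, hi, hl⟩⟩
    · exact ⟨[], fun h => absurd h huv⟩
  choose I hI using h1
  refine containsSubdivision_of_interiors (f ∘ τ) I (hf.comp hτ) ?_ ?_ ?_ ?_
  · intro u v h
    obtain ⟨i, -, h, -⟩ := hI u v h
    exact h
  · intro u v h
    obtain ⟨i, -, -, h, -⟩ := hI u v h
    exact h
  · rintro u v h x hx ⟨w, rfl⟩
    obtain ⟨i, -, -, -, h⟩ := hI u v h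
    exact hfT _ _ (h _ hx)
  · intro u v u' v' h h' hne x hx hx'
    obtain ⟨i, hi, -, -, h⟩ := hI u v h
    obtain ⟨i', hi', -, -, h'⟩ := hI u' v' h'
    have hii : i ≠ i' := by
      rintro rfl
      rw [hi, Prod.mk.injEq] at hi'
      exact hne (Prod.ext (hτ hi'.1) (hτ hi'.2))
    rcases lt_or_gt_of_ne hii with hlt | hlt
    · exact Set.disjoint_left.mp (hT _ _ hlt) (h x hx) (h' x hx')
    · exact Set.disjoint_left.mp (hT _ _ hlt) (h' x hx') (h x hx)

theorem HasModel.of_reversed (h : G.reversed.HasModel A) (hA : ∀ i, (A i).1 ≠ (A i).2) :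
    G.HasModel fun i => (A i).swap := by
  obtain ⟨f, hf, T, hT, hfT, hr⟩ := h
  exact ⟨f, hf, T, hT, hfT, fun i => (hr i).reverse_insert fun h => hA i (hf h)⟩

/-- The transitive tournament. -/
def transitiveArcs : Fin 6 → Fin 4 × Fin 4 := ![(0, 1), (0, 2), (0, 3), (1, 2), (1, 3), (2, 3)]

/-- The strongly connected tournament. -/
def strongArcs : Fin 6 → Fin 4 × Fin 4 := ![(0, 1), (1, 2), (2, 3), (3, 0), (3, 1), (2, 0)]

/-- The tournament with a source dominating a directed triangle. -/
def sourceArcs : Fin 6 → Fin 4 × Fin 4 := ![(0, 1), (0, 2), (0, 3), (1, 2), (2, 3), (3, 1)]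

/-- The tournament on `Fin 4` that has, for `u < v`, the arc `(u, v)` if the corresponding argument
is true, and `(v, u)` otherwise. -/
def tournamentAdj (b01 b02 b03 b12 b13 b23 : Bool) : Fin 4 → Fin 4 → Bool :=
  ![![false, b01, b02, b03], ![!b01, false, b12, b13], ![!b02, !b12, false, b23],
    ![!b03, !b13, !b23, false]]

/-- The alternatives are the four isomorphism types. Conditions are interleaved with the quantifiers
so that `decide` need not run through all quadruples. -/
theorem tournamentAdj_classification (b01 b02 b03 b12 b13 b23 : Bool) :
    let r := fun u v => tournamentAdj b01 b02 b03 b12 b13 b23 u v = true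
    (∃ a b, r a b ∧ ∃ c, r a c ∧ r b c ∧ ∃ d, r a d ∧ r b d ∧ r c d) ∨
    (∃ a b, r a b ∧ ∃ c, r b c ∧ r c a ∧ ∃ d, r c d ∧ r d a ∧ r d b) ∨
    (∃ a b, r a b ∧ ∃ c, r a c ∧ r b c ∧ ∃ d, r a d ∧ r c d ∧ r d b) ∨
    (∃ a b, r b a ∧ ∃ c, r c a ∧ r c b ∧ ∃ d, r d a ∧ r d c ∧ r b d) := by
  revert b01 b02 b03 b12 b13 b23
  decide

/-- The four tournaments on four vertices. -/
def fourTournaments : Fin 4 → Fin 6 → Fin 4 × Fin 4 :=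
  ![transitiveArcs, strongArcs, sourceArcs, fun i => (sourceArcs i).swap]

theorem fourTournaments_complete :
    ∀ k a b, a ≠ b → ∃ i, fourTournaments k i = (a, b) ∨ fourTournaments k i = (b, a) := by
  decide

/-- A listed tournament is first mapped into `H` by some `g`. Since `H` has neither loops nor
opposite arcs, `g` is injective, hence bijective, and `τ` is its inverse. -/
theorem IsOrientation.classification (hH : H.IsOrientation (⊤ : SimpleGraph (Fin 4))) :
    ∃ k : Fin 4, ∃ τ : Fin 4 → Fin 4, Function.Injective τ ∧ ∀ u v, H.Adj u v →
      ∃ i, fourTournaments k i = (τ u, τ v) := by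
  classical
  have hn : ∀ u v, H.Adj u v → ¬ H.Adj v u := fun u v h h' => hH.2 u v ⟨h, h'⟩
  have ht : ∀ u v, u ≠ v → H.Adj u v ∨ H.Adj v u := fun u v h => (hH.1 u v).mp h
  suffices h : ∃ k, ∃ g : Fin 4 → Fin 4, ∀ i,
      H.Adj (g (fourTournaments k i).1) (g (fourTournaments k i).2) by
    obtain ⟨k, g, h⟩ := h
    have hg : Function.Injective g := by
      intro a b hab
      by_contra hne
      obtain ⟨i, hi | hi⟩ := fourTournaments_complete k a b hne <;>
      · have := h i
        rw [hi] at this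
        simp only [hab] at this
        exact hn _ _ this this
    have hs := Finite.surjective_of_injective hg
    refine ⟨k, Function.surjInv hs, Function.injective_surjInv hs, fun u v huv => ?_⟩
    have hne : Function.surjInv hs u ≠ Function.surjInv hs v := by
      intro h
      have := Function.injective_surjInv hs h
      subst this
      exact hn _ _ huv huv
    obtain ⟨i, hi | hi⟩ := fourTournaments_complete k _ _ hne
    · exact ⟨i, hi⟩
    · have := h i
      rw [hi] at this
      simp only [Function.surjInv_eq] at this
      exact absurd this (hn _ _ huv)
  have hr : ∀ u v, tournamentAdj (decide (H.Adj 0 1))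
    (decide (H.Adj 0 2)) (decide (H.Adj 0 3)) (decide (H.Adj 1 2)) (decide (H.Adj 1 3))
    (decide (H.Adj 2 3)) u v = true → H.Adj u v := by
    intro u v
    fin_cases u <;> fin_cases v <;> simp [tournamentAdj] <;>
      exact fun h => (ht _ _ (by decide)).resolve_right h
  rcases tournamentAdj_classification (decide (H.Adj 0 1))
    (decide (H.Adj 0 2)) (decide (H.Adj 0 3)) (decide (H.Adj 1 2)) (decide (H.Adj 1 3))
    (decide (H.Adj 2 3)) with
    ⟨a, b, h1, c, h2, h3, d, h4, h5, h6⟩ | ⟨a, b, h1, c, h2, h3, d, h4, h5, h6⟩ |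
    ⟨a, b, h1, c, h2, h3, d, h4, h5, h6⟩ | ⟨a, b, h1, c, h2, h3, d, h4, h5, h6⟩
  · refine ⟨0, ![a, b, c, d], fun i => ?_⟩
    fin_cases i <;> apply hr <;> assumption
  · refine ⟨1, ![a, b, c, d], fun i => ?_⟩
    fin_cases i <;> apply hr
    exacts [h1, h2, h4, h5, h6, h3]
  · refine ⟨2, ![a, b, c, d], fun i => ?_⟩
    fin_cases i <;> apply hr
    exacts [h1, h2, h4, h3, h5, h6]
  · refine ⟨3, ![a, b, c, d], fun i => ?_⟩
    fin_cases i <;> apply hr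
    exacts [h1, h2, h4, h3, h5, h6]

end Model

end Digraph

namespace Digraph

/-! ### Strong and source tournaments from maximal paths -/

section LongPath

variable {V : Type*} {G : Digraph V} {R : Set V} {v : ℕ → V} {h m a b i j k l : ℕ}

/-- For any two vertices, `u` has an out-neighbour different from both. -/
def ThreeOut (D : Digraph V) (u : V) : Prop := ∀ y z, ∃ w, D.Adj u w ∧ w ≠ y ∧ w ≠ z

theorem threeOut_of_outDegree [Finite V] {u : V} (h : 3 ≤ G.outDegree u) : G.ThreeOut u := by
  intro y z
  have h1 : ({y, z} : Set V).ncard < {w | G.Adj u w}.ncard :=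
    by
    have := Set.ncard_insert_le y {z}
    rw [Set.ncard_singleton] at this
    exact lt_of_le_of_lt this h
  obtain ⟨w, hw, hw'⟩ := Set.exists_mem_notMem_of_ncard_lt_ncard h1
  simp at hw'
  exact ⟨w, hw, hw'.1, hw'.2⟩

/-- The vertices `v 0, …, v m` form a path which enters `R` at time `h`, and the only arcs leaving
`R` go to `v 0` and `v 1`. -/
structure IsTailPath (G : Digraph V) (R : Set V) (v : ℕ → V) (h m : ℕ) : Prop where
  inj : ∀ a b, a ≤ m → b ≤ m → v a = v b → a = b
  adj : ∀ a < m, G.Adj (v a) (v (a + 1))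
  notMem : ∀ a < h, v a ∉ R
  mem : ∀ a, h ≤ a → a ≤ m → v a ∈ R
  out : ∀ u ∈ R, ∀ w, G.Adj u w → w ∈ R ∨ w = v 0 ∨ w = v 1
  two_le : 2 ≤ h
  le : h ≤ m

theorem IsTailPath.exists_maximal [Finite V] (hv : G.IsTailPath R v h m) :
    ∃ v m, G.IsTailPath R v h m ∧ ∀ w, G.Adj (v m) w → ∃ t ≤ m, w = v t := by
  by_contra hcon
  push Not at hcon
  have key : ∀ n, ∃ v, G.IsTailPath R v h (m + n) := by
    intro n
    induction n with
    | zero => exact ⟨v, hv⟩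
    | succ n ih =>
      obtain ⟨v, hv⟩ := ih
      obtain ⟨w, hw, hw'⟩ := hcon v _ hv
      have hle := hv.le
      have h2 := hv.two_le
      refine ⟨fun t => if t = m + n + 1 then w else v t, ?_, ?_, ?_, ?_, ?_, h2, by omega⟩
      · intro a b ha hb hab
        split_ifs at hab with h1 h2 h2
        · omega
        · exact absurd hab (hw' b (by omega))
        · exact absurd hab.symm (hw' a (by omega))
        · exact hv.inj a b (by omega) (by omega) hab
      · intro a ha
        split_ifs with h1 h2 h2
        · omega
        · omega
        · have : a = m + n := by omega
          subst this
          exact hw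
        · exact hv.adj a (by omega)
      · intro a ha
        rw [if_neg (by omega)]
        exact hv.notMem a ha
      · intro a ha ha'
        split_ifs with h1
        · rcases hv.out _ (hv.mem (m + n) (by omega) le_rfl) w hw with h | h | h
          · exact h
          · exact absurd h (hw' 0 (by omega))
          · exact absurd h (hw' 1 (by omega))
        · exact hv.mem a ha (by omega)
      · rw [if_neg (by omega), if_neg (by omega)]
        exact hv.out
  obtain ⟨v, hv⟩ := key (Nat.card V)
  have h1 : Function.Injective fun t : Fin (m + Nat.card V + 1) => v t := by
    intro a b hab
    exact Fin.ext (hv.inj _ _ (by omega) (by omega) hab)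
  have := Nat.card_le_card_of_injective _ h1
  simp at this

/-- The vertices `v t` with `a ≤ t < b`. -/
def segment (v : ℕ → V) (a b : ℕ) : Set V := {x | ∃ t, a ≤ t ∧ t < b ∧ v t = x}

theorem reach_segment (hadj : ∀ t < m, G.Adj (v t) (v (t + 1))) (hab : a ≤ b) (hb : b ≤ m) :
    G.Reach (insert (v b) (segment v (a + 1) b)) (v a) (v b) := by
  induction b, hab using Nat.le_induction with
  | base => exact Reach.refl
  | succ b hab ih =>
    have h1 := ih (by omega)
    rcases hab.eq_or_lt with rfl | hlt
    · exact Reach.of_adj_insert (hadj a (by omega))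
    · refine (h1.mono ?_).tail (hadj b (by omega)) (Set.mem_insert _ _)
      rintro x (rfl | ⟨t, h1, h2, rfl⟩)
      · exact Or.inr ⟨b, by omega, by omega, rfl⟩
      · exact Or.inr ⟨t, by omega, by omega, rfl⟩

theorem reach_arc_segment (hadj : ∀ t < m, G.Adj (v t) (v (t + 1))) {x : V} (hx : G.Adj x (v a))
    (hab : a ≤ b) (hb : b ≤ m) : G.Reach (insert (v b) (segment v a b)) x (v b) := by
  rcases hab.eq_or_lt with rfl | hlt
  · exact Reach.of_adj_insert hx
  · refine Reach.head hx (Or.inr ⟨a, le_rfl, hlt, rfl⟩) ((reach_segment hadj hab hb).mono ?_)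
    rintro x (rfl | ⟨t, h1, h2, rfl⟩)
    · simp
    · exact Or.inr ⟨t, by omega, by omega, rfl⟩

/-- Shorten the walk to run from its last vertex `v r` behind `v j` to the next vertex `v l` before
`v j`. The path supplies `v l → v j → v r → v m`, the end `v m` returns to `v l` through `v i` and
to `v j` directly, and the shortened walk is the sixth connection. -/
theorem IsTailPath.hasModel_strong (hv : G.IsTailPath R v h m) (hjk : j < k)
    (hkm : k < m) (hi : G.Adj (v m) (v i)) (hj : G.Adj (v m) (v j))
    (hil : i ≤ l) (hlj : l < j) (hr : G.Reach {v j, v m}ᶜ (v k) (v l)) :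
    G.HasModel strongArcs := by
  obtain ⟨_, ⟨r, hjr, hrm, rfl⟩, _, ⟨l, hil, hlj, rfl⟩, -, hr⟩ :=
    hr.exists_exit_entry (A := segment v (j + 1) m) (B := segment v i j)
      ⟨k, hjk, hkm, rfl⟩ ⟨l, hil, hlj, rfl⟩ (by
        rw [Set.disjoint_left]
        rintro x ⟨t, h1, h2, rfl⟩ ⟨t', h1', h2', h3⟩
        have := hv.inj _ _ (by omega) (by omega) h3
        omega)
  have hinj := hv.inj
  refine ⟨![v l, v j, v r, v m], ?_, ![segment v (l + 1) j, segment v (j + 1) r,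
    segment v (r + 1) m, segment v i l, ∅, {v j, v m}ᶜ \ (segment v (j + 1) m ∪ segment v i j)],
    ?_, ?_, ?_⟩
  · have h1 : Function.Injective fun t : Fin 4 => (![l, j, r, m] t : ℕ) := by
      intro a b hab
      fin_cases a <;> fin_cases b <;> simp at hab ⊢ <;> omega
    have h2 : ∀ t : Fin 4, ![v l, v j, v r, v m] t = v (![l, j, r, m] t) := by
      intro t; fin_cases t <;> rfl
    have h3 : ∀ t : Fin 4, ![l, j, r, m] t ≤ m := by
      intro t; fin_cases t <;> simp <;> omega
    intro a b hab
    rw [h2, h2] at hab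
    exact h1 (hinj _ _ (h3 a) (h3 b) hab)
  · have hseg : ∀ a b a' b', b ≤ m → b' ≤ m → b ≤ a' ∨ b' ≤ a →
        Disjoint (segment v a b) (segment v a' b') := by
      intro a b a' b' hb hb' hd
      rw [Set.disjoint_left]
      rintro x ⟨t, h1, h2, rfl⟩ ⟨t', h1', h2', h3⟩
      have := hinj _ _ (by omega) (by omega) h3
      omega
    have hseg' : ∀ a b, (i ≤ a ∧ b ≤ j) ∨ (j + 1 ≤ a ∧ b ≤ m) → Disjoint (segment v a b)
        ({v j, v m}ᶜ \ (segment v (j + 1) m ∪ segment v i j)) := by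
      intro a b hab
      rw [Set.disjoint_left]
      rintro x ⟨t, h1, h2, rfl⟩ h3
      refine h3.2 ?_
      rcases hab with hab | hab
      · exact Or.inr ⟨t, by omega, by omega, rfl⟩
      · exact Or.inl ⟨t, by omega, by omega, rfl⟩
    intro a b hab
    fin_cases a <;> fin_cases b <;> simp at hab ⊢ <;>
      first | (apply hseg <;> omega) | (apply hseg'; omega)
  · have hns : ∀ t a b, t ≤ m → b ≤ m → t < a ∨ b ≤ t → v t ∉ segment v a b := by
      rintro t a b ht hb hd ⟨t', h1, h2, h3⟩
      have := hinj _ _ (by omega) (by omega) h3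
      omega
    intro a b
    fin_cases a <;> fin_cases b <;> simp <;> try (apply hns <;> omega)
    · intro _ _ _
      exact ⟨l, by omega, by omega, rfl⟩
    · intro _ _ h
      exact absurd ⟨r, by omega, by omega, rfl⟩ h
  · have hadj := hv.adj
    intro a
    fin_cases a <;> simp [strongArcs]
    · exact reach_segment hadj (by omega) (by omega)
    · exact reach_segment hadj (by omega) (by omega)
    · exact reach_segment hadj (by omega) (by omega)
    · exact reach_arc_segment hadj hi (by omega) (by omega)
    · exact Reach.of_adj hj (by simp)
    · exact hr

/-- The source is `v m` and the triangle is `v l → v j → v w → v l`, where `v w` splits the walk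
from `v k` to `v l`: its first part, preceded by the arc to `v k`, joins the source to `v w`, and
its second part closes the triangle. -/
theorem IsTailPath.hasModel_source (hv : G.IsTailPath R v h m) (hjk : j < k)
    (hkm : k < m) (hi : G.Adj (v m) (v i)) (hj : G.Adj (v m) (v j)) (hk : G.Adj (v m) (v k))
    (hil : i ≤ l) (hlj : l < j) (hr : G.Reach {v j, v m}ᶜ (v k) (v l)) :
    G.HasModel sourceArcs := by
  classical
  have hinj := hv.inj
  have hkB : v k ∉ segment v i j := by
    rintro ⟨t, h1, h2, h3⟩
    have := hinj _ _ (by omega) (by omega) h3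
    omega
  obtain ⟨_, rfl, _, ⟨l, hil, hlj, rfl⟩, -, hr⟩ :=
    hr.exists_exit_entry (A := {v k}) (B := segment v i j) rfl ⟨l, hil, hlj, rfl⟩
      (Set.disjoint_singleton_left.mpr hkB)
  obtain ⟨Z, hZ1, hZ2, hZ3⟩ := hr.exists_interior (fun h => hkB ⟨l, hil, hlj, h.symm⟩)
  -- The least such index keeps the path strictly between `v j` and `v w` off the walk.
  have hex : ∃ w, j < w ∧ v w ∈ v k :: Z := ⟨k, hjk, by simp⟩
  set w := Nat.find hex with hw
  obtain ⟨hjw, hwZ⟩ := Nat.find_spec hex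
  rw [← hw] at hjw hwZ
  have hwk : w ≤ k := Nat.find_min' hex ⟨hjk, by simp⟩
  have hmin : ∀ t, j < t → t < w → v t ∉ v k :: Z := fun t h1 h2 h3 =>
    Nat.find_min hex h2 ⟨h1, h3⟩
  obtain ⟨Z1, Z2, hZ⟩ := List.append_of_mem hwZ
  have hk' : ∀ x, x ∈ v k :: Z → x ∉ segment v i j ∧ x ≠ v j ∧ x ≠ v m := by
    intro x hx
    rcases List.mem_cons.mp hx with rfl | hx
    · refine ⟨hkB, fun h => ?_, fun h => ?_⟩ <;>
      · have := hinj _ _ (by omega) (by omega) h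
        omega
    · obtain ⟨h1, h2⟩ := hZ3 x hx
      simp at h1 h2
      exact ⟨h2.2, h1.1, h1.2⟩
  rw [← List.cons_append] at hZ1 hZ2
  have hch : (v m :: ((v k :: Z) ++ [v l])).IsChain G.Adj := by
    simpa [hk] using hZ1
  rw [hZ] at hZ2 hmin hk' hch
  have hvw : v w ∉ Z1 ∧ v w ∉ Z2 ∧ ∀ x ∈ Z1, x ∉ Z2 := by
    have := (List.nodup_append.mp hZ2).1
    rw [List.nodup_append] at this
    obtain ⟨-, h2, h3⟩ := this
    exact ⟨fun h => h3 _ h (v w) (by simp) rfl, (List.nodup_cons.mp h2).1,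
      fun x hx hx' => h3 x hx x (by simp [hx']) rfl⟩
  have hm1 : ∀ x ∈ Z1, x ∈ Z1 ++ v w :: Z2 := fun x hx => by simp [hx]
  have hm2 : ∀ x ∈ Z2, x ∈ Z1 ++ v w :: Z2 := fun x hx => by simp [hx]
  refine ⟨![v m, v l, v j, v w], ?_, ![segment v i l, ∅, {x | x ∈ Z1}, segment v (l + 1) j,
    segment v (j + 1) w, {x | x ∈ Z2}], ?_, ?_, ?_⟩
  · have h1 : Function.Injective fun t : Fin 4 => (![m, l, j, w] t : ℕ) := by
      intro a b hab
      fin_cases a <;> fin_cases b <;> simp at hab ⊢ <;> omega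
    have h2 : ∀ t : Fin 4, ![v m, v l, v j, v w] t = v (![m, l, j, w] t) := by
      intro t; fin_cases t <;> rfl
    have h3 : ∀ t : Fin 4, ![m, l, j, w] t ≤ m := by
      intro t; fin_cases t <;> simp <;> omega
    intro a b hab
    rw [h2, h2] at hab
    exact h1 (hinj _ _ (h3 a) (h3 b) hab)
  · have hseg : ∀ a b a' b', b ≤ m → b' ≤ m → b ≤ a' ∨ b' ≤ a →
        Disjoint (segment v a b) (segment v a' b') := by
      intro a b a' b' hb hb' hd
      rw [Set.disjoint_left]
      rintro x ⟨t, h1, h2, rfl⟩ ⟨t', h1', h2', h3⟩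
      have := hinj _ _ (by omega) (by omega) h3
      omega
    have hZs : ∀ L : List V, (∀ x ∈ L, x ∈ Z1 ++ v w :: Z2) → ∀ a b,
        (i ≤ a ∧ b ≤ j) ∨ (j + 1 ≤ a ∧ b ≤ w) → Disjoint (segment v a b) {x | x ∈ L} := by
      intro L hL a b hab
      rw [Set.disjoint_left]
      rintro x ⟨t, h1, h2, rfl⟩ hx
      rcases hab with hab | hab
      · exact (hk' _ (hL _ hx)).1 ⟨t, by omega, by omega, rfl⟩
      · exact hmin t (by omega) (by omega) (hL _ hx)
    intro a b hab
    fin_cases a <;> fin_cases b <;> simp at hab ⊢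
    · exact hZs _ hm1 _ _ (by omega)
    · apply hseg <;> omega
    · apply hseg <;> omega
    · exact hZs _ hm2 _ _ (by omega)
    · exact (hZs _ hm1 _ _ (by omega)).symm
    · exact (hZs _ hm1 _ _ (by omega)).symm
    · exact Set.disjoint_left.mpr hvw.2.2
    · apply hseg <;> omega
    · exact hZs _ hm2 _ _ (by omega)
    · exact hZs _ hm2 _ _ (by omega)
  · have hns : ∀ t a b, t ≤ m → b ≤ m → t < a ∨ b ≤ t → v t ∉ segment v a b := by
      rintro t a b ht hb hd ⟨t', h1, h2, h3⟩
      have := hinj _ _ (by omega) (by omega) h3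
      omega
    have hl : v l ∈ segment v i j := ⟨l, by omega, by omega, rfl⟩
    intro a b
    fin_cases a <;> fin_cases b <;> simp <;> try (apply hns <;> omega)
    · exact fun h => (hk' _ (hm1 _ h)).2.2 rfl
    · exact fun h => (hk' _ (hm1 _ h)).1 hl
    · exact fun h => (hk' _ (hm1 _ h)).2.1 rfl
    · exact hvw.1
    · exact fun h => (hk' _ (hm2 _ h)).2.2 rfl
    · exact fun h => (hk' _ (hm2 _ h)).1 hl
    · exact fun h => (hk' _ (hm2 _ h)).2.1 rfl
    · exact hvw.2.1
  · have hadj := hv.adj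
    intro a
    fin_cases a <;> simp [sourceArcs]
    · exact reach_arc_segment hadj hi (by omega) (by omega)
    · exact Reach.of_adj hj (by simp)
    · have h1 : (v m :: (Z1 ++ [v w])).IsChain G.Adj := by
        refine List.IsChain.left_of_append (l₂ := Z2 ++ [v l]) ?_
        simpa using hch
      refine Reach.of_isChain h1 ?_ _ (by simp)
      intro x hx
      simp at hx ⊢
      tauto
    · exact reach_segment hadj (by omega) (by omega)
    · exact reach_segment hadj (by omega) (by omega)
    · have h1 : (v w :: (Z2 ++ [v l])).IsChain G.Adj := by
        refine List.IsChain.right_of_append (l₁ := v m :: Z1) ?_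
        simpa using hch
      refine Reach.of_isChain h1 ?_ _ (by simp)
      intro x hx
      simp at hx ⊢
      tauto

/-- Induction on the size of `R`. If `v k` cannot get behind `v j`, the set `X` it reaches has only
the exits `v j` and `v m`; it lies in `R` and misses `v m`, so it is smaller. -/
theorem IsTailPath.hasModel [Finite V] (hG : G.Loopless) (h3 : ∀ u, G.ThreeOut u)
    (hv : G.IsTailPath R v h m) : G.HasModel strongArcs ∧ G.HasModel sourceArcs := by
  classical
  induction hn : R.ncard using Nat.strong_induction_on generalizing R v h m with
  | _ n ih =>
  subst hn
  obtain ⟨v, m, hv, hmax⟩ := hv.exists_maximal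
  have hinj := hv.inj
  have hmax' : ∀ w, G.Adj (v m) w → ∃ t < m, w = v t := by
    intro w hw
    obtain ⟨t, ht, rfl⟩ := hmax w hw
    refine ⟨t, lt_of_le_of_ne ht ?_, rfl⟩
    rintro rfl
    exact hG _ hw
  have hex : ∃ t, G.Adj (v m) (v t) := by
    obtain ⟨w, hw, -⟩ := h3 (v m) (v m) (v m)
    obtain ⟨t, -, rfl⟩ := hmax' w hw
    exact ⟨t, hw⟩
  obtain ⟨i, hi, hmin⟩ : ∃ i, G.Adj (v m) (v i) ∧ ∀ t, G.Adj (v m) (v t) → i ≤ t :=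
    ⟨Nat.find hex, Nat.find_spec hex, fun t => Nat.find_min' hex⟩
  obtain ⟨k, ⟨hkm, hk⟩, hkmax⟩ : ∃ k, (k < m ∧ G.Adj (v m) (v k)) ∧
      ∀ t, t < m → G.Adj (v m) (v t) → t ≤ k := by
    let P : ℕ → Prop := fun t => t < m ∧ G.Adj (v m) (v t)
    have hP : ∃ t, t ≤ m ∧ P t := by
      obtain ⟨t, ht⟩ := hex
      obtain ⟨t', h1, h2⟩ := hmax' _ ht
      exact ⟨t', h1.le, h1, h2 ▸ ht⟩
    obtain ⟨t, ht, hPt⟩ := hP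
    exact ⟨Nat.findGreatest P m, Nat.findGreatest_spec ht hPt,
      fun t h1 h2 => Nat.le_findGreatest h1.le ⟨h1, h2⟩⟩
  obtain ⟨w, hj, hwi, hwk⟩ := h3 (v m) (v i) (v k)
  obtain ⟨j, hjm, rfl⟩ := hmax' w hj
  have hij : i < j := lt_of_le_of_ne (hmin j hj) (by rintro rfl; exact hwi rfl)
  have hjk : j < k := lt_of_le_of_ne (hkmax j hjm hj) (by rintro rfl; exact hwk rfl)
  by_cases hcase : ∃ l, i ≤ l ∧ l < j ∧ G.Reach {v j, v m}ᶜ (v k) (v l)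
  · obtain ⟨l, hil, hlj, hr⟩ := hcase
    exact ⟨hv.hasModel_strong hjk hkm hi hj hil hlj hr,
      hv.hasModel_source hjk hkm hi hj hk hil hlj hr⟩
  have h2h := hv.two_le
  have hhm := hv.le
  set X : Set V := {x | G.Reach {v j, v m}ᶜ (v k) x} with hX
  have hlow : ∀ t < j, v t ∉ X := by
    intro t ht hx
    rcases le_or_gt i t with hit | hit
    · exact hcase ⟨t, hit, ht, hx⟩
    -- From `v t` with `t < i` the path leads on to `v i`, avoiding `v j` and `v m`.
    · refine hcase ⟨i, le_rfl, hij, Reach.trans hx ((reach_segment hv.adj hit.le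
        (by omega)).mono ?_)⟩
      rintro x (rfl | ⟨s, h1, h2, rfl⟩) <;> simp <;> constructor <;> intro h <;>
      · have := hinj _ _ (by omega) (by omega) h
        omega
  have hkj : v k ≠ v j := fun h => by have := hinj _ _ (by omega) (by omega) h; omega
  have hkm' : v k ≠ v m := fun h => by have := hinj _ _ (by omega) (by omega) h; omega
  have hXc : X ⊆ {v j, v m}ᶜ := fun x hx => Reach.mem_of_mem hx (by simp [hkj, hkm'])
  have hkR : v k ∈ R := by
    rcases hv.out _ (hv.mem m hhm le_rfl) _ hk with h | h | h
    · exact h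
    · have := hinj _ _ (by omega) (by omega) h; omega
    · have := hinj _ _ (by omega) (by omega) h; omega
  have hXR : X ⊆ R := by
    intro x hx
    refine (Reach.mem_of_closed (A := X ∩ R) hx ⟨Reach.refl, hkR⟩ fun a ha b hb hab => ?_).2
    have hbX : b ∈ X := Reach.tail ha.1 hab hb
    refine ⟨hbX, ?_⟩
    rcases hv.out a ha.2 b hab with h | rfl | rfl
    · exact h
    · exact absurd hbX (hlow 0 (by omega))
    · rcases Nat.lt_or_ge 1 j with h1 | h1
      · exact absurd hbX (hlow 1 h1)
      · have : j = 1 := by omega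
        subst this
        simp at hb
  have hlt : X.ncard < R.ncard := by
    refine Set.ncard_lt_ncard ⟨hXR, fun h => ?_⟩ (Set.toFinite _)
    have := hXc (h (hv.mem m hhm le_rfl))
    simp at this
  have hex' : ∃ t, j < t ∧ v t ∈ X := ⟨k, hjk, Reach.refl⟩
  obtain ⟨k', ⟨hjk', hk'X⟩, hk'k, hk'⟩ : ∃ k', (j < k' ∧ v k' ∈ X) ∧ k' ≤ k ∧
      ∀ t, j < t → t < k' → v t ∉ X :=
    ⟨Nat.find hex', Nat.find_spec hex', Nat.find_min' hex' ⟨hjk, Reach.refl⟩,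
      fun t h1 h2 h3 => Nat.find_min hex' h2 ⟨h1, h3⟩⟩
  -- The new path is `v m`, `v j`, `v (j + 1)`, …, `v k'`: it starts with the two exits of `X`, and
  -- only its last vertex is in `X`.
  suffices hv' : G.IsTailPath X (fun s => if s = 0 then v m else v (j + s - 1)) (k' - j + 1)
      (k' - j + 1) from ih _ hlt hv' rfl
  refine ⟨?_, ?_, ?_, ?_, ?_, by omega, le_rfl⟩
  · intro a b ha hb hab
    split_ifs at hab with h1 h2 h2
    · omega
    all_goals
      have := hinj _ _ (by omega) (by omega) hab
      omega
  · intro a ha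
    rw [if_neg (show a + 1 ≠ 0 by omega)]
    split_ifs with h1
    · subst h1
      simpa using hj
    · have := hv.adj (j + a - 1) (by omega)
      rwa [show j + a - 1 + 1 = j + (a + 1) - 1 by omega] at this
  · intro a ha
    split_ifs with h1
    · intro h; have := hXc h; simp at this
    · rcases Nat.eq_or_lt_of_le (show 1 ≤ a by omega) with h2 | h2
      · subst h2
        intro h; have := hXc h; simp at this
      · exact hk' _ (by omega) (by omega)
  · intro a ha ha'
    have : a = k' - j + 1 := by omega
    subst this
    rw [if_neg (by omega)]
    rwa [show j + (k' - j + 1) - 1 = k' by omega]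
  · intro u hu w huw
    by_cases hw : w ∈ ({v j, v m} : Set V)
    · rcases hw with rfl | rfl
      · right; right
        simp
      · right; left
        simp
    · exact Or.inl (Reach.tail hu huw hw)

/-- Any path on three vertices is an initial tail path, with all vertices but its first two as `R`.
-/
theorem hasModel_strong_source [Finite V] [Nonempty V] (hG : G.Loopless)
    (h3 : ∀ u, G.ThreeOut u) : G.HasModel strongArcs ∧ G.HasModel sourceArcs := by
  obtain ⟨p⟩ := ‹Nonempty V›
  obtain ⟨q, hpq, -⟩ := h3 p p p
  obtain ⟨x, hqx, hxp, hxq⟩ := h3 q p q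
  have hne : p ≠ q := by rintro rfl; exact hG _ hpq
  refine IsTailPath.hasModel hG h3 (R := {p, q}ᶜ) (v := fun t => if t = 0 then p else
    if t = 1 then q else x) (h := 2) (m := 2) ⟨?_, ?_, ?_, ?_, ?_, le_rfl, le_rfl⟩
  · intro a b ha hb
    interval_cases a <;> interval_cases b <;> simp [*, Ne.symm, hne.symm, hxp.symm, hxq.symm]
  · intro a ha
    interval_cases a <;> simpa
  · intro a ha
    interval_cases a <;> simp
  · intro a ha ha'
    have : a = 2 := by omega
    subst this
    simp [hxp, hxq]
  · intro u _ w _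
    simp
    tauto

end LongPath

end Digraph

namespace Digraph

/-! ### Menger's theorem for two paths -/

section Menger

variable {V : Type*} {D : Digraph V} {A B T : Set V} {a b d w x y z : V}

/-- Some walk inside `T` leads from `A` to `B`. -/
def Links (D : Digraph V) (A B T : Set V) : Prop := ∃ a ∈ A, ∃ b ∈ B, a ∈ T ∧ D.Reach T a b

/-- The digraph with the arc from `x` to `y` removed. -/
def deleteArc (D : Digraph V) (x y : V) : Digraph V :=
  ⟨fun u v => D.Adj u v ∧ ¬ (u = x ∧ v = y)⟩

theorem Reach.of_deleteArc (h : (D.deleteArc x y).Reach T a b) : D.Reach T a b :=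
  h.mono_adj subset_rfl fun _ _ h => h.1

theorem Reach.deleteArc_or (h : D.Reach T a b) :
    (D.deleteArc x y).Reach T a b ∨ (D.deleteArc x y).Reach T a x := by
  induction h with
  | refl => exact Or.inl Reach.refl
  | @tail b c _ hbc ih =>
    rcases ih with ih | ih
    · by_cases h : b = x ∧ c = y
      · exact Or.inr (h.1 ▸ ih)
      · exact Or.inl (ih.tail ⟨hbc.1, h⟩ hbc.2)
    · exact Or.inr ih

theorem Reach.deleteArc_or' (h : D.Reach T a b) :
    (D.deleteArc x y).Reach T a b ∨ (y ∈ T ∧ (D.deleteArc x y).Reach T y b) := by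
  induction h with
  | refl => exact Or.inl Reach.refl
  | @tail b c _ hbc ih =>
    by_cases h : b = x ∧ c = y
    · exact Or.inr ⟨h.2 ▸ hbc.2, h.2 ▸ Reach.refl⟩
    · rcases ih with ih | ih
      · exact Or.inl (ih.tail ⟨hbc.1, h⟩ hbc.2)
      · exact Or.inr ⟨ih.1, ih.2.tail ⟨hbc.1, h⟩ hbc.2⟩

/-- A walk from `z` may be taken to never return to `z`. -/
theorem Reach.exists_from (h : D.Reach T z b) (hz : z ∈ T) :
    ∃ S ⊆ T, z ∈ S ∧ D.Reach S z b ∧ ∀ w ∈ S, w ≠ z → D.Reach (S \ {z}) w b := by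
  obtain ⟨l, h1, h2, h3, h4⟩ := h.exists_chain
  refine ⟨{w | w ∈ z :: l}, ?_, by simp, ?_, ?_⟩
  · intro w hw
    rcases List.mem_cons.mp hw with rfl | hw
    · exact hz
    · exact h3 w hw
  · exact Reach.of_isChain h1 (fun w hw => by simp [hw]) b (List.mem_of_getLast? h4)
  · intro w hw hwz
    have hw' : w ∈ l := by simpa [hwz] using hw
    obtain ⟨s, t, rfl⟩ := List.append_of_mem hw'
    have h5 : (w :: t).IsChain D.Adj := by
      have := (List.isChain_append (l₁ := z :: s) (l₂ := w :: t)).mp (by simpa using h1)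
      exact this.2.1
    have h6 : ∀ v ∈ t, v ∈ {u | u ∈ z :: (s ++ w :: t)} \ {z} := by
      intro v hv
      refine ⟨by simp [hv], ?_⟩
      rintro rfl
      have := (List.nodup_cons.mp h2).1
      simp [hv] at this
    refine Reach.of_isChain h5 h6 b ?_
    · have : (z :: (s ++ w :: t)).getLast? = (w :: t).getLast? := by
        rw [← List.cons_append, List.getLast?_append]
        cases h : (w :: t).getLast? <;> simp_all
      rw [this] at h4
      exact List.mem_of_getLast? h4

/-- Unless `a = z`, the set `S` is not a path but consists of `z` and everything reachable from `a`
in `T` without `z`. -/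
theorem Reach.exists_to (h : D.Reach T a z) (ha : a ∈ T) :
    ∃ S ⊆ T, a ∈ S ∧ D.Reach S a z ∧ ∀ w ∈ S, w ≠ z → a ≠ z ∧ D.Reach (S \ {z}) a w := by
  by_cases haz : a = z
  · subst haz
    exact ⟨{a}, by simpa using ha, rfl, Reach.refl, fun w hw hwa => absurd hw hwa⟩
  refine ⟨insert z {w | D.Reach (T \ {z}) a w ∧ w ∈ T \ {z}} , ?_, ?_, ?_, ?_⟩
  · rintro w (rfl | hw)
    · exact h.mem_of_mem ha
    · exact hw.2.1
  · exact Or.inr ⟨Reach.refl, ha, haz⟩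
  · obtain ⟨w, hw, c, rfl, -, hwc⟩ := h.exists_first (B := {z}) rfl haz
    refine Reach.tail ?_ hwc (Set.mem_insert _ _)
    refine (Reach.induct (A := {w | D.Reach (T \ {c}) a w ∧ w ∈ T \ {c}}) hw
      ⟨Reach.refl, ha, haz⟩ fun u hu v hv huv => ?_).2
    have : v ∈ {w | D.Reach (T \ {c}) a w ∧ w ∈ T \ {c}} := ⟨hu.1.tail huv hv, hv⟩
    exact ⟨this, Or.inr this, huv⟩
  · rintro w (rfl | hw) hwz
    · exact absurd rfl hwz
    · refine ⟨haz, ?_⟩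
      refine (Reach.induct (A := {w | D.Reach (T \ {z}) a w ∧ w ∈ T \ {z}}) hw.1
        ⟨Reach.refl, ha, haz⟩ fun u hu v hv huv => ?_).2
      have : v ∈ {w | D.Reach (T \ {z}) a w ∧ w ∈ T \ {z}} := ⟨hu.1.tail huv hv, hv⟩
      exact ⟨this, ⟨Or.inr this, hv.2⟩, huv⟩

/-- Menger's theorem for two paths between sets. -/
theorem menger_two [Finite V] [Nonempty V] (hsep : ∀ z, ∃ a ∈ A, ∃ b ∈ B, a ≠ z ∧ D.Reach {z}ᶜ a b) :
    ∃ T₁ T₂, Disjoint T₁ T₂ ∧ D.Links A B T₁ ∧ D.Links A B T₂ := by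
  classical
  induction hn : {e : V × V | D.Adj e.1 e.2}.ncard using Nat.strong_induction_on
    generalizing D A B with
  | _ n ih =>
  subst hn
  by_cases hE : ∃ x y, D.Adj x y
  swap
  · have hR : ∀ T a b, D.Reach T a b → a = b := by
      intro T a b h
      rcases h.eq_or_head with h | ⟨w, -, h, -⟩
      · exact h
      · exact absurd ⟨_, _, h⟩ hE
    -- Without arcs all walks are trivial: one vertex of `A ∩ B` is found, and avoiding it produces
    -- a second.
    obtain ⟨a, ha, b, hb, -, h⟩ := hsep (Classical.arbitrary V)
    obtain rfl := hR _ _ _ h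
    obtain ⟨a', ha', b', hb', hne, h'⟩ := hsep a
    obtain rfl := hR _ _ _ h'
    exact ⟨{a}, {a'}, by simpa using hne.symm, ⟨a, ha, a, hb, rfl, Reach.refl⟩,
      ⟨a', ha', a', hb', rfl, Reach.refl⟩⟩
  obtain ⟨x, y, hxy⟩ := hE
  set D' := D.deleteArc x y with hD'
  have hlt : {e : V × V | D'.Adj e.1 e.2}.ncard < {e : V × V | D.Adj e.1 e.2}.ncard := by
    refine Set.ncard_lt_ncard ⟨fun e he => he.1, fun h => ?_⟩ (Set.toFinite _)
    exact (h (a := (x, y)) hxy).2 ⟨rfl, rfl⟩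
  by_cases hsep' : ∀ z, ∃ a ∈ A, ∃ b ∈ B, a ≠ z ∧ D'.Reach {z}ᶜ a b
  · obtain ⟨T₁, T₂, h, ⟨a, ha, b, hb, haT, h1⟩, ⟨a', ha', b', hb', haT', h2⟩⟩ := ih _ hlt hsep' rfl
    exact ⟨T₁, T₂, h, ⟨a, ha, b, hb, haT, h1.of_deleteArc⟩, ⟨a', ha', b', hb', haT', h2.of_deleteArc⟩⟩
  -- Now `z` separates `A` from `B` once the arc `x → y` is removed. In `D'` no vertex separates `A`
  -- from `{z, x}` or `{z, y}` from `B`, so induction gives two pairs of disjoint walks. They are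
  -- glued at `z` and along the removed arc; any unwanted meeting would let a walk of `D'` bypass
  -- `z`.
  push Not at hsep'
  obtain ⟨z, hz⟩ := hsep'
  have hz' : ∀ S : Set V, z ∉ S → ∀ a ∈ A, a ∈ S → ∀ b ∈ B, ¬ D'.Reach S a b := by
    intro S hS a ha haS b hb h
    exact hz a ha b hb (fun h => hS (h ▸ haS)) (h.mono fun w hw hwz => hS (hwz ▸ hw))
  have hvis : ∀ S : Set V, ∀ a ∈ A, a ∈ S → ∀ b ∈ B, D'.Reach S a b →
      z ∈ S ∧ D'.Reach S a z ∧ D'.Reach S z b := by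
    intro S a ha haS b hb h
    by_cases haz : a = z
    · subst haz; exact ⟨haS, Reach.refl, h⟩
    have hzS : z ∈ S := by
      by_contra hzS
      exact hz' S hzS a ha haS b hb h
    have h1 : D'.Reach S a z := by
      by_contra hcon
      refine hz' {w | w ∈ S ∧ D'.Reach S a w} (fun h => hcon h.2) a ha ⟨haS, Reach.refl⟩ b hb ?_
      refine (h.induct (A := {w | w ∈ S ∧ D'.Reach S a w}) ⟨haS, Reach.refl⟩
        fun u hu v hv huv => ?_).2
      have : v ∈ {w | w ∈ S ∧ D'.Reach S a w} := ⟨hv, hu.2.tail huv hv⟩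
      exact ⟨this, this, huv⟩
    refine ⟨hzS, h1, ?_⟩
    by_contra hcon
    have key : D'.Reach (S \ {z}) a b := by
      have : b ∈ {w | ¬ D'.Reach S z w} ∧ D'.Reach (S \ {z}) a b := by
        clear hb
        induction h with
        | refl => exact ⟨hcon, Reach.refl⟩
        | @tail u v _ huv ih' =>
          have h2 : ¬ D'.Reach S z u := fun h => hcon (h.tail huv.1 huv.2)
          refine ⟨hcon, (ih' h2).2.tail huv.1 ⟨huv.2, ?_⟩⟩
          rintro rfl
          exact hcon Reach.refl
      exact this.2
    exact hz' (S \ {z}) (by simp) a ha ⟨haS, haz⟩ b hb key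
  have hP : ∀ s, ∃ a ∈ A, ∃ b ∈ ({z, x} : Set V), a ≠ s ∧ D'.Reach {s}ᶜ a b := by
    intro s
    obtain ⟨a, ha, b, hb, has, h⟩ := hsep s
    rcases h.deleteArc_or (x := x) (y := y) with h | h
    · exact ⟨a, ha, z, by simp, has, (hvis _ a ha has b hb h).2.1⟩
    · exact ⟨a, ha, x, by simp, has, h⟩
  have hQ : ∀ s, ∃ a ∈ ({z, y} : Set V), ∃ b ∈ B, a ≠ s ∧ D'.Reach {s}ᶜ a b := by
    intro s
    obtain ⟨a, ha, b, hb, has, h⟩ := hsep s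
    rcases h.deleteArc_or' (x := x) (y := y) with h | ⟨hy, h⟩
    · obtain ⟨h1, -, h2⟩ := hvis _ a ha has b hb h
      exact ⟨z, by simp, b, hb, h1, h2⟩
    · exact ⟨y, by simp, b, hb, hy, h⟩
  have hP' : ∃ Tz Tx, Disjoint Tz Tx ∧ (∃ a ∈ A, a ∈ Tz ∧ D'.Reach Tz a z) ∧
      ∃ a ∈ A, a ∈ Tx ∧ D'.Reach Tx a x := by
    obtain ⟨T₁, T₂, h, ⟨a, ha, b, hb, haT, h1⟩, ⟨a', ha', b', hb', haT', h2⟩⟩ := ih _ hlt hP rfl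
    have hne : b ≠ b' := by
      rintro rfl
      exact Set.disjoint_left.mp h (h1.mem_of_mem haT) (h2.mem_of_mem haT')
    rcases hb with rfl | rfl <;> rcases hb' with rfl | rfl
    · exact absurd rfl hne
    · exact ⟨T₁, T₂, h, ⟨a, ha, haT, h1⟩, a', ha', haT', h2⟩
    · exact ⟨T₂, T₁, h.symm, ⟨a', ha', haT', h2⟩, a, ha, haT, h1⟩
    · exact absurd rfl hne
  have hQ' : ∃ Tz Ty, Disjoint Tz Ty ∧ (∃ b ∈ B, z ∈ Tz ∧ D'.Reach Tz z b) ∧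
      ∃ b ∈ B, y ∈ Ty ∧ D'.Reach Ty y b := by
    obtain ⟨T₁, T₂, h, ⟨a, ha, b, hb, haT, h1⟩, ⟨a', ha', b', hb', haT', h2⟩⟩ := ih _ hlt hQ rfl
    have hne : a ≠ a' := by
      rintro rfl
      exact Set.disjoint_left.mp h haT haT'
    rcases ha with rfl | rfl <;> rcases ha' with rfl | rfl
    · exact absurd rfl hne
    · exact ⟨T₁, T₂, h, ⟨b, hb, haT, h1⟩, b', hb', haT', h2⟩
    · exact ⟨T₂, T₁, h.symm, ⟨b', hb', haT', h2⟩, b, hb, haT, h1⟩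
    · exact absurd rfl hne
  obtain ⟨Pz, Px, hPd, ⟨a, ha, haT, h1⟩, ⟨a', ha', haT', h2⟩⟩ := hP'
  obtain ⟨Qz, Qy, hQd, ⟨b, hb, hbT, h3⟩, ⟨b', hb', hbT', h4⟩⟩ := hQ'
  obtain ⟨Pz', hPz, haT, h1, h1'⟩ := h1.exists_to haT
  obtain ⟨Qz', hQz, hbT, h3, h3'⟩ := h3.exists_from hbT
  obtain ⟨Px', hPx, haT', h2, h2'⟩ := h2.exists_to haT'
  obtain ⟨Qy', hQy, hbT', h4, h4'⟩ := h4.exists_from hbT'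
  have hPd' := hPd.mono hPz hPx
  have hQd' := hQd.mono hQz hQy
  have hzPx : z ∉ Px' := fun h => Set.disjoint_left.mp hPd' (h1.mem_of_mem haT) h
  have hzQy : z ∉ Qy' := fun h => Set.disjoint_left.mp hQd' hbT h
  have hPx'' : ∀ w ∈ Px', D'.Reach Px' a' w := fun w hw => by
    by_cases hwx : w = x
    · exact hwx ▸ h2
    · exact (h2' w hw hwx).2.mono Set.sdiff_subset
  have hQy'' : ∀ w ∈ Qy', D'.Reach Qy' w b' := fun w hw => by
    by_cases hwy : w = y
    · exact hwy ▸ h4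
    · exact (h4' w hw hwy).mono Set.sdiff_subset
  have hd1 : Disjoint Pz' Qy' := by
    rw [Set.disjoint_left]
    intro w hw hw'
    have hwz : w ≠ z := fun h => hzQy (h ▸ hw')
    obtain ⟨haz, h1'⟩ := h1' w hw hwz
    refine hz' (Pz' \ {z} ∪ Qy') (by simp [hzQy]) a ha (Or.inl ⟨haT, haz⟩) b' hb' ?_
    exact (h1'.mono Set.subset_union_left).trans
      ((hQy'' w hw').mono Set.subset_union_right)
  have hd2 : Disjoint Px' Qz' := by
    rw [Set.disjoint_left]
    intro w hw hw'
    have hwz : w ≠ z := fun h => hzPx (h ▸ hw)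
    refine hz' (Px' ∪ Qz' \ {z}) (by simp [hzPx]) a' ha' (Or.inl haT') b hb ?_
    exact ((hPx'' w hw).mono Set.subset_union_left).trans
      ((h3' w hw' hwz).mono Set.subset_union_right)
  have hd3 : Disjoint Px' Qy' := by
    rw [Set.disjoint_left]
    intro w hw hw'
    refine hz' (Px' ∪ Qy') (by simp [hzPx, hzQy]) a' ha' (Or.inl haT') b' hb' ?_
    exact ((hPx'' w hw).mono Set.subset_union_left).trans
      ((hQy'' w hw').mono Set.subset_union_right)
  refine ⟨Pz' ∪ Qz', Px' ∪ Qy', ?_, ⟨a, ha, b, hb, Or.inl haT, ?_⟩,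
    ⟨a', ha', b', hb', Or.inl haT', ?_⟩⟩
  · simp only [Set.disjoint_union_left, Set.disjoint_union_right]
    exact ⟨⟨hPd', hd2.symm⟩, hd1, hQd'⟩
  · exact (h1.of_deleteArc.mono Set.subset_union_left).trans
      (h3.of_deleteArc.mono Set.subset_union_right)
  · exact ((h2.of_deleteArc.mono Set.subset_union_left).tail hxy (Or.inr hbT')).trans
      (h4.of_deleteArc.mono Set.subset_union_right)

/-- `T` is a union of interiors of paths from `a` to `d`. -/
structure Thick (D : Digraph V) (a d : V) (T : Set V) : Prop where
  start : a ∉ T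
  finish : d ∉ T
  nonempty : T.Nonempty
  from_start : ∀ w ∈ T, D.Reach T a w
  to_finish : ∀ w ∈ T, D.Reach (insert d T) w d

/-- `S` retains the vertices of `T` that lie on a walk from `a` to `d` through `T`. -/
theorem exists_thick (ha : a ∉ T) (hd : d ∉ T) (hw : w ∈ T) (h1 : D.Reach T a w)
    (h2 : D.Reach (insert d T) w d) : ∃ S ⊆ T, w ∈ S ∧ D.Thick a d S := by
  set S : Set V := {w | w ∈ T ∧ D.Reach T a w ∧ D.Reach (insert d T) w d} with hS
  have hST : S ⊆ T := fun w hw => hw.1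
  refine ⟨S, hST, ⟨hw, h1, h2⟩, fun h => ha h.1, fun h => hd h.1, ⟨w, hw, h1, h2⟩, ?_, ?_⟩
  · rintro w ⟨hw, h1, h2⟩
    induction h1 with
    | refl => exact Reach.refl
    | @tail u v hu huv ih =>
      rcases Reach.eq_or_mem hu with h | h
      · subst h
        exact Reach.of_adj huv.1 ⟨hw, Reach.of_adj huv.1 hw, h2⟩
      · exact (ih h (Reach.head huv.1 (Or.inr hw) h2)).tail huv.1 ⟨hw, Reach.tail hu huv.1 hw, h2⟩
  · rintro w ⟨hw, h1, h2⟩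
    have h3 : d ∈ S ∪ {d} ∧ D.Reach (insert d S) w d := by
      induction h2 using Relation.ReflTransGen.head_induction_on with
      | refl => exact ⟨Or.inr rfl, Reach.refl⟩
      | @head u v huv h ih =>
        rcases huv.2 with rfl | hv
        · exact ⟨Or.inr rfl, Reach.of_adj_insert huv.1⟩
        · have h4 := h1.tail huv.1 hv
          exact ⟨Or.inr rfl, Reach.head huv.1 (Or.inr ⟨hv, h4, h⟩) (ih hv h4).2⟩
    exact h3.2

/-- Either a single vertex (besides a possible arc) separates `d` from `a`, or there are two
internally disjoint paths from `a` to `d`. -/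
theorem separator_or_thick [Finite V] (had : a ≠ d) :
    (∃ (Z : Set V) (z : V), a ∈ Z ∧ d ∉ Z ∧ z ≠ d ∧
      (∀ u ∈ Z, ∀ w, D.Adj u w → w ∈ Z ∨ w = z ∨ (u = a ∧ w = d)) ∧
      ∀ w ∈ Z, w ≠ a → ∃ u ∈ Z, D.Adj u w) ∨
    ∃ T₁ T₂, Disjoint T₁ T₂ ∧ D.Thick a d T₁ ∧ D.Thick a d T₂ := by
  have : Nonempty V := ⟨a⟩
  by_cases h : ∃ z, z ≠ d ∧ ¬ (D.deleteArc a d).Reach {z}ᶜ a d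
  · left
    obtain ⟨z, hzd, hz⟩ := h
    refine ⟨{v : V | (D.deleteArc a d).Reach {z}ᶜ a v}, z, Reach.refl, hz, hzd, ?_, ?_⟩
    · intro u hu w huw
      by_cases hwz : w = z
      · exact Or.inr (Or.inl hwz)
      · by_cases h : u = a ∧ w = d
        · exact Or.inr (Or.inr h)
        · exact Or.inl (Reach.tail hu ⟨huw, h⟩ hwz)
    · intro w hw hwa
      cases hw with
      | refl => exact absurd rfl hwa
      | tail hu h => exact ⟨_, hu, h.1.1⟩
  · right
    push Not at h
    -- Menger is applied between the out-neighbours of `a` and the in-neighbours of `d`, with `a`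
    -- and `d` isolated, so that the disjoint walks serve as interiors.
    set D' : Digraph V := ⟨fun u v => D.Adj u v ∧ u ∉ ({a, d} : Set V) ∧ v ∉ ({a, d} : Set V)⟩
    set A := {w | D.Adj a w ∧ w ∉ ({a, d} : Set V)}
    set B := {w | D.Adj w d ∧ w ∉ ({a, d} : Set V)}
    have key : ∀ S : Set V, (D.deleteArc a d).Reach S a d → ∃ u ∈ A, ∃ v ∈ B, u ∈ S ∧ D'.Reach S u v := by
      intro S hS
      obtain ⟨a', ha', d', hd', -, h⟩ := hS.exists_exit_entry (A := {a}) (B := {d}) rfl rfl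
        (by simpa using had)
      rw [Set.mem_singleton_iff] at ha' hd'
      rw [ha', hd'] at h
      obtain ⟨v, hv, d', hd', -, hvd⟩ := h.exists_first (B := {d}) rfl (by simpa using had)
      rw [Set.mem_singleton_iff] at hd'
      rw [hd'] at hvd
      rcases hv.eq_or_head with rfl | ⟨u, hu, hau, huv⟩
      · exact absurd ⟨rfl, rfl⟩ hvd.2
      · have hcl : ∀ w, w ∈ insert d (S \ ({a} ∪ {d})) \ {d} → w ∈ S ∧ w ∉ ({a, d} : Set V) := by
          rintro w ⟨rfl | hw, hwd⟩
          · exact absurd rfl hwd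
          · exact ⟨hw.1, hw.2⟩
        obtain ⟨h1, h2⟩ := Reach.induct (D' := D') (S := S) (A := {w | w ∉ ({a, d} : Set V)}) huv
          (hcl u hu).2 fun x hx y hy hxy => ⟨(hcl y hy).2, (hcl y hy).1, hxy.1, hx, (hcl y hy).2⟩
        exact ⟨u, ⟨hau.1, (hcl u hu).2⟩, v, ⟨hvd.1, h1⟩, (hcl u hu).1, h2⟩
    have hsep : ∀ z, ∃ u ∈ A, ∃ v ∈ B, u ≠ z ∧ D'.Reach {z}ᶜ u v := by
      intro z
      by_cases hz : z = d
      · subst hz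
        obtain ⟨u, hu, v, hv, -, h⟩ := key _ (h a had)
        refine ⟨u, hu, v, hv, fun h => hu.2 (Or.inr h), ?_⟩
        exact (h.induct (Set.mem_univ _) fun x _ y _ hxy =>
          ⟨Set.mem_univ _, fun h => hxy.2.2 (Or.inr h), hxy⟩).2
      · exact key _ (h z hz)
    obtain ⟨T₁, T₂, hT, ⟨u₁, hu₁, v₁, hv₁, h1, h1'⟩, ⟨u₂, hu₂, v₂, hv₂, h2, h2'⟩⟩ := menger_two hsep
    have final : ∀ T u v, u ∈ A → v ∈ B → u ∈ T → D'.Reach T u v → ∃ S ⊆ T, D.Thick a d S := by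
      intro T u v hu hv huT h
      have h1 : D.Reach (T \ {a, d}) u v := by
        refine (Reach.induct h (Set.mem_univ u) ?_).2
        exact fun x _ y hy hxy => ⟨Set.mem_univ _, ⟨hy, hxy.2.2⟩, hxy.1⟩
      obtain ⟨S, hS, -, hS'⟩ := exists_thick (D := D) (T := T \ {a, d}) (a := a) (d := d) (w := u)
        (by simp) (by simp) ⟨huT, hu.2⟩ (Reach.of_adj hu.1 ⟨huT, hu.2⟩)
        ((h1.mono (Set.subset_insert _ _)).tail hv.1 (Set.mem_insert _ _))
      exact ⟨S, hS.trans Set.sdiff_subset, hS'⟩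
    obtain ⟨S₁, hS₁, h1⟩ := final _ _ _ hu₁ hv₁ h1 h1'
    obtain ⟨S₂, hS₂, h2⟩ := final _ _ _ hu₂ hv₂ h2 h2'
    exact ⟨S₁, S₂, hT.mono hS₁ hS₂, h1, h2⟩

end Menger

/-! ### Transitive subdivisions: recognition, lifting, and separators -/

section Linked

variable {V : Type*} {D D' : Digraph V} {T T₁ T₂ W : Set V} {a b d u v w : V}

/-- The arc from `a` to `d` is the first-to-last arc of a subdivided transitive tournament: besides
it there are two disjoint paths from `a` to `d`, and a walk joining them. -/
def HasTransitive (D : Digraph V) (a d : V) : Prop :=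
  a ≠ d ∧ D.Adj a d ∧ ∃ T₁ T₂, Disjoint T₁ T₂ ∧ D.Thick a d T₁ ∧ D.Thick a d T₂ ∧
    ∃ u ∈ T₁, ∃ v ∈ T₂, D.Reach {a, d}ᶜ u v

theorem HasTransitive.mono (h : D'.HasTransitive a d) (hD : ∀ x y, D'.Adj x y → D.Adj x y) :
    D.HasTransitive a d := by
  obtain ⟨h0, h1, T₁, T₂, h2, h3, h4, u, hu, v, hv, h5⟩ := h
  have : ∀ T, D'.Thick a d T → D.Thick a d T := fun T h => ⟨h.start, h.finish, h.nonempty,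
    fun w hw => (h.from_start w hw).mono_adj subset_rfl hD,
    fun w hw => (h.to_finish w hw).mono_adj subset_rfl hD⟩
  exact ⟨h0, hD _ _ h1, T₁, T₂, h2, this _ h3, this _ h4, u, hu, v, hv,
    h5.mono_adj subset_rfl hD⟩

theorem Thick.exists_first (h : D.Thick a d T) : ∃ w ∈ T, D.Adj a w := by
  obtain ⟨w, hw⟩ := h.nonempty
  rcases (h.from_start w hw).eq_or_head with rfl | ⟨x, hx, hax, -⟩
  · exact absurd hw h.start
  · exact ⟨x, hx, hax⟩

theorem Thick.exists_last (h : D.Thick a d T) : ∃ w ∈ T, D.Adj w d := by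
  obtain ⟨w, hw⟩ := h.nonempty
  obtain ⟨x, hx, _, rfl, -, hxd⟩ := (h.to_finish w hw).exists_first (B := {d}) rfl
    (fun hwd => h.finish (Set.mem_singleton_iff.mp hwd ▸ hw))
  refine ⟨x, ?_, hxd⟩
  rcases hx.eq_or_mem with rfl | hx
  · exact hw
  · exact (Set.mem_insert_iff.mp hx.1).resolve_left hx.2

theorem Reach.exists_split {L : List V} (hch : (a :: (L ++ [d])).IsChain D.Adj) (hn : L.Nodup)
    (hb : b ∈ L) : ∃ P Q : Set V, Disjoint P Q ∧ b ∉ P ∧ b ∉ Q ∧ (∀ x ∈ P, x ∈ L) ∧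
      (∀ x ∈ Q, x ∈ L) ∧ D.Reach (insert b P) a b ∧ D.Reach (insert d Q) b d := by
  obtain ⟨L₁, L₂, rfl⟩ := List.append_of_mem hb
  rw [List.nodup_append] at hn
  obtain ⟨-, hn2, hn3⟩ := hn
  refine ⟨{x | x ∈ L₁}, {x | x ∈ L₂}, ?_, fun h => hn3 _ h b (by simp) rfl,
    (List.nodup_cons.mp hn2).1, fun x hx => ?_, fun x hx => ?_, ?_, ?_⟩
  · exact Set.disjoint_left.mpr fun x hx hx' => hn3 x hx x (by simp; exact Or.inr hx') rfl
  · have hx : x ∈ L₁ := hx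
    simp [hx]
  · have hx : x ∈ L₂ := hx
    simp [hx]
  · have h1 : (a :: (L₁ ++ [b])).IsChain D.Adj := by
      refine List.IsChain.left_of_append (l₂ := L₂ ++ [d]) ?_
      simpa using hch
    refine Reach.of_isChain h1 ?_ _ (by simp)
    intro x hx
    simp at hx ⊢
    tauto
  · have h1 : (b :: (L₂ ++ [d])).IsChain D.Adj := by
      refine List.IsChain.right_of_append (l₁ := a :: L₁) ?_
      simpa using hch
    refine Reach.of_isChain h1 ?_ _ (by simp)
    intro x hx
    simp at hx ⊢
    tauto

/-- Take a path through `T₁` that begins with a vertex leading to `u`, and one through `T₂` that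
ends with a vertex reached from `v`. On the walk connecting these two vertices, the last exit `b`
from the first path before the first entry `c` to the second gives the middle branch vertices. -/
theorem HasTransitive.hasModel (h : D.HasTransitive a d) : D.HasModel transitiveArcs := by
  obtain ⟨had, h1, T₁, T₂, hT, hT₁, hT₂, u, hu, v, hv, h5⟩ := h
  have haT₁ := hT₁.start
  have haT₂ := hT₂.start
  have hdT₁ := hT₁.finish
  have hdT₂ := hT₂.finish
  have hsub : ∀ T : Set V, a ∉ T → d ∉ T → T ⊆ {a, d}ᶜ := by
    rintro T h1 h2 x hx (rfl | rfl)
    · exact h1 hx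
    · exact h2 hx
  -- the first path starts with a vertex that reaches `u`
  obtain ⟨w₁, hw₁, haw₁, hw₁u⟩ : ∃ w ∈ T₁, D.Adj a w ∧ D.Reach T₁ w u := by
    rcases (hT₁.from_start u hu).eq_or_head with rfl | h
    · exact absurd hu hT₁.start
    · exact h
  obtain ⟨w₂, hw₂, hvw₂, hw₂d⟩ : ∃ w ∈ T₂, D.Reach T₂ v w ∧ D.Adj w d := by
    obtain ⟨x, hx, _, rfl, -, hxd⟩ := (hT₂.to_finish v hv).exists_first (B := {d}) rfl
      (fun hvd => hT₂.finish (Set.mem_singleton_iff.mp hvd ▸ hv))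
    have hx' : D.Reach T₂ v x := hx.mono fun y hy => hy.1.resolve_left hy.2
    exact ⟨x, hx'.mem_of_mem hv, hx', hxd⟩
  have hcross : D.Reach {a, d}ᶜ w₁ w₂ := (hw₁u.mono (hsub _ haT₁ hdT₁)).trans
    (h5.trans (hvw₂.mono (hsub _ haT₂ hdT₂)))
  obtain ⟨l₁, hl₁, hl₁n, hl₁T⟩ := (hT₁.to_finish w₁ hw₁).exists_interior
    (fun h => hT₁.finish (h ▸ hw₁))
  obtain ⟨l₂, hl₂, hl₂n, hl₂T⟩ := ((hT₂.from_start w₂ hw₂).mono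
    (Set.subset_insert w₂ T₂)).exists_interior (fun h => hT₂.start (h ▸ hw₂))
  set L₁ := w₁ :: l₁
  set L₂ := l₂ ++ [w₂]
  have hL₁ : (a :: (L₁ ++ [d])).IsChain D.Adj := by simpa [L₁, haw₁] using hl₁
  have hL₁n : L₁.Nodup := by
    have : (L₁ ++ [d]).Nodup := hl₁n
    exact (List.nodup_append.mp this).1
  have hL₂ : (a :: (L₂ ++ [d])).IsChain D.Adj := by
    rw [← List.cons_append, List.isChain_append]
    refine ⟨hl₂, by simp, ?_⟩
    intro x hx y hy
    have hx' : (a :: l₂ ++ [w₂]).getLast? = some x := hx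
    rw [List.getLast?_append] at hx'
    simp at hx' hy
    subst hx' hy
    exact hw₂d
  have hL₂n : L₂.Nodup := (List.nodup_cons.mp hl₂n).2
  have hL₁T : ∀ x ∈ L₁, x ∈ T₁ := by
    intro x hx
    rcases List.mem_cons.mp hx with rfl | hx
    · exact hw₁
    · exact hl₁T x hx
  have hL₂T : ∀ x ∈ L₂, x ∈ T₂ := by
    intro x hx
    rcases List.mem_append.mp hx with hx | hx
    · exact hl₂T x hx
    · simp at hx; exact hx ▸ hw₂
  have hLL : ∀ x ∈ L₁, x ∉ L₂ := fun x hx hx' =>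
    Set.disjoint_left.mp hT (hL₁T x hx) (hL₂T x hx')
  obtain ⟨b, hb, c, hc, -, hbc⟩ := hcross.exists_exit_entry (A := {x | x ∈ L₁})
    (B := {x | x ∈ L₂}) (by simp [L₁]) (by simp [L₂]) (Set.disjoint_left.mpr hLL)
  have hb : b ∈ L₁ := hb
  have hc : c ∈ L₂ := hc
  obtain ⟨P₁, Q₁, hPQ₁, hbP, hbQ, hP₁, hQ₁, hab, hbd⟩ := Reach.exists_split hL₁ hL₁n hb
  obtain ⟨P₂, Q₂, hPQ₂, hcP, hcQ, hP₂, hQ₂, hac, hcd⟩ := Reach.exists_split hL₂ hL₂n hc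
  have hd1 : ∀ P Q : Set V, (∀ x ∈ P, x ∈ L₁) → (∀ x ∈ Q, x ∈ L₂) → Disjoint P Q :=
    fun P Q hP hQ => Set.disjoint_left.mpr fun x hx hx' => hLL x (hP x hx) (hQ x hx')
  have hd2 : ∀ P : Set V, (∀ x ∈ P, x ∈ L₁) →
      Disjoint P ({a, d}ᶜ \ ({x | x ∈ L₁} ∪ {x | x ∈ L₂})) :=
    fun P hP => Set.disjoint_left.mpr fun x hx hx' => hx'.2 (Or.inl (hP x hx))
  have hd3 : ∀ P : Set V, (∀ x ∈ P, x ∈ L₂) →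
      Disjoint P ({a, d}ᶜ \ ({x | x ∈ L₁} ∪ {x | x ∈ L₂})) :=
    fun P hP => Set.disjoint_left.mpr fun x hx hx' => hx'.2 (Or.inr (hP x hx))
  have hbT := hL₁T b hb
  have hcT := hL₂T c hc
  have hba : b ≠ a := by rintro rfl; exact haT₁ hbT
  have hbd' : b ≠ d := by rintro rfl; exact hdT₁ hbT
  have hca : c ≠ a := by rintro rfl; exact haT₂ hcT
  have hcd' : c ≠ d := by rintro rfl; exact hdT₂ hcT
  have hbc' : b ≠ c := by rintro rfl; exact hLL _ hb hc
  refine ⟨![a, b, c, d], ?_, ![P₁, P₂, ∅, {a, d}ᶜ \ ({x | x ∈ L₁} ∪ {x | x ∈ L₂}), Q₁, Q₂],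
    ?_, ?_, ?_⟩
  · intro i j hij
    fin_cases i <;> fin_cases j <;> simp at hij ⊢
    · exact hba hij.symm
    · exact hca hij.symm
    · exact had hij
    · exact hba hij
    · exact hbc' hij
    · exact hbd' hij
    · exact hca hij
    · exact hbc' hij.symm
    · exact hcd' hij
    · exact had hij.symm
    · exact hbd' hij.symm
    · exact hcd' hij.symm
  · intro i j hij
    fin_cases i <;> fin_cases j <;> simp only [Fin.reduceFinMk] at hij ⊢ <;>
      first
      | exact absurd hij (by decide)
      | exact hd1 _ _ hP₁ hP₂ | exact hPQ₁ | exact hPQ₂ | exact hd2 _ hP₁ | exact hd3 _ hP₂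
      | exact (hd2 _ hQ₁).symm | exact (hd3 _ hQ₂).symm | exact hd1 _ _ hP₁ hQ₂
      | exact (hd1 _ _ hQ₁ hP₂).symm | exact hd1 _ _ hQ₁ hQ₂
      | exact Set.disjoint_empty _ | exact Set.empty_disjoint _
  · intro i k
    fin_cases i <;> fin_cases k <;> first
      | exact fun h => haT₁ (hL₁T _ (hP₁ _ h)) | exact fun h => haT₁ (hL₁T _ (hQ₁ _ h))
      | exact fun h => hdT₁ (hL₁T _ (hP₁ _ h)) | exact fun h => hdT₁ (hL₁T _ (hQ₁ _ h))
      | exact fun h => haT₂ (hL₂T _ (hP₂ _ h)) | exact fun h => haT₂ (hL₂T _ (hQ₂ _ h))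
      | exact fun h => hdT₂ (hL₂T _ (hP₂ _ h)) | exact fun h => hdT₂ (hL₂T _ (hQ₂ _ h))
      | exact hbP | exact hbQ | exact hcP | exact hcQ
      | exact fun h => hLL _ hb (hP₂ _ h) | exact fun h => hLL _ hb (hQ₂ _ h)
      | exact fun h => hLL _ (hP₁ _ h) hc | exact fun h => hLL _ (hQ₁ _ h) hc
      | exact Set.notMem_empty _
      | exact fun h => h.1 (Or.inl rfl) | exact fun h => h.1 (Or.inr rfl)
      | exact fun h => h.2 (Or.inl hb) | exact fun h => h.2 (Or.inr hc)
  · intro i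
    fin_cases i
    · exact hab
    · exact hac
    · exact Reach.of_adj_insert h1
    · exact hbc
    · exact hbd
    · exact hcd

theorem Reach.simulate {A S : Set V} (h : D'.Reach T u v) (hu : u ∈ A)
    (hA : ∀ x ∈ A, ∀ y ∈ T, D'.Adj x y → y ∈ A ∧ D.Reach S x y) : v ∈ A ∧ D.Reach S u v := by
  induction h with
  | refl => exact ⟨hu, Reach.refl⟩
  | tail _ h ih =>
    obtain ⟨h1, h2⟩ := hA _ ih.1 _ h.2 h.1
    exact ⟨h1, ih.2.trans h2⟩

/-- If `D` arises from `D'` by expanding the vertices in `W`, transitive tournaments lift. -/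
theorem HasTransitive.lift (h : D'.HasTransitive a d) (had : D.Adj a d) (haW : a ∉ W)
    (hdis : ∀ T₁ T₂, Disjoint T₁ T₂ → D'.Thick a d T₁ → D'.Thick a d T₂ →
      (T₁ ∩ W).Nonempty → ¬ (T₂ ∩ W).Nonempty)
    (hadj : ∀ x y, x ≠ d → y ≠ a → D'.Adj x y → D.Adj x y ∨
      ((x ∈ W ∨ (y ∈ W ∧ y ≠ d)) ∧ D.Reach (insert y (W \ {d})) x y)) :
    D.HasTransitive a d := by
  classical
  obtain ⟨hne, -, T₁, T₂, hT, hT₁, hT₂, u, hu, v, hv, h5⟩ := h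
  have key : ∀ T, D'.Thick a d T → ∀ w ∈ T, ∃ S, w ∈ S ∧ (∀ x ∈ S, x ∉ T → x ∈ W ∧ (T ∩ W).Nonempty) ∧
      D.Thick a d S := by
    intro T hT w hw
    -- Only a thick set that meets `W` is enlarged; by `hdis` this concerns at most one of the two,
    -- so they remain disjoint.
    set E : Set V := {x | x ∈ T ∨ ((T ∩ W).Nonempty ∧ x ∈ W \ {d})} with hE
    have hTE : T ⊆ E := fun x hx => Or.inl hx
    have hWE : ∀ x ∈ T, x ∈ W → W \ {d} ⊆ E := fun x hx hxW y hy => Or.inr ⟨⟨x, hx, hxW⟩, hy⟩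
    have hstep : ∀ x ∈ insert a T, ∀ y ∈ T, D'.Adj x y → D.Reach E x y := by
      intro x hx y hy hxy
      have hxd : x ≠ d := by
        rintro rfl
        rcases hx with rfl | hx
        · exact hne rfl
        · exact hT.finish hx
      rcases hadj x y hxd (fun h => hT.start (h ▸ hy)) hxy with h | ⟨h, h'⟩
      · exact Reach.of_adj h (hTE hy)
      · refine h'.mono (Set.insert_subset (hTE hy) ?_)
        rcases h with h | h
        · refine hWE x (hx.resolve_left ?_) h
          rintro rfl
          exact haW h
        · exact hWE y hy h.1
    have h1 : D.Reach E a w := (Reach.simulate (A := insert a T) (hT.from_start w hw) (Or.inl rfl)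
      fun x hx y hy hxy => ⟨Or.inr hy, hstep x hx y hy hxy⟩).2
    have h2 : D.Reach (insert d E) w d := by
      obtain ⟨x, hx, _, rfl, -, hxd⟩ := (hT.to_finish w hw).exists_first (B := {d}) rfl
        (fun h => hT.finish (Set.mem_singleton_iff.mp h ▸ hw))
      obtain ⟨hxT, h3⟩ := Reach.simulate (D := D) (A := T) (S := E) hx hw fun x hx y hy hxy => by
        have hy' := hy.1.resolve_left hy.2
        exact ⟨hy', hstep x (Or.inr hx) y hy' hxy⟩
      refine (h3.mono (Set.subset_insert _ _)).trans ?_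
      rcases hadj x _ (fun h => hT.finish (h ▸ hxT)) hne.symm hxd with h | ⟨h, h'⟩
      · exact Reach.of_adj_insert h
      · exact h'.mono (Set.insert_subset_insert (hWE x hxT (h.resolve_right fun h => h.2 rfl)))
    obtain ⟨S, hS, hwS, hS'⟩ := exists_thick (T := E) (a := a) (d := d)
      (fun h => h.elim hT.start fun h => haW h.2.1) (fun h => h.elim hT.finish fun h => h.2.2 rfl)
      (hTE hw) h1 h2
    exact ⟨S, hwS, fun x hx hxT => ⟨((hS hx).resolve_left hxT).2.1, ((hS hx).resolve_left hxT).1⟩,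
      hS'⟩
  obtain ⟨S₁, huS, hS₁, hS₁'⟩ := key T₁ hT₁ u hu
  obtain ⟨S₂, hvS, hS₂, hS₂'⟩ := key T₂ hT₂ v hv
  have hnot := hdis T₁ T₂ hT hT₁ hT₂
  refine ⟨hne, had, S₁, S₂, ?_, hS₁', hS₂', u, huS, v, hvS, ?_⟩
  · rw [Set.disjoint_left]
    intro x hx hx'
    by_cases hx1 : x ∈ T₁
    · obtain ⟨hxW, h⟩ := hS₂ x hx' (Set.disjoint_left.mp hT hx1)
      exact hnot ⟨x, hx1, hxW⟩ h
    · obtain ⟨hxW, h⟩ := hS₁ x hx hx1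
      by_cases hx2 : x ∈ T₂
      · exact hnot h ⟨x, hx2, hxW⟩
      · exact hnot h (hS₂ x hx' hx2).2
  · refine (Reach.simulate (A := {a, d}ᶜ) h5 (fun h => ?_) fun x hx y hy hxy => ⟨hy, ?_⟩).2
    · rcases h with rfl | rfl
      · exact hT₁.start hu
      · exact hT₁.finish hu
    · rcases hadj x y (fun h => hx (Or.inr h)) (fun h => hy (Or.inl h)) hxy with h | ⟨-, h⟩
      · exact Reach.of_adj h hy
      · refine h.mono (Set.insert_subset hy ?_)
        rintro z hz (rfl | rfl)
        · exact haW hz.1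
        · exact hz.2 rfl

/-- If the arc from `a` to `d` is not the first-to-last arc of a subdivided transitive tournament,
then, under mild connectivity assumptions, a vertex separates `a` from `d` apart from this arc. -/
theorem exists_separator [Finite V] {U : Set V} {o : V} (hn : ¬ D.HasTransitive a d) (hne : a ≠ d)
    (had : D.Adj a d) (hU : ∀ u w, D.Adj u w → w ∈ U)
    (H1 : ∀ X ⊆ U, X.Nonempty → a ∉ X → d ∉ X → o ∉ X →
      ¬ ∀ u ∈ X, ∀ w, D.Adj u w → w ∈ X ∨ w = a ∨ w = d)
    (hoa : o ≠ a) (hod : o ≠ d) (H2 : D.Reach {a}ᶜ o d) :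
    ∃ (Z : Set V) (z : V), a ∈ Z ∧ d ∉ Z ∧ z ≠ d ∧
      (∀ u ∈ Z, ∀ w, D.Adj u w → w ∈ Z ∨ w = z ∨ (u = a ∧ w = d)) ∧
      ∀ w ∈ Z, w ≠ a → ∃ u ∈ Z, D.Adj u w := by
  rcases separator_or_thick (D := D) hne with h | ⟨T₁, T₂, hT, hT₁, hT₂⟩
  · exact h
  exfalso
  have hsub : ∀ T, D.Thick a d T → T ⊆ {a, d}ᶜ := by
    rintro T h x hx (rfl | rfl)
    · exact h.start hx
    · exact h.finish hx
  have hoR : ∀ T, D.Thick a d T → ∃ u ∈ T, D.Reach {a, d}ᶜ u o := by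
    intro T hT
    by_contra hcon
    obtain ⟨w, hw⟩ := hT.nonempty
    have hX : {w | ∃ u ∈ T, D.Reach {a, d}ᶜ u w} ⊆ {a, d}ᶜ := by
      rintro w ⟨u, hu, h⟩
      exact h.mem_of_mem (hsub T hT hu)
    refine H1 {w | ∃ u ∈ T, D.Reach {a, d}ᶜ u w} ?_ ⟨w, w, hw, Reach.refl⟩
      (fun h => hX h (Or.inl rfl)) (fun h => hX h (Or.inr rfl)) hcon ?_
    · rintro w ⟨u, hu, h⟩
      rcases Relation.ReflTransGen.cases_tail h with rfl | ⟨x, -, hx⟩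
      · rcases Relation.ReflTransGen.cases_tail (hT.from_start w hu) with h | ⟨x, -, hx⟩
        · exact absurd (h ▸ hu) hT.start
        · exact hU _ _ hx.1
      · exact hU _ _ hx.1
    · rintro u ⟨t, ht, h⟩ w huw
      by_cases hw : w ∈ ({a, d} : Set V)
      · exact Or.inr hw
      · exact Or.inl ⟨t, ht, h.tail huw hw⟩
  obtain ⟨u₁, hu₁, h1⟩ := hoR T₁ hT₁
  obtain ⟨u₂, hu₂, h2⟩ := hoR T₂ hT₂
  set R : Set V := {w | ∃ u ∈ T₁, D.Reach {a, d}ᶜ u w} with hR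
  have hTR : T₁ ⊆ R := fun w hw => ⟨w, hw, Reach.refl⟩
  have hRc : R ⊆ {a, d}ᶜ := by
    rintro w ⟨u, hu, h⟩
    exact h.mem_of_mem (hsub T₁ hT₁ hu)
  have hstay : ∀ w ∈ R, ∀ x, D.Reach {a, d}ᶜ w x → D.Reach R w x := by
    intro w hw x h
    refine (h.induct (A := R) hw ?_).2
    rintro y ⟨t, ht, hty⟩ v hv hyv
    have : v ∈ R := ⟨t, ht, hty.tail hyv hv⟩
    exact ⟨this, this, hyv⟩
  by_cases hRT : Disjoint R T₂
  swap
  · obtain ⟨w, ⟨u, hu, h⟩, hw⟩ := Set.not_disjoint_iff.mp hRT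
    exact hn ⟨hne, had, T₁, T₂, hT, hT₁, hT₂, u, hu, w, hw, h⟩
  have hoR : o ∈ R := ⟨u₁, hu₁, h1⟩
  obtain ⟨x, hx, _, rfl, -, hxd⟩ := H2.exists_first (B := {d}) rfl hod
  have hox : D.Reach R o x := hstay o hoR x (hx.mono fun y hy h => by
    rcases h with rfl | rfl
    · exact hy.1 rfl
    · exact hy.2 rfl)
  -- When `R` misses `T₂`, a walk from `o` to `d` runs inside `R` and yields a thick set through
  -- `o`. Since `T₂` also leads to `o`, the pair `T₂`, `S` is joined.
  obtain ⟨S, hS, hoS, hS'⟩ := exists_thick (T := R) (a := a) (fun h => hRc h (Or.inl rfl))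
    (fun h => hRc h (Or.inr rfl)) hoR
    (((hT₁.from_start u₁ hu₁).mono hTR).trans (hstay u₁ (hTR hu₁) o h1))
    ((hox.mono (Set.subset_insert _ _)).tail hxd (Set.mem_insert _ _))
  exact hn ⟨hne, had, T₂, S, hRT.symm.mono_right hS, hT₂, hS', u₂, hu₂, o, hoS, h2⟩

end Linked

end Digraph

namespace Digraph

/-! ### Minimal configurations: reductions and uncrossing -/

section Reduction

variable {V : Type*} {D : Digraph V} {R X : Set V} {a b c d p q s t u v w x y z : V} {n : ℕ}

theorem HasTransitive.exists_out (h : D.HasTransitive a d) : ∃ w, D.Adj a w ∧ w ≠ d := by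
  obtain ⟨-, -, T₁, -, -, h, -⟩ := h
  obtain ⟨w, hw, h'⟩ := h.exists_first
  exact ⟨w, h', fun e => h.finish (e ▸ hw)⟩

theorem HasTransitive.exists_in (h : D.HasTransitive a d) :
    ∃ v w, v ≠ w ∧ v ≠ a ∧ w ≠ a ∧ D.Adj v d ∧ D.Adj w d := by
  obtain ⟨-, -, T₁, T₂, hT, h1, h2, -⟩ := h
  obtain ⟨v, hv, h3⟩ := h1.exists_last
  obtain ⟨w, hw, h4⟩ := h2.exists_last
  exact ⟨v, w, fun e => Set.disjoint_left.mp hT hv (e ▸ hw), fun e => h1.start (e ▸ hv),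
    fun e => h2.start (e ▸ hw), h3, h4⟩

theorem Thick.exists_in {T : Set V} (h : D.Thick a d T) (hw : w ∈ T) : ∃ u, D.Adj u w := by
  rcases Relation.ReflTransGen.cases_tail (h.from_start w hw) with h' | ⟨u, -, hu⟩
  · exact absurd (h' ▸ hw) h.start
  · exact ⟨u, hu.1⟩

/-- A digraph on `R ∪ {p, q}` in which the vertices of `R` have out-degree at least three, while
`p` and `q` have a single out-neighbour each, `q` and `x`. -/
structure Config (D : Digraph V) (R : Set V) (p q x : V) : Prop where
  ne : p ≠ q
  p_notMem : p ∉ R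
  q_notMem : q ∉ R
  x_mem : x ∈ R
  adj_p : ∀ w, D.Adj p w ↔ w = q
  adj_q : ∀ w, D.Adj q w ↔ w = x
  tail : ∀ u w, D.Adj u w → u ∈ R ∨ u = p ∨ u = q
  head : ∀ u w, D.Adj u w → w ∈ R ∨ w = p ∨ w = q
  loopless : ∀ u ∈ R, ¬ D.Adj u u
  three : ∀ u ∈ R, D.ThreeOut u

/-- Contracting the outside of `X` to a path with two vertices. -/
theorem exists_hasTransitive_of_reduction
    (ih : ∀ (D' : Digraph V) X p q x, D'.Config X p q x → X.ncard < n →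
      ∃ a d, D'.HasTransitive a d)
    (hX : X.ncard < n) (h3 : ∀ u ∈ X, D.ThreeOut u) (hl : ∀ u ∈ X, ¬ D.Adj u u) (hst : s ≠ t)
    (hs : s ∉ X) (ht : t ∉ X) (hout : ∀ u ∈ X, ∀ w, D.Adj u w → w ∈ X ∨ w = s ∨ w = t)
    (hA : D.Reach Xᶜ s t) (hy : y ∈ X)
    (hB : D.Reach (insert y (Xᶜ \ {s})) t y ∨ (D.Reach (insert y Xᶜ) t y ∧
      ¬ ∃ u ∈ X, ∃ v ∈ X, ∃ w ∈ X, u ≠ v ∧ u ≠ w ∧ v ≠ w ∧ D.Adj u s ∧ D.Adj v s ∧ D.Adj w s)) :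
    ∃ a ∈ X, ∃ d, (d ∈ X ∨ d = s ∨ d = t) ∧ D.HasTransitive a d ∧
      (d = s → ∃ u ∈ X, ∃ v ∈ X, ∃ w ∈ X, u ≠ v ∧ u ≠ w ∧ v ≠ w ∧
        D.Adj u s ∧ D.Adj v s ∧ D.Adj w s) ∧
      (d = t → ∃ u ∈ X, ∃ v ∈ X, u ≠ v ∧ D.Adj u t ∧ D.Adj v t) := by
  set D' : Digraph V := ⟨fun u w => (u ∈ X ∧ D.Adj u w) ∨ (u = s ∧ w = t) ∨ (u = t ∧ w = y)⟩
    with hD'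
  have hX' : ∀ u ∈ X, ∀ w, D'.Adj u w ↔ D.Adj u w := by
    intro u hu w
    constructor
    · rintro (h | ⟨rfl, -⟩ | ⟨rfl, -⟩)
      · exact h.2
      · exact absurd hu hs
      · exact absurd hu ht
    · exact fun h => Or.inl ⟨hu, h⟩
  have hs' : ∀ w, D'.Adj s w ↔ w = t := by
    intro w
    constructor
    · rintro (h | ⟨-, h⟩ | ⟨h, -⟩)
      · exact absurd h.1 hs
      · exact h
      · exact absurd h hst
    · exact fun h => Or.inr (Or.inl ⟨rfl, h⟩)
  have ht' : ∀ w, D'.Adj t w ↔ w = y := by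
    intro w
    constructor
    · rintro (h | ⟨h, -⟩ | ⟨-, h⟩)
      · exact absurd h.1 ht
      · exact absurd h hst.symm
      · exact h
    · exact fun h => Or.inr (Or.inr ⟨rfl, h⟩)
  have htail : ∀ u w, D'.Adj u w → u ∈ X ∨ u = s ∨ u = t := by
    rintro u w (h | h | h)
    · exact Or.inl h.1
    · exact Or.inr (Or.inl h.1)
    · exact Or.inr (Or.inr h.1)
  have hhead : ∀ u w, D'.Adj u w → w ∈ X ∨ w = s ∨ w = t := by
    rintro u w (h | h | h)
    · exact hout u h.1 w h.2
    · exact Or.inr (Or.inr h.2)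
    · exact Or.inl (h.2 ▸ hy)
  obtain ⟨a, d, had⟩ := ih D' X s t y ⟨hst, hs, ht, hy, hs', ht', htail, hhead,
    fun u hu h => hl u hu ((hX' u hu u).mp h), fun u hu y z => by
      obtain ⟨w, hw⟩ := h3 u hu y z
      exact ⟨w, (hX' u hu w).mpr hw.1, hw.2⟩⟩ hX
  have had1 : D'.Adj a d := had.2.1
  -- `a` has two out-neighbours, whereas `s` and `t` have one each.
  have haX : a ∈ X := by
    obtain ⟨w, hw, hwd⟩ := had.exists_out
    rcases htail a d had1 with h | rfl | rfl
    · exact h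
    · exact absurd (((hs' w).mp hw).trans ((hs' d).mp had1).symm) hwd
    · exact absurd (((ht' w).mp hw).trans ((ht' d).mp had1).symm) hwd
  obtain ⟨v, w, hvw, hva, hwa, hv, hw⟩ := had.exists_in
  have hds : d = s → ∃ u ∈ X, ∃ v ∈ X, ∃ w ∈ X, u ≠ v ∧ u ≠ w ∧ v ≠ w ∧
        D.Adj u s ∧ D.Adj v s ∧ D.Adj w s := by
    rintro rfl
    have key : ∀ u, D'.Adj u d → u ∈ X := by
      intro u hu
      rcases htail u d hu with h | rfl | rfl
      · exact h
      · exact absurd ((hs' u).mp hu) hst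
      · exact absurd (((ht' d).mp hu) ▸ hy) hs
    exact ⟨a, haX, v, key v hv, w, key w hw, hva.symm, hwa.symm, hvw, (hX' a haX d).mp had1,
      (hX' v (key v hv) d).mp hv, (hX' w (key w hw) d).mp hw⟩
  have hdt : d = t → ∃ u ∈ X, ∃ v ∈ X, u ≠ v ∧ D.Adj u t ∧ D.Adj v t := by
    rintro rfl
    have key : ∀ u, D'.Adj u d → u ≠ s → u ∈ X := by
      intro u hu hus
      rcases htail u d hu with h | rfl | rfl
      · exact h
      · exact absurd rfl hus
      · exact absurd (((ht' u).mp hu) ▸ hy) ht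
    by_cases hvs : v = s
    · have hwX := key w hw (fun h => hvw (hvs.trans h.symm))
      exact ⟨a, haX, w, hwX, hwa.symm, (hX' a haX d).mp had1, (hX' w hwX d).mp hw⟩
    · have hvX := key v hv hvs
      exact ⟨a, haX, v, hvX, hva.symm, (hX' a haX d).mp had1, (hX' v hvX d).mp hv⟩
  refine ⟨a, haX, d, hhead a d had1, ?_, hds, hdt⟩
  refine had.lift (W := Xᶜ) ((hX' a haX d).mp had1) (fun h => h haX) ?_ ?_
  -- A thick set leaving `X` passes through `t`, or through `s` with `t` as its end; two disjoint
  -- ones cannot both do so.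
  · have key : ∀ T, D'.Thick a d T → (T ∩ Xᶜ).Nonempty → t ∈ T ∨ (s ∈ T ∧ t = d) := by
      rintro T hT ⟨w, hwT, hwX⟩
      obtain ⟨u, hu⟩ := hT.exists_in hwT
      rcases hhead u w hu with h | rfl | rfl
      · exact absurd h hwX
      · rcases (hT.to_finish w hwT).eq_or_head with h | ⟨v', hv', hwv, -⟩
        · exact absurd (h ▸ hwT) hT.finish
        · rw [hs'] at hwv
          rw [hwv] at hv'
          rcases hv' with h | h
          · exact Or.inr ⟨hwT, h⟩
          · exact Or.inl h
      · exact Or.inl hwT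
    intro T₁ T₂ hT hT₁ hT₂ h1 h2
    rcases key T₁ hT₁ h1 with h1 | ⟨h1, h1'⟩ <;> rcases key T₂ hT₂ h2 with h2 | ⟨h2, h2'⟩
    · exact Set.disjoint_left.mp hT h1 h2
    · exact hT₁.finish (h2' ▸ h1)
    · exact hT₂.finish (h1' ▸ h2)
    · exact Set.disjoint_left.mp hT h1 h2
  · intro u w hud hwa huw
    rcases htail u w huw with h | rfl | rfl
    · exact Or.inl ((hX' u h w).mp huw)
    · rw [hs'] at huw
      subst huw
      refine Or.inr ⟨Or.inl hs, hA.mono fun z hz => ?_⟩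
      by_cases hzd : z = d
      · rcases hhead a d had1 with h | h | h
        · exact absurd (hzd ▸ h) hz
        · exact absurd h.symm hud
        · exact Or.inl (hzd.trans h)
      · exact Or.inr ⟨hz, hzd⟩
    · rw [ht'] at huw
      subst huw
      refine Or.inr ⟨Or.inl ht, ?_⟩
      -- The walk that replaces `t → y` must avoid `d`, which is delicate only for `d = s`. Then `s`
      -- has three in-neighbours in `X`, which the second option of `hB` excludes.
      by_cases hd : d = s
      · subst hd
        rcases hB with hB | hB
        · exact hB
        · exact absurd (hds rfl) hB.2
      · have hdX : d ∈ X := by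
          rcases hhead a d had1 with h | h | h
          · exact h
          · exact absurd h hd
          · exact absurd h.symm hud
        have h1 : D.Reach (insert w Xᶜ) u w := by
          rcases hB with hB | hB
          · exact hB.mono (Set.insert_subset_insert Set.sdiff_subset)
          · exact hB.1
        exact h1.mono (Set.insert_subset_insert fun z hz => ⟨hz, fun h => hz (h ▸ hdX)⟩)

/-- A minimal configuration without a subdivided transitive tournament. -/
structure MinConfig (D : Digraph V) (R : Set V) (p q x : V) : Prop extends D.Config R p q x where
  not_hasTransitive : ∀ a d, ¬ D.HasTransitive a d
  minimal : ∀ (D' : Digraph V) X p q x, D'.Config X p q x → X.ncard < R.ncard →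
      ∃ a d, D'.HasTransitive a d

namespace MinConfig

theorem false_of_reduction [Finite V] (h : D.MinConfig R p q x) (hXR : X ⊆ R) (hne : X ≠ R)
    (hst : s ≠ t)
    (hs : s ∉ X) (ht : t ∉ X) (hout : ∀ u ∈ X, ∀ w, D.Adj u w → w ∈ X ∨ w = s ∨ w = t)
    (hA : D.Reach Xᶜ s t) (hy : y ∈ X) (hB : D.Reach (insert y (Xᶜ \ {s})) t y) : False := by
  have hlt : X.ncard < R.ncard := Set.ncard_lt_ncard (hXR.ssubset_of_ne hne) (Set.toFinite _)
  obtain ⟨a, -, d, -, had, -⟩ := exists_hasTransitive_of_reduction h.minimal hlt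
    (fun u hu => h.three u (hXR hu)) (fun u hu => h.loopless u (hXR hu)) hst hs ht hout hA hy
    (Or.inl hB)
  exact h.not_hasTransitive a d had

/-- For an arc `u → v` inside `X` and a further out-neighbour `y` of `v`, the set `X \ {u, v}` can
be reduced with the path `u → v → y`. -/
theorem not_closed [Finite V] (h : D.MinConfig R p q x) (hXR : X ⊆ R) (hX : X.Nonempty)
    (hout : ∀ u ∈ X, ∀ w, D.Adj u w → w ∈ X) : False := by
  obtain ⟨u, hu⟩ := hX
  obtain ⟨v, huv, -⟩ := h.three u (hXR hu) u u
  have hv := hout u hu v huv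
  obtain ⟨y, hvy, hyu, hyv⟩ := h.three v (hXR hv) u v
  have hy := hout v hv y hvy
  have huv' : u ≠ v := by
    rintro rfl
    exact h.loopless u (hXR hu) huv
  refine h.false_of_reduction (X := X \ {u, v}) (s := u) (t := v) (y := y)
    (Set.sdiff_subset.trans hXR) (fun e => ?_) huv' (by simp) (by simp) ?_
    (Reach.of_adj huv (by simp)) ⟨hy, by simp [hyu, hyv]⟩ (Reach.of_adj_insert hvy)
  · have := hXR hu
    rw [← e] at this
    simp at this
  · intro a ha w haw
    have := hout a ha.1 w haw
    by_cases hw : w ∈ ({u, v} : Set V)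
    · exact Or.inr hw
    · exact Or.inl ⟨this, hw⟩

/-- This is strong connectivity of `D`. If `p` is missing from `K`, an in-neighbour `u` of `q` in `K
∩ R` takes over its role; if there is none, `K ∩ R` is itself closed. If vertices of `R` are
missing, `K ∩ R` is reduced with `p → q → x`. -/
theorem eq_of_closed [Finite V] {K : Set V} (h : D.MinConfig R p q x)
    (hK : ∀ u ∈ K, u ∈ R ∨ u = p ∨ u = q) (hKn : K.Nonempty)
    (hout : ∀ u ∈ K, ∀ w, D.Adj u w → w ∈ K) : p ∈ K ∧ q ∈ K ∧ R ⊆ K := by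
  have hpq : p ∈ K → q ∈ K := fun hp => hout p hp q ((h.adj_p q).mpr rfl)
  have hqx : q ∈ K → x ∈ K := fun hq => hout q hq x ((h.adj_q x).mpr rfl)
  have hq : q ∈ K := by
    by_contra hq
    refine h.not_closed (fun u hu => ?_) hKn hout
    rcases hK u hu with h | rfl | rfl
    · exact h
    · exact absurd (hpq hu) hq
    · exact absurd hu hq
  have hx := hqx hq
  have hmem : ∀ u ∈ K, u ≠ p → u ≠ q → u ∈ R := fun u hu hup huq =>
    ((hK u hu).resolve_right (by simp [hup, huq]))
  have hp : p ∈ K := by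
    by_contra hp
    by_cases hu : ∃ u ∈ K ∩ R, D.Adj u q
    · obtain ⟨u, ⟨huK, huR⟩, huq⟩ := hu
      have hne : (K ∩ R) \ {u} ≠ R := fun e => by
        rw [← e] at huR; simp at huR
      have hout' : ∀ a ∈ (K ∩ R) \ {u}, ∀ w, D.Adj a w → w ∈ (K ∩ R) \ {u} ∨ w = u ∨ w = q := by
        intro a ha w haw
        have hw := hout a ha.1.1 w haw
        by_cases hwq : w = q
        · exact Or.inr (Or.inr hwq)
        by_cases hwu : w = u
        · exact Or.inr (Or.inl hwu)
        exact Or.inl ⟨⟨hw, hmem w hw (fun e => hp (e ▸ hw)) hwq⟩, hwu⟩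
      have hqu : q ≠ u := fun e => h.q_notMem (e ▸ huR)
      by_cases hxu : x = u
      · subst hxu
        obtain ⟨y, hy, hyq, hyx⟩ := h.three x huR q x
        have hyK := hout x hx y hy
        refine h.false_of_reduction (s := q) (t := x) (y := y)
          (Set.sdiff_subset.trans Set.inter_subset_right) hne hqu
          (fun hq => h.q_notMem hq.1.2) (by simp) (fun a ha w haw => (hout' a ha w haw).imp id
          Or.symm) (Reach.of_adj ((h.adj_q x).mpr rfl) (by simp))
          ⟨⟨hyK, hmem y hyK (fun e => hp (e ▸ hyK)) hyq⟩, hyx⟩ (Reach.of_adj_insert hy)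
      · exact h.false_of_reduction (s := u) (t := q) (y := x)
          (Set.sdiff_subset.trans Set.inter_subset_right) hne hqu.symm (by simp)
          (fun hq => h.q_notMem hq.1.2) hout' (Reach.of_adj huq (fun hq => h.q_notMem hq.1.2))
          ⟨⟨hx, h.x_mem⟩, hxu⟩ (Reach.of_adj_insert ((h.adj_q x).mpr rfl))
    · refine h.not_closed (X := K ∩ R) Set.inter_subset_right ⟨x, hx, h.x_mem⟩ fun u hu w huw => ?_
      have hw := hout u hu.1 w huw
      refine ⟨hw, hmem w hw (fun e => hp (e ▸ hw)) ?_⟩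
      rintro rfl
      exact hu ⟨u, ‹_›, huw⟩
  refine ⟨hp, hq, ?_⟩
  by_contra hR
  have hpX : p ∉ K ∩ R := fun e => h.p_notMem e.2
  have hqX : q ∉ K ∩ R := fun e => h.q_notMem e.2
  refine h.false_of_reduction (X := K ∩ R) (s := p) (t := q) (y := x) Set.inter_subset_right
    (fun e => hR (Set.inter_eq_right.mp e)) h.ne hpX hqX (fun u hu w huw => ?_)
    (Reach.of_adj ((h.adj_p q).mpr rfl) hqX) ⟨hx, h.x_mem⟩
    (Reach.of_adj_insert ((h.adj_q x).mpr rfl))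
  by_cases hwp : w = p
  · exact Or.inr (Or.inl hwp)
  by_cases hwq : w = q
  · exact Or.inr (Or.inr hwq)
  have hw := hout u hu.1 w huw
  exact Or.inl ⟨hw, hmem w hw hwp hwq⟩

theorem reach [Finite V] (h : D.MinConfig R p q x) (hu : u ∈ R ∨ u = p ∨ u = q)
    (hX : X.Nonempty) (hXR : X ⊆ R) : ∃ y ∈ X, D.Reach Set.univ u y := by
  obtain ⟨y, hy⟩ := hX
  refine ⟨y, hy, (h.eq_of_closed (K := {w | D.Reach Set.univ u w}) ?_ ⟨u, Reach.refl⟩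
    fun a ha w haw => Reach.tail ha haw (Set.mem_univ _)).2.2 (hXR hy)⟩
  intro w hw
  rcases Relation.ReflTransGen.cases_tail hw with rfl | ⟨v, -, hv⟩
  · exact hu
  · exact h.head _ _ hv.1

/-- The first entry to `X` of a walk from `u`. -/
theorem reach_first [Finite V] (h : D.MinConfig R p q x) (hu : u ∈ R ∨ u = p ∨ u = q)
    (hX : X.Nonempty) (hXR : X ⊆ R) (huX : u ∉ X) :
    ∃ w, D.Reach Xᶜ u w ∧ ∃ y ∈ X, D.Adj w y := by
  obtain ⟨y, hy, h1⟩ := h.reach hu hX hXR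
  obtain ⟨w, hw, y, hy, -, hwy⟩ := h1.exists_first hy huX
  exact ⟨w, hw.mono fun z hz => hz.2, y, hy, hwy⟩

/-- A walk from `z` returns to `X`, first at some `y`. Removing `y` makes it a second exit, and `X \
{y}` is reduced with `z` leading to `y`. -/
theorem not_out_one [Finite V] (h : D.MinConfig R p q x) (hXR : X ⊆ R) (hX : X.Nonempty)
    (hout : ∀ u ∈ X, ∀ w, D.Adj u w → w ∈ X ∨ w = z) : False := by
  by_cases hz : (z ∈ R ∨ z = p ∨ z = q) ∧ z ∉ X
  swap
  · refine h.not_closed hXR hX fun u hu w huw => (hout u hu w huw).elim id ?_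
    rintro rfl
    by_contra hw
    exact hz ⟨h.head _ _ huw, hw⟩
  obtain ⟨w, hzw, y, hy, hwy⟩ := h.reach_first hz.1 hX hXR hz.2
  have hzy : z ≠ y := fun e => hz.2 (e ▸ hy)
  obtain ⟨y', hyy', hy'z, hy'y⟩ := h.three y (hXR hy) z y
  have hy' : y' ∈ X := (hout y hy y' hyy').resolve_right hy'z
  refine h.false_of_reduction (X := X \ {y}) (s := z) (t := y) (y := y')
    (Set.sdiff_subset.trans hXR) (fun e => ?_) hzy (fun e => hz.2 e.1) (by simp) ?_
    (((hzw.mono (Set.compl_subset_compl.mpr Set.sdiff_subset)).tail hwy fun h => h.2 rfl)) ⟨hy', hy'y⟩ (Reach.of_adj_insert hyy')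
  · have := hXR hy
    rw [← e] at this
    simp at this
  · intro u hu w huw
    rcases hout u hu.1 w huw with hw | hw
    · by_cases hwy : w = y
      · exact Or.inr (Or.inr hwy)
      · exact Or.inl ⟨hw, hwy⟩
    · exact Or.inr (Or.inl hw)

/-- If `t` returns to `X` without `s`, the reduction applies directly. If not, `t` reaches `s`, and
the reduction applies with the roles exchanged provided that `s` returns without `t`. If both fail,
no walk from `s` comes back to `X` at all, contradicting `reach`. -/
theorem not_out_two [Finite V] (h : D.MinConfig R p q x) (hXR : X ⊆ R) (hX : X.Nonempty)
    (hne : X ≠ R) (hout : ∀ u ∈ X, ∀ w, D.Adj u w → w ∈ X ∨ w = s ∨ w = t)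
    (hst : D.Reach Xᶜ s t) : False := by
  by_cases hs : s ∈ X
  · refine h.not_out_one (z := t) hXR hX fun u hu w huw => ?_
    rcases hout u hu w huw with h | rfl | h
    exacts [Or.inl h, Or.inl hs, Or.inr h]
  by_cases ht : t ∈ X
  · refine h.not_out_one (z := s) hXR hX fun u hu w huw => ?_
    rcases hout u hu w huw with h | h | rfl
    exacts [Or.inl h, Or.inr h, Or.inl ht]
  rcases eq_or_ne s t with rfl | hne'
  · exact h.not_out_one (z := s) hXR hX fun u hu w huw => by simpa using hout u hu w huw
  have hsV : s ∈ R ∨ s = p ∨ s = q := by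
    rcases hst.eq_or_head with e | ⟨w, -, hw, -⟩
    · exact absurd e hne'
    · exact h.tail _ _ hw
  have htV : t ∈ R ∨ t = p ∨ t = q := by
    rcases Relation.ReflTransGen.cases_tail hst with e | ⟨w, -, hw⟩
    · exact absurd e.symm hne'
    · exact h.head _ _ hw.1
  by_cases hB : ∃ w, D.Reach (Xᶜ \ {s}) t w ∧ ∃ y ∈ X, D.Adj w y
  · obtain ⟨w, hw, y, hy, hwy⟩ := hB
    exact h.false_of_reduction hXR hne hne' hs ht hout hst hy
      ((hw.mono (Set.subset_insert _ _)).tail hwy (Set.mem_insert _ _))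
  have hts : D.Reach Xᶜ t s := by
    obtain ⟨w, hw, y, hy, hwy⟩ := h.reach_first htV hX hXR ht
    by_contra hcon
    refine hB ⟨w, ?_, y, hy, hwy⟩
    refine (hw.induct (A := {v | D.Reach Xᶜ t v}) Reach.refl fun a ha b hb hab => ?_).2
    have hb' : D.Reach Xᶜ t b := Reach.tail ha hab hb
    refine ⟨hb', ⟨hb, ?_⟩, hab⟩
    rintro rfl
    exact hcon hb'
  by_cases hB' : ∃ w, D.Reach (Xᶜ \ {t}) s w ∧ ∃ y ∈ X, D.Adj w y
  · obtain ⟨w, hw, y, hy, hwy⟩ := hB'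
    exact h.false_of_reduction hXR hne hne'.symm ht hs
      (fun u hu w huw => (hout u hu w huw).imp id Or.symm) hts hy
      ((hw.mono (Set.subset_insert _ _)).tail hwy (Set.mem_insert _ _))
  obtain ⟨y, hy, hsy⟩ := h.reach hsV hX hXR
  have : y ∈ {w | w ∉ X ∧ (D.Reach (Xᶜ \ {s}) t w ∨ D.Reach (Xᶜ \ {t}) s w)} := by
    refine hsy.mem_of_closed ⟨hs, Or.inr Reach.refl⟩ ?_
    rintro a ⟨ha, ha'⟩ b - hab
    have hb : b ∉ X := by
      intro hb
      rcases ha' with ha' | ha'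
      · exact hB ⟨a, ha', b, hb, hab⟩
      · exact hB' ⟨a, ha', b, hb, hab⟩
    refine ⟨hb, ?_⟩
    by_cases hbs : b = s
    · exact Or.inr (hbs ▸ Reach.refl)
    by_cases hbt : b = t
    · exact Or.inl (hbt ▸ Reach.refl)
    exact ha'.imp (fun h => h.tail hab ⟨hb, hbs⟩) (fun h => h.tail hab ⟨hb, hbt⟩)
  exact this.1 hy

theorem reach_pq (h : D.MinConfig R p q x) (hXR : X ⊆ R) : D.Reach Xᶜ p q :=
  Reach.of_adj ((h.adj_p q).mpr rfl) fun hq => h.q_notMem (hXR hq)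

/-- If `z` reaches `q` outside `X`, this is `not_out_two`. Otherwise all that `z` reaches is added
to `X`, and `q` remains as the only exit. -/
theorem not_out_q [Finite V] (h : D.MinConfig R p q x) (hXR : X ⊆ R) (hX : X.Nonempty)
    (hne : X ≠ R) (hout : ∀ u ∈ X, ∀ w, D.Adj u w → w ∈ X ∨ w = z ∨ w = q) : False := by
  by_cases hzq : D.Reach Xᶜ z q
  · exact h.not_out_two hXR hX hne hout hzq
  set U := {w | D.Reach Xᶜ z w} with hU
  by_cases hz : z ∈ R
  · have hUR : ∀ w ∈ U, w ∉ X → w ∈ R := by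
      intro w hw hwX
      have hwq : w ≠ q := fun e => hzq (e ▸ hw)
      have hwp : w ≠ p := by
        rintro rfl
        exact hzq (Reach.trans hw (h.reach_pq hXR))
      rcases Relation.ReflTransGen.cases_tail hw with rfl | ⟨v, -, hv⟩
      · exact hz
      · exact (h.head _ _ hv.1).resolve_right (by simp [hwp, hwq])
    have hUR' : U ⊆ R := fun w hw => by
      by_cases hwX : w ∈ X
      · exact hXR hwX
      · exact hUR w hw hwX
    refine h.not_out_one (X := X ∪ U) (z := q) (Set.union_subset hXR hUR') hX.inl ?_
    rintro u (hu | hu) w huw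
    · rcases hout u hu w huw with h | rfl | h
      · exact Or.inl (Or.inl h)
      · exact Or.inl (Or.inr Reach.refl)
      · exact Or.inr h
    · by_cases hw : w ∈ X
      · exact Or.inl (Or.inl hw)
      · exact Or.inl (Or.inr (Reach.tail hu huw hw))
  · have hzp : z ≠ p := by
      rintro rfl
      exact hzq (h.reach_pq hXR)
    refine h.not_out_one (z := q) hXR hX fun u hu w huw => ?_
    rcases hout u hu w huw with h' | rfl | h'
    · exact Or.inl h'
    · exact Or.inr (((h.head _ _ huw).resolve_left hz).resolve_left hzp)
    · exact Or.inr h'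

theorem not_out_p_q [Finite V] (h : D.MinConfig R p q x) (hXR : X ⊆ R) (hX : X.Nonempty)
    (hne : X ≠ R) (hout : ∀ u ∈ X, ∀ w, D.Adj u w → w ∈ X ∨ w = p ∨ w = q) : False :=
  h.not_out_q hXR hX hne hout

theorem exists_adj_q [Finite V] (h : D.MinConfig R p q x) : ∃ s ∈ R, D.Adj s q := by
  by_contra hcon
  refine h.not_out_one (X := R) (z := p) subset_rfl ⟨x, h.x_mem⟩ fun u hu w huw => ?_
  rcases h.head u w huw with h | h | rfl
  · exact Or.inl h
  · exact Or.inr h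
  · exact absurd ⟨u, hu, huw⟩ hcon

/-- Separate the arc `a → q`, with `p` in the role of `o`. As `p → q`, the vertex `p` is outside
`Z`, so `Z ∩ R` has the exits `z` and `q` only and must be `R`; but from inside `Z` only `a` may
send an arc to `q`. -/
theorem adj_q_unique [Finite V] (h : D.MinConfig R p q x) (ha : a ∈ R) (haq : D.Adj a q)
    (hb : b ∈ R) (hbq : D.Adj b q) : b = a := by
  have hane : a ≠ q := fun e => h.q_notMem (e ▸ ha)
  have hap : a ≠ p := fun e => h.p_notMem (e ▸ ha)
  obtain ⟨Z, z, haZ, hqZ, hzq, hout, -⟩ := exists_separator (U := {w | w ∈ R ∨ w = p ∨ w = q})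
    (o := p) (h.not_hasTransitive a q) hane haq h.head (by
      intro X hXU hX haX hqX hpX hout
      have hXR : X ⊆ R := fun u hu => (hXU hu).resolve_right (by
        rintro (rfl | rfl)
        exacts [hpX hu, hqX hu])
      exact h.not_out_q hXR hX (fun e => haX (e ▸ ha)) hout) hap.symm h.ne
    (Reach.of_adj ((h.adj_p q).mpr rfl) hane.symm)
  have hpZ : p ∉ Z := by
    intro hp
    rcases hout p hp q ((h.adj_p q).mpr rfl) with h | h | h
    exacts [hqZ h, hzq h.symm, hap h.1.symm]
  have hZR : Z ∩ R = R := by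
    by_contra hne
    refine h.not_out_q (X := Z ∩ R) (z := z) Set.inter_subset_right ⟨a, haZ, ha⟩ hne ?_
    rintro u ⟨hu, huR⟩ w huw
    rcases hout u hu w huw with hw | hw | hw
    · rcases h.head _ _ huw with hR | rfl | hq
      · exact Or.inl ⟨hw, hR⟩
      · exact absurd hw hpZ
      · exact Or.inr (Or.inr hq)
    · exact Or.inr (Or.inl hw)
    · exact Or.inr (Or.inr hw.2)
  rw [← hZR] at hb
  rcases hout b hb.1 q hbq with h | h | h
  exacts [absurd h hqZ, absurd h.symm hzq, h.1]

/-- By uniqueness of `s`, the set `R \ {s}` has only the exits `s` and `p`, which an arc `s → p`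
would link. -/
theorem not_adj_p [Finite V] (h : D.MinConfig R p q x) (hs : s ∈ R) (hsq : D.Adj s q) :
    ¬ D.Adj s p := by
  intro hsp
  obtain ⟨w, hw, hwp, hwq⟩ := h.three s hs p q
  have hwR : w ∈ R := (h.head _ _ hw).resolve_right (by simp [hwp, hwq])
  have hws : w ≠ s := by
    rintro rfl
    exact h.loopless w hs hw
  refine h.not_out_two (X := R \ {s}) (s := s) (t := p) Set.sdiff_subset ⟨w, hwR, hws⟩
    (fun e => ?_) ?_ (Reach.of_adj hsp fun hp => h.p_notMem hp.1)
  · rw [← e] at hs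
    simp at hs
  · rintro u ⟨hu, hus⟩ w huw
    rcases h.head _ _ huw with hR | hp | rfl
    · by_cases hws : w = s
      · exact Or.inr (Or.inl hws)
      · exact Or.inl ⟨hR, hws⟩
    · exact Or.inr (Or.inr hp)
    · exact absurd (h.adj_q_unique hs hsq hu huw) hus

/-- Otherwise `R \ {b}` has only the exits `b` and `q`. -/
theorem exists_adj_p [Finite V] (h : D.MinConfig R p q x) (hb : b ∈ R) :
    ∃ c ∈ R, c ≠ b ∧ D.Adj c p := by
  by_contra hcon
  obtain ⟨w, hw, hwp, hwq⟩ := h.three b hb p q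
  have hwR : w ∈ R := (h.head _ _ hw).resolve_right (by simp [hwp, hwq])
  have hwb : w ≠ b := by
    rintro rfl
    exact h.loopless w hb hw
  refine h.not_out_q (X := R \ {b}) (z := b) Set.sdiff_subset ⟨w, hwR, hwb⟩ (fun e => ?_) ?_
  · rw [← e] at hb
    simp at hb
  · rintro u ⟨hu, hub⟩ w huw
    rcases h.head _ _ huw with hR | rfl | hq
    · by_cases hwb : w = b
      · exact Or.inr (Or.inl hwb)
      · exact Or.inl ⟨hR, hwb⟩
    · exact absurd ⟨u, hu, hub, huw⟩ hcon
    · exact Or.inr (Or.inr hq)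

/-- A separator below an in-neighbour `b ≠ x` of `p`. -/
theorem exists_separator_p [Finite V] (h : D.MinConfig R p q x) (hb : b ∈ R) (hbp : D.Adj b p)
    (hbx : b ≠ x) (hs : s ∈ R) (hsq : D.Adj s q) :
    ∃ (Z : Set V) (z : V), b ∈ Z ∧ p ∉ Z ∧ z ≠ p ∧ q ∈ Z ∧ s ∈ Z ∧
      ∀ u ∈ Z, ∀ w, D.Adj u w → w ∈ Z ∨ w = z ∨ (u = b ∧ w = p) := by
  have hbq : b ≠ q := fun e => h.q_notMem (e ▸ hb)
  have hbp' : b ≠ p := fun e => h.p_notMem (e ▸ hb)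
  obtain ⟨c, hc, hcb, hcp⟩ := h.exists_adj_p hb
  obtain ⟨Z, z, hbZ, hpZ, hzp, hout, hin⟩ := exists_separator
    (U := {w | w ∈ R ∨ w = p ∨ w = q}) (o := q) (h.not_hasTransitive b p) hbp' hbp h.head (by
      intro X hXU hX hbX hpX hqX hout
      have hXR : X ⊆ R := fun u hu => (hXU hu).resolve_right (by
        rintro (rfl | rfl)
        exacts [hpX hu, hqX hu])
      exact h.not_out_two hXR hX (fun e => hbX (e ▸ hb)) hout (Reach.of_adj hbp hpX)) hbq.symm
    -- If `q` did not reach `p` without `b`, the part of `R` it reaches, nonempty because `b ≠ x`,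
    -- would have the exits `b` and `q` only.
    h.ne.symm (by
      by_contra hcon
      have hK : ∀ w, D.Reach {b}ᶜ q w → w ≠ b := fun w hw => hw.mem_of_mem (T := {b}ᶜ) hbq.symm
      refine h.not_out_q (X := {w | D.Reach {b}ᶜ q w} ∩ R) (z := b) Set.inter_subset_right
        ⟨x, Reach.of_adj ((h.adj_q x).mpr rfl) hbx.symm, h.x_mem⟩ (fun e => ?_) ?_
      · rw [← e] at hb
        exact hK b hb.1 rfl
      · rintro u ⟨hu, huR⟩ w huw
        by_cases hwb : w = b
        · exact Or.inr (Or.inl hwb)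
        have hw : D.Reach {b}ᶜ q w := Reach.tail hu huw hwb
        rcases h.head _ _ huw with hR | rfl | hq
        · exact Or.inl ⟨hw, hR⟩
        · exact absurd hw hcon
        · exact Or.inr (Or.inr hq))
  -- If `q ∉ Z`, then `Z ∩ R` has the exits `z` and `p`, and `z` cannot reach `p` outside it. Adding
  -- what `z` reaches gives a set with exits `p` and `q` that misses the other in-neighbour `c` of
  -- `p`.
  have hqZ : q ∈ Z := by
    by_contra hqZ
    have hZR : ∀ u w, D.Adj u w → w ∈ Z → w ∈ Z ∩ R := fun u w huw hw =>
      ⟨hw, (h.head _ _ huw).resolve_right (by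
        rintro (rfl | rfl)
        exacts [hpZ hw, hqZ hw])⟩
    have hcZ : c ∉ Z := by
      intro hcZ
      rcases hout c hcZ p hcp with h | h | h
      exacts [hpZ h, hzp h.symm, hcb h.1]
    have hout' : ∀ u ∈ Z ∩ R, ∀ w, D.Adj u w → w ∈ Z ∩ R ∨ w = z ∨ w = p := by
      rintro u ⟨hu, huR⟩ w huw
      rcases hout u hu w huw with hw | hw | hw
      exacts [Or.inl (hZR u w huw hw), Or.inr (Or.inl hw), Or.inr (Or.inr hw.2)]
    have hne : Z ∩ R ≠ R := fun e => hcZ (Set.inter_eq_right.mp e hc)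
    have hcl : ∀ w, D.Reach (Z ∩ R)ᶜ z w → w ≠ p := by
      rintro w hw rfl
      exact h.not_out_two Set.inter_subset_right ⟨b, hbZ, hb⟩ hne hout' hw
    refine h.not_out_p_q (X := (Z ∩ R) ∪ ({w | D.Reach (Z ∩ R)ᶜ z w} ∩ R))
      (Set.union_subset Set.inter_subset_right Set.inter_subset_right) ⟨b, Or.inl ⟨hbZ, hb⟩⟩ ?_ ?_
    · intro e
      rw [← e] at hc
      rcases hc with hc | hc
      · exact hcZ hc.1
      · exact hcl p (Reach.tail hc.1 hcp fun hp => hpZ hp.1) rfl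
    · rintro u hu w huw
      have : w ∈ Z ∩ R ∨ D.Reach (Z ∩ R)ᶜ z w ∨ w = p := by
        rcases hu with hu | hu
        · rcases hout' u hu w huw with h | rfl | h
          exacts [Or.inl h, Or.inr (Or.inl Reach.refl), Or.inr (Or.inr h)]
        · by_cases hw : w ∈ Z ∩ R
          · exact Or.inl hw
          · exact Or.inr (Or.inl (Reach.tail hu.1 huw hw))
      rcases this with hw | hw | hw
      · exact Or.inl (Or.inl hw)
      · rcases h.head _ _ huw with hR | hpq
        · exact Or.inl (Or.inr ⟨hw, hR⟩)
        · exact Or.inr hpq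
      · exact Or.inr (Or.inl hw)
  refine ⟨Z, z, hbZ, hpZ, hzp, hqZ, ?_, hout⟩
  obtain ⟨u, hu, huq⟩ := hin q hqZ hbq.symm
  rcases h.tail _ _ huq with hR | rfl | rfl
  · exact h.adj_q_unique hs hsq hR huq ▸ hu
  · exact absurd hu hpZ
  · exact absurd ((h.adj_q u).mp huq) (fun e => h.q_notMem (e ▸ h.x_mem))

/-- Uncross the separators of `b` and `c`. If each contains the exit of the other, their union
covers `R`, and inside it only `b` and `c` precede `p`. Otherwise their intersection, which contains
`s` but not `b`, has a single exit apart from `q`. -/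
theorem adj_p_eq [Finite V] (h : D.MinConfig R p q x) (hb : b ∈ R) (hbp : D.Adj b p)
    (hbx : b ≠ x) (hc : c ∈ R) (hcp : D.Adj c p) (hcx : c ≠ x) (hbc : b ≠ c) (ha : a ∈ R)
    (hap : D.Adj a p) : a = b ∨ a = c := by
  obtain ⟨s, hs, hsq⟩ := h.exists_adj_q
  obtain ⟨Z₁, z₁, hbZ, hpZ₁, hz₁p, hqZ₁, hsZ₁, hout₁⟩ := h.exists_separator_p hb hbp hbx hs hsq
  obtain ⟨Z₂, z₂, hcZ, hpZ₂, hz₂p, hqZ₂, hsZ₂, hout₂⟩ := h.exists_separator_p hc hcp hcx hs hsq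
  have hN₁ : ∀ a ∈ Z₁, D.Adj a p → a = b := by
    intro a ha hap
    rcases hout₁ a ha p hap with h | h | h
    exacts [absurd h hpZ₁, absurd h.symm hz₁p, h.1]
  have hN₂ : ∀ a ∈ Z₂, D.Adj a p → a = c := by
    intro a ha hap
    rcases hout₂ a ha p hap with h | h | h
    exacts [absurd h hpZ₂, absurd h.symm hz₂p, h.1]
  have hbZ₂ : b ∉ Z₂ := fun hb => hbc (hN₂ b hb hbp)
  have hcZ₁ : c ∉ Z₁ := fun hc => hbc (hN₁ c hc hcp).symm
  by_cases hz : z₁ ∈ Z₂ ∧ z₂ ∈ Z₁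
  · have hR : (Z₁ ∪ Z₂) ∩ R = R := by
      by_contra hne
      refine h.not_out_p_q (X := (Z₁ ∪ Z₂) ∩ R) Set.inter_subset_right ⟨b, Or.inl hbZ, hb⟩ hne ?_
      rintro u ⟨hu, huR⟩ w huw
      have : w ∈ Z₁ ∪ Z₂ ∨ w = p := by
        rcases hu with hu | hu
        · rcases hout₁ u hu w huw with h | rfl | h
          exacts [Or.inl (Or.inl h), Or.inl (Or.inr hz.1), Or.inr h.2]
        · rcases hout₂ u hu w huw with h | rfl | h
          exacts [Or.inl (Or.inr h), Or.inl (Or.inl hz.2), Or.inr h.2]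
      rcases this with hw | hw
      · rcases h.head _ _ huw with hR | hpq
        · exact Or.inl ⟨hw, hR⟩
        · exact Or.inr hpq
      · exact Or.inr (Or.inl hw)
    rcases Set.inter_eq_right.mp hR ha with h | h
    · exact Or.inl (hN₁ a h hap)
    · exact Or.inr (hN₂ a h hap)
  · exfalso
    have key : ∀ u ∈ Z₁ ∩ Z₂, ∀ w, D.Adj u w → (w ∈ Z₁ ∨ w = z₁) ∧ (w ∈ Z₂ ∨ w = z₂) := by
      rintro u ⟨hu1, hu2⟩ w huw
      constructor
      · rcases hout₁ u hu1 w huw with h | h | h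
        exacts [Or.inl h, Or.inr h, absurd (h.1 ▸ hu2) hbZ₂]
      · rcases hout₂ u hu2 w huw with h | h | h
        exacts [Or.inl h, Or.inr h, absurd (h.1 ▸ hu1) hcZ₁]
    have : ∃ z, ∀ u ∈ Z₁ ∩ Z₂, ∀ w, D.Adj u w → w ∈ Z₁ ∩ Z₂ ∨ w = z := by
      by_cases hz1 : z₁ ∈ Z₂
      · have hz2 : z₂ ∉ Z₁ := fun h => hz ⟨hz1, h⟩
        refine ⟨z₁, fun u hu w huw => ?_⟩
        obtain ⟨h1 | h1, h2 | h2⟩ := key u hu w huw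
        exacts [Or.inl ⟨h1, h2⟩, absurd (h2 ▸ h1) hz2, Or.inr h1, Or.inr h1]
      · refine ⟨z₂, fun u hu w huw => ?_⟩
        obtain ⟨h1 | h1, h2 | h2⟩ := key u hu w huw
        exacts [Or.inl ⟨h1, h2⟩, Or.inr h2, absurd (h1 ▸ h2) hz1, Or.inr h2]
    obtain ⟨z, hz⟩ := this
    refine h.not_out_q (X := (Z₁ ∩ Z₂) ∩ R) (z := z) Set.inter_subset_right ⟨s, ⟨hsZ₁, hsZ₂⟩, hs⟩
      (fun e => hbZ₂ (Set.inter_eq_right.mp e hb).2) ?_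
    rintro u ⟨hu, huR⟩ w huw
    rcases hz u hu w huw with hw | hw
    · rcases h.head _ _ huw with hR | rfl | hq
      · exact Or.inl ⟨hw, hR⟩
      · exact absurd hw.1 hpZ₁
      · exact Or.inr (Or.inr hq)
    · exact Or.inr (Or.inl hw)

/-- In a minimal configuration, `q` has exactly one in-neighbour besides `p`, and `p` has exactly
two in-neighbours. -/
theorem exists_tokens [Finite V] (h : D.MinConfig R p q x) :
    ∃ b ∈ R, ∃ c ∈ R, ∃ s ∈ R, b ≠ c ∧ b ≠ s ∧ c ≠ s ∧
      (∀ u ∈ R, D.Adj u p ↔ u = b ∨ u = c) ∧ ∀ u ∈ R, D.Adj u q ↔ u = s := by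
  obtain ⟨s, hs, hsq⟩ := h.exists_adj_q
  obtain ⟨b, hb, -, hbp⟩ := h.exists_adj_p hs
  obtain ⟨c, hc, hcb, hcp⟩ := h.exists_adj_p hb
  have hsp := h.not_adj_p hs hsq
  refine ⟨b, hb, c, hc, s, hs, hcb.symm, fun e => hsp (e ▸ hbp), fun e => hsp (e ▸ hcp), ?_, ?_⟩
  · refine fun u hu => ⟨fun hup => ?_, ?_⟩
    · by_contra hcon
      push Not at hcon
      -- Separators are available only for in-neighbours other than `x`; among three in-neighbours
      -- of `p` two differ from `x`.
      by_cases hbx : b = x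
      · have := h.adj_p_eq hc hcp (fun e => hcb (e.trans hbx.symm)) hu hup
          (fun e => hcon.1 (e.trans hbx.symm)) hcon.2.symm hb hbp
        rcases this with e | e
        exacts [hcb e.symm, hcon.1 e.symm]
      by_cases hcx : c = x
      · have := h.adj_p_eq hb hbp hbx hu hup
          (fun e => hcon.2 (e.trans hcx.symm)) hcon.1.symm hc hcp
        rcases this with e | e
        exacts [hcb e, hcon.2 e.symm]
      rcases h.adj_p_eq hb hbp hbx hc hcp hcx hcb.symm hu hup with e | e
      exacts [hcon.1 e, hcon.2 e]
    · rintro (rfl | rfl) <;> assumption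
  · refine fun u hu => ⟨fun huq => h.adj_q_unique hs hsq hu huq, ?_⟩
    rintro rfl
    exact hsq

end MinConfig

end Reduction

end Digraph

namespace Digraph

/-! ### Suppressing `p` -/

section Tokens

variable {V : Type*} {D E : Digraph V} {R X tok : Set V} {a b c d p q s t u v w x y z : V}

/-- The properties of a minimal configuration after suppressing `p`; `tok` is the set of
in-neighbours of `q`. -/
structure TokenConfig (E : Digraph V) (R : Set V) (q x : V) (tok : Set V) : Prop where
  q_notMem : q ∉ R
  x_mem : x ∈ R
  tok_subset : tok ⊆ R
  tok_ne : ∀ z, ∃ t ∈ tok, t ≠ z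
  adj_q : ∀ w, E.Adj q w ↔ w = x
  adj_to_q : ∀ u, E.Adj u q ↔ u ∈ tok
  tail : ∀ u w, E.Adj u w → u ∈ R ∨ u = q
  head : ∀ u w, E.Adj u w → w ∈ R ∨ w = q
  loopless : ∀ u ∈ R, ¬ E.Adj u u
  not_hasTransitive : ∀ a ∈ R, ∀ d ∈ R, ¬ E.HasTransitive a d
  eq_of_closed : ∀ K : Set V, (∀ u ∈ K, u ∈ R ∨ u = q) → K.Nonempty →
    (∀ u ∈ K, ∀ w, E.Adj u w → w ∈ K) → q ∈ K ∧ R ⊆ K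
  eq_of_not_out : ∀ X ⊆ R, X.Nonempty → (∀ u ∈ X, ∀ w ∈ R, E.Adj u w → w ∈ X) → X = R
  not_out_one : ∀ X ⊆ R, X.Nonempty → Disjoint X tok → ∀ z,
    ¬ ∀ u ∈ X, ∀ w, E.Adj u w → w ∈ X ∨ w = z
  not_out_two : ∀ X ⊆ R, X.Nonempty → Disjoint X tok → ∀ y z,
    (∀ u ∈ X, ∀ w, E.Adj u w → w ∈ X ∨ w = y ∨ w = z) → ¬ E.Reach Xᶜ y z
  not_reach : ∀ X ⊆ R, X.Nonempty → ¬ tok ⊆ X → ∀ y,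
    (∀ u ∈ X, ∀ w ∈ R, E.Adj u w → w ∈ X ∨ w = y) → ¬ E.Reach Xᶜ q y

/-- Suppress `p`: the digraph on `R ∪ {q}` with the arcs of `D` inside `R`, arcs from `tok` to `q`
and the arc from `q` to `x`. -/
def suppress (D : Digraph V) (R : Set V) (q x : V) (tok : Set V) : Digraph V :=
  ⟨fun u w => (u ∈ R ∧ w ∈ R ∧ D.Adj u w) ∨ (u ∈ tok ∧ w = q) ∨ (u = q ∧ w = x)⟩

/-- No vertex of `R` precedes both `p` and `q`, so suppression preserves out-degrees. Afterwards `q`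
has exactly three in-neighbours; a set missing one of them can be reduced even when the way back
runs through `q`, which is the source of `not_reach`. -/
theorem MinConfig.exists_tokenConfig [Finite V] (h : D.MinConfig R p q x) :
    ∃ E tok, TokenConfig E R q x tok := by
  classical
  obtain ⟨b, hb, c, hc, s, hs, hbc, hbs, hcs, hp, hq⟩ := h.exists_tokens
  set tok : Set V := {b, c, s} with htok
  have htokR : tok ⊆ R := by
    rintro u (rfl | rfl | rfl) <;> assumption
  have htne : ∀ z, ∃ t ∈ tok, t ≠ z := by
    intro z
    by_cases hz : b = z
    · exact ⟨c, by simp [tok], fun e => hbc (hz.trans e.symm)⟩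
    · exact ⟨b, by simp [tok], hz⟩
  set E := D.suppress R q x tok with hE
  have hEq : ∀ w, E.Adj q w ↔ w = x := by
    intro w
    constructor
    · rintro (h' | h' | h')
      exacts [absurd h'.1 h.q_notMem, absurd (htokR h'.1) h.q_notMem, h'.2]
    · exact fun e => Or.inr (Or.inr ⟨rfl, e⟩)
  have hEt : ∀ u, E.Adj u q ↔ u ∈ tok := by
    intro u
    constructor
    · rintro (h' | h' | h')
      exacts [absurd h'.2.1 h.q_notMem, h'.1, absurd (h'.2 ▸ h.x_mem) h.q_notMem]
    · exact fun e => Or.inr (Or.inl ⟨e, rfl⟩)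
  have hER : ∀ u ∈ R, ∀ w ∈ R, E.Adj u w ↔ D.Adj u w := by
    intro u hu w hw
    constructor
    · rintro (h' | h' | h')
      exacts [h'.2.2, absurd (h'.2 ▸ hw) h.q_notMem, absurd (h'.1 ▸ hu) h.q_notMem]
    · exact fun e => Or.inl ⟨hu, hw, e⟩
  have htail : ∀ u w, E.Adj u w → u ∈ R ∨ u = q := by
    rintro u w (h' | h' | h')
    exacts [Or.inl h'.1, Or.inl (htokR h'.1), Or.inr h'.1]
  have hhead : ∀ u w, E.Adj u w → w ∈ R ∨ w = q := by
    rintro u w (h' | h' | h')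
    exacts [Or.inl h'.2.1, Or.inr h'.2, Or.inl (h'.2 ▸ h.x_mem)]
  have hloop : ∀ u ∈ R, ¬ E.Adj u u := fun u hu huu => h.loopless u hu ((hER u hu u hu).mp huu)
  have harc : ∀ u w, E.Adj u w → D.Adj u w ∨ (w = q ∧ D.Adj u p) := by
    rintro u w (h' | ⟨h', rfl⟩ | ⟨rfl, rfl⟩)
    · exact Or.inl h'.2.2
    · rcases h' with rfl | rfl | rfl
      · exact Or.inr ⟨rfl, (hp _ hb).mpr (Or.inl rfl)⟩
      · exact Or.inr ⟨rfl, (hp _ hc).mpr (Or.inr rfl)⟩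
      · exact Or.inl ((hq _ hs).mpr rfl)
    · exact Or.inl ((h.adj_q _).mpr rfl)
  have hpq : D.Adj p q := (h.adj_p q).mpr rfl
  have hED : ∀ X ⊆ R, ∀ u v, E.Reach Xᶜ u v → D.Reach Xᶜ u v := by
    intro X hX u v huv
    refine (Reach.simulate (A := Set.univ) huv trivial fun a _ w hw haw => ⟨trivial, ?_⟩).2
    rcases harc a w haw with h' | ⟨rfl, h'⟩
    · exact Reach.of_adj h' hw
    · exact Reach.head h' (fun hpX => h.p_notMem (hX hpX)) (Reach.of_adj hpq hw)
  have hDE : ∀ u ∈ R, ∀ w, D.Adj u w → (w ∈ R ∧ E.Adj u w) ∨ (u ∈ tok ∧ (w = p ∨ w = q)) := by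
    intro u hu w huw
    rcases h.head u w huw with hw | rfl | rfl
    · exact Or.inl ⟨hw, (hER u hu w hw).mpr huw⟩
    · rcases (hp u hu).mp huw with rfl | rfl <;> exact Or.inr ⟨by simp [tok], Or.inl rfl⟩
    · rw [(hq u hu).mp huw]
      exact Or.inr ⟨by simp [tok], Or.inr rfl⟩
  have hthree : ∀ u ∈ R, E.ThreeOut u := by
    intro u hu y z
    by_cases hut : D.Adj u p
    · have huq : ¬ D.Adj u q := by
        intro huq
        obtain rfl := (hq u hu).mp huq
        rcases (hp u hu).mp hut with e | e
        exacts [hbs e.symm, hcs e.symm]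
      -- The arc to `q` in `E` comes from the arc to `p` in `D`, so avoiding `q` is translated into
      -- avoiding `p`.
      obtain ⟨w, hw, hwy, hwz⟩ := h.three u hu (if y = q then p else y) (if z = q then p else z)
      rcases hDE u hu w hw with ⟨hwR, hw'⟩ | ⟨ht, rfl | rfl⟩
      · have hwq : w ≠ q := fun e => h.q_notMem (e ▸ hwR)
        refine ⟨w, hw', ?_, ?_⟩
        · rintro rfl
          rw [if_neg hwq] at hwy
          exact hwy rfl
        · rintro rfl
          rw [if_neg hwq] at hwz
          exact hwz rfl
      · refine ⟨q, (hEt u).mpr ht, ?_, ?_⟩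
        · rintro rfl
          simp at hwy
        · rintro rfl
          simp at hwz
      · exact absurd hw huq
    · obtain ⟨w, hw, hwy, hwz⟩ := h.three u hu y z
      refine ⟨w, ?_, hwy, hwz⟩
      rcases hDE u hu w hw with ⟨-, hw'⟩ | ⟨ht, rfl | rfl⟩
      exacts [hw', absurd hw hut, (hEt u).mpr ht]
  have hnot : ∀ a ∈ R, ∀ d ∈ R, ¬ E.HasTransitive a d := by
    intro a ha d hd had
    refine h.not_hasTransitive a d (had.lift (W := {p, q}) ((hER a ha d hd).mp had.2.1) ?_ ?_ ?_)
    · rintro (rfl | rfl)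
      exacts [h.p_notMem ha, h.q_notMem ha]
    · have key : ∀ T, E.Thick a d T → (T ∩ {p, q}).Nonempty → q ∈ T := by
        rintro T hT ⟨w, hw, rfl | rfl⟩
        · obtain ⟨u, hu⟩ := hT.exists_in hw
          rcases hhead _ _ hu with h' | h'
          exacts [absurd h' h.p_notMem, absurd h' h.ne]
        · exact hw
      exact fun T₁ T₂ hT hT₁ hT₂ h1 h2 =>
        Set.disjoint_left.mp hT (key T₁ hT₁ h1) (key T₂ hT₂ h2)
    · intro u w hud hwa huw
      rcases harc u w huw with h' | ⟨rfl, h'⟩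
      · exact Or.inl h'
      · have hqd : w ≠ d := fun e => h.q_notMem (e ▸ hd)
        have hpd : p ≠ d := fun e => h.p_notMem (e ▸ hd)
        exact Or.inr ⟨Or.inr ⟨by simp, hqd⟩, Reach.head h' (by simp [hpd])
          (Reach.of_adj hpq (by simp))⟩
  have hclosed : ∀ K : Set V, (∀ u ∈ K, u ∈ R ∨ u = q) → K.Nonempty →
      (∀ u ∈ K, ∀ w, E.Adj u w → w ∈ K) → q ∈ K ∧ R ⊆ K := by
    intro K hK hKn hout
    have hqK : q ∈ K := by
      by_contra hqK
      have hKR : K ⊆ R := fun u hu => (hK u hu).resolve_right fun e => hqK (e ▸ hu)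
      refine h.not_closed hKR hKn fun u hu w huw => ?_
      rcases hDE u (hKR hu) w huw with ⟨-, hw⟩ | ⟨ht, -⟩
      · exact hout u hu w hw
      · exact absurd (hout u hu q ((hEt u).mpr ht)) hqK
    have hKR : ∀ u ∈ K, u ≠ q → u ∈ R := fun u hu huq => (hK u hu).resolve_right huq
    have h1 : ∀ u ∈ insert p K, u ∈ R ∨ u = p ∨ u = q := by
      rintro u (rfl | hu)
      · exact Or.inr (Or.inl rfl)
      · rcases hK u hu with h | h
        exacts [Or.inl h, Or.inr (Or.inr h)]
    have h2 : ∀ u ∈ insert p K, ∀ w, D.Adj u w → w ∈ insert p K := by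
      rintro u (rfl | hu) w huw
      · rw [h.adj_p] at huw
        exact Or.inr (huw ▸ hqK)
      · by_cases huq : u = q
        · subst huq
          exact Or.inr (hout u hu w ((hEq w).mpr ((h.adj_q w).mp huw)))
        · rcases hDE u (hKR u hu huq) w huw with ⟨-, hw⟩ | ⟨-, rfl | rfl⟩
          · exact Or.inr (hout u hu w hw)
          · exact Or.inl rfl
          · exact Or.inr hqK
    obtain ⟨-, -, h3⟩ := h.eq_of_closed h1 ⟨p, Or.inl rfl⟩ h2
    exact ⟨hqK, fun u hu => (h3 hu).resolve_left fun e => h.p_notMem (e ▸ hu)⟩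
  have hnotout : ∀ X ⊆ R, X.Nonempty → (∀ u ∈ X, ∀ w ∈ R, E.Adj u w → w ∈ X) → X = R := by
    intro X hX hXn hout
    by_contra hne
    refine h.not_out_p_q hX hXn hne fun u hu w huw => ?_
    rcases hDE u (hX hu) w huw with ⟨hw, hw'⟩ | ⟨-, hw⟩
    · exact Or.inl (hout u hu w hw hw')
    · exact Or.inr hw
  refine ⟨E, tok, h.q_notMem, h.x_mem, htokR, htne, hEq, hEt, htail, hhead, hloop,
    hnot, hclosed, hnotout, ?_, ?_, ?_⟩
  · intro X hX hXn hdis z hout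
    refine h.not_out_one (z := z) hX hXn fun u hu w huw => ?_
    rcases hDE u (hX hu) w huw with ⟨-, hw⟩ | ⟨ht, -⟩
    · exact hout u hu w hw
    · exact absurd ht (Set.disjoint_left.mp hdis hu)
  · intro X hX hXn hdis y z hout hyz
    refine h.not_out_two (s := y) (t := z) hX hXn ?_ (fun u hu w huw => ?_) (hED X hX y z hyz)
    · rintro rfl
      exact Set.disjoint_left.mp hdis hb (by simp [tok])
    · rcases hDE u (hX hu) w huw with ⟨-, hw⟩ | ⟨ht, -⟩
      · exact hout u hu w hw
      · exact absurd ht (Set.disjoint_left.mp hdis hu)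
  · intro X hX hXn htX y hout hqy
    have hXR : X ≠ R := by
      rintro rfl
      exact htX htokR
    have hyX : y ∉ X := by
      intro hy
      refine hXR (hnotout X hX hXn fun u hu w hw huw => ?_)
      rcases hout u hu w hw huw with h | rfl
      exacts [h, hy]
    have hqX : q ∉ X := fun hqX => h.q_notMem (hX hqX)
    have hyq : q ≠ y := by
      rintro rfl
      refine hXR (hnotout X hX hXn fun u hu w hw huw => ?_)
      rcases hout u hu w hw huw with h' | rfl
      exacts [h', absurd hw h.q_notMem]
    have hyR : y ∈ R := by
      rcases Relation.ReflTransGen.cases_tail hqy with e | ⟨w, -, hw⟩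
      · exact absurd e.symm hyq
      · exact (hhead _ _ hw.1).resolve_right hyq.symm
    obtain ⟨v, hv⟩ := hXn
    have hyv : E.Reach Set.univ y v := by
      refine (hclosed {w | E.Reach Set.univ y w} ?_ ⟨y, Reach.refl⟩
        fun u hu w huw => Reach.tail hu huw trivial).2 (hX hv)
      intro w hw
      rcases Relation.ReflTransGen.cases_tail hw with rfl | ⟨u, -, hu⟩
      · exact Or.inl hyR
      · exact hhead _ _ hu.1
    obtain ⟨w, hw, v, hv, -, hwv⟩ := hyv.exists_first hv hyX
    have hlt : X.ncard < R.ncard := Set.ncard_lt_ncard (hX.ssubset_of_ne hXR) (Set.toFinite _)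
    have hfew : ¬ ∃ u ∈ X, ∃ v ∈ X, ∃ w ∈ X, u ≠ v ∧ u ≠ w ∧ v ≠ w ∧
        E.Adj u q ∧ E.Adj v q ∧ E.Adj w q := by
      rintro ⟨u, hu, v, hv, w, hw, huv, huw, hvw, h1, h2, h3⟩
      rw [hEt] at h1 h2 h3
      refine htX ?_
      have hsub : ({u, v, w} : Set V) ⊆ tok := by
        rintro _ (rfl | rfl | rfl) <;> assumption
      have hcard : tok.ncard ≤ ({u, v, w} : Set V).ncard := by
        rw [Set.ncard_eq_three.mpr ⟨u, v, w, huv, huw, hvw, rfl⟩,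
          Set.ncard_eq_three.mpr ⟨b, c, s, hbc, hbs, hcs, htok⟩]
      rw [← Set.eq_of_subset_of_ncard_le hsub hcard (Set.toFinite _)]
      rintro _ (rfl | rfl | rfl) <;> assumption
    obtain ⟨a, ha, d, hd, had, hdq, -⟩ := exists_hasTransitive_of_reduction (D := E) (X := X)
      (s := q) (t := y) (y := v) h.minimal hlt (fun u hu => hthree u (hX hu))
      (fun u hu => hloop u (hX hu)) hyq hqX hyX (fun u hu w huw => by
        rcases hhead u w huw with hw | rfl
        · exact (hout u hu w hw huw).imp id Or.inr
        · exact Or.inr (Or.inl rfl)) hqy hv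
      (Or.inr ⟨((hw.mono fun z hz => hz.2).mono (Set.subset_insert _ _)).tail hwv
        (Set.mem_insert _ _), hfew⟩)
    refine hnot a (hX ha) d ?_ had
    rcases hd with hd | hd | hd
    · exact hX hd
    · exact absurd (hdq hd) hfew
    · exact hd ▸ hyR

end Tokens

end Digraph

namespace Digraph

/-! ### Contracting to a hub -/

section Hub

variable {V : Type*} {E : Digraph V} {R X Y tok : Set V} {a q x : V}

/-- The digraph on `Y ∪ {o}` obtained from a minimal configuration by contracting everything
outside `Y` to the single vertex `o`. -/
structure HubConfig (Q : Digraph V) (Y : Set V) (o : V) (Heavy : Set V → Prop) : Prop where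
  notMem : o ∉ Y
  tail : ∀ u w, Q.Adj u w → u ∈ Y ∨ u = o
  head : ∀ u w, Q.Adj u w → w ∈ Y ∨ w = o
  adj_hub : ∀ w, Q.Adj o w → w ∈ Y
  not_hasTransitive : ∀ a ∈ Y, ∀ d ∈ Y, ¬ Q.HasTransitive a d
  eq_of_closed : ∀ K : Set V, (∀ u ∈ K, u ∈ Y ∨ u = o) → K.Nonempty →
    (∀ u ∈ K, ∀ w, Q.Adj u w → w ∈ K) → o ∈ K ∧ Y ⊆ K
  exists_adj_ne : ∀ z, ∃ w, Q.Adj o w ∧ w ≠ z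
  heavy_inter : ∀ X X', Heavy X → Heavy X' → (X ∩ X').Nonempty
  eq_of_not_out : ∀ X ⊆ Y, X.Nonempty → (∀ u ∈ X, ∀ w ∈ Y, Q.Adj u w → w ∈ X) → X = Y
  heavy : ∀ X ⊆ Y, X.Nonempty → ∀ y ∈ Y, (∀ u ∈ X, ∀ w ∈ Y, Q.Adj u w → w ∈ X ∨ w = y) →
    Q.Reach Xᶜ o y → Heavy X
  not_out_two : ∀ X ⊆ Y, X.Nonempty → (∀ u ∈ X, ¬ Q.Adj u o) → ∀ y z,
    (∀ u ∈ X, ∀ w, Q.Adj u w → w ∈ X ∨ w = y ∨ w = z) → ¬ Q.Reach Xᶜ y z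

namespace TokenConfig

/-- Separate `a → x` with `q` in the role of `o`. If the exit is `q`, then `not_reach` forces all
tokens into `Z`. Another exit `z` cannot occur: `Z` would contain no token, `z` would reach neither
`x` nor `q` outside it, and adding what `z` reaches would leave `x` as the only exit. -/
theorem exists_separator [Finite V] (h : TokenConfig E R q x tok) (ha : a ∈ R) (hax : E.Adj a x) :
    ∃ Z ⊆ R, a ∈ Z ∧ x ∉ Z ∧ tok ⊆ Z ∧
      ∀ u ∈ Z, ∀ w ∈ R, E.Adj u w → w ∈ Z ∨ (u = a ∧ w = x) := by
  have hne : a ≠ x := by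
    rintro rfl
    exact h.loopless a ha hax
  have hqa : q ≠ a := fun e => h.q_notMem (e ▸ ha)
  have hqx : q ≠ x := fun e => h.q_notMem (e ▸ h.x_mem)
  have hqx' : E.Adj q x := (h.adj_q x).mpr rfl
  obtain ⟨Z, z, haZ, hxZ, hzx, hout, -⟩ := Digraph.exists_separator (U := {w | w ∈ R ∨ w = q})
    (o := q) (h.not_hasTransitive a ha x h.x_mem) hne hax h.head (by
      intro X hXU hX haX hxX hqX hout
      have hXR : X ⊆ R := fun u hu => (hXU hu).resolve_right fun e => hqX (e ▸ hu)
      refine h.not_out_two X hXR hX (Set.disjoint_left.mpr fun u hu ht => ?_) a x hout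
        (Reach.of_adj hax hxX)
      rcases hout u hu q ((h.adj_to_q u).mpr ht) with e | e | e
      exacts [hqX e, hqa e, hqx e]) hqa hqx (Reach.of_adj hqx' hne.symm)
  have hqZ : q ∉ Z := by
    intro hq
    rcases hout q hq x hqx' with e | e | e
    exacts [hxZ e, hzx e.symm, hqa e.1]
  have hne : (Z ∩ R).Nonempty := ⟨a, haZ, ha⟩
  by_cases hzq : z = q
  · subst hzq
    have hout' : ∀ u ∈ Z ∩ R, ∀ w ∈ R, E.Adj u w → w ∈ Z ∩ R ∨ (u = a ∧ w = x) := by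
      intro u hu w hw huw
      rcases hout u hu.1 w huw with e | e | e
      exacts [Or.inl ⟨e, hw⟩, absurd (e ▸ hw) h.q_notMem, Or.inr e]
    refine ⟨Z ∩ R, Set.inter_subset_right, ⟨haZ, ha⟩, fun e => hxZ e.1, ?_, hout'⟩
    by_contra ht
    exact h.not_reach (Z ∩ R) Set.inter_subset_right hne ht x
      (fun u hu w hw huw => (hout' u hu w hw huw).imp id And.right)
      (Reach.of_adj hqx' fun e => hxZ e.1)
  · exfalso
    have hdis : ∀ u ∈ Z, u ∉ tok := by
      intro u hu ht
      rcases hout u hu q ((h.adj_to_q u).mpr ht) with e | e | e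
      exacts [hqZ e, hzq e.symm, hqx e.2]
    have hdis' : Disjoint (Z ∩ R) tok := Set.disjoint_left.mpr fun u hu => hdis u hu.1
    have hwR : ∀ u ∈ Z, ∀ w, E.Adj u w → w ∈ R := by
      intro u hu w huw
      refine (h.head u w huw).resolve_right ?_
      rintro rfl
      exact hdis u hu ((h.adj_to_q u).mp huw)
    have hout' : ∀ u ∈ Z ∩ R, ∀ w, E.Adj u w → w ∈ Z ∩ R ∨ w = z ∨ w = x := by
      intro u hu w huw
      have := hwR u hu.1 w huw
      rcases hout u hu.1 w huw with e | e | e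
      exacts [Or.inl ⟨e, this⟩, Or.inr (Or.inl e), Or.inr (Or.inr e.2)]
    by_cases hz : z ∈ R
    swap
    · refine h.not_out_one (Z ∩ R) Set.inter_subset_right hne hdis' x fun u hu w huw => ?_
      rcases hout' u hu w huw with e | rfl | e
      exacts [Or.inl e, absurd (hwR u hu.1 w huw) hz, Or.inr e]
    have hxU := h.not_out_two (Z ∩ R) Set.inter_subset_right hne hdis' z x hout'
    have hqU : ¬ E.Reach (Z ∩ R)ᶜ z q := fun e => hxU (e.tail hqx' fun e => hxZ e.1)
    have hUR : ∀ w, E.Reach (Z ∩ R)ᶜ z w → w ∈ R := by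
      intro w hw
      rcases Relation.ReflTransGen.cases_tail hw with rfl | ⟨v, -, hv⟩
      · exact hz
      · refine (h.head v w hv.1).resolve_right ?_
        rintro rfl
        exact hqU hw
    refine h.not_out_one (Z ∩ R ∪ {w | E.Reach (Z ∩ R)ᶜ z w})
      (Set.union_subset Set.inter_subset_right hUR) hne.inl
      (Set.disjoint_left.mpr ?_) x ?_
    · rintro u (hu | hu) ht
      · exact hdis u hu.1 ht
      · exact hqU (Reach.tail hu ((h.adj_to_q u).mpr ht) fun e => hqZ e.1)
    · rintro u (hu | hu) w huw
      · rcases hout' u hu w huw with e | rfl | e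
        exacts [Or.inl (Or.inl e), Or.inl (Or.inr Reach.refl), Or.inr e]
      · by_cases hw : w ∈ Z ∩ R
        · exact Or.inl (Or.inl hw)
        · exact Or.inl (Or.inr (Reach.tail hu huw hw))

/-- For two in-neighbours of `x`, the intersection of their separators contains the tokens, misses
`x`, and has no exit in `R`. -/
theorem exists_unique_adj [Finite V] (h : TokenConfig E R q x tok) :
    ∃ α ∈ R, E.Adj α x ∧ ∀ a ∈ R, E.Adj a x → a = α := by
  obtain ⟨t, ht, htx⟩ := h.tok_ne x
  obtain ⟨α, hα, hαx⟩ : ∃ α ∈ R, E.Adj α x := by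
    by_contra hcon
    have := h.eq_of_not_out (R \ {x}) Set.sdiff_subset ⟨t, h.tok_subset ht, htx⟩
      fun u hu w hw huw => ⟨hw, by
        rintro rfl
        exact hcon ⟨u, hu.1, huw⟩⟩
    have hx := h.x_mem
    rw [← this] at hx
    simp at hx
  refine ⟨α, hα, hαx, fun a ha hax => ?_⟩
  by_contra hne
  obtain ⟨Z, hZR, haZ, hxZ, htZ, hout⟩ := h.exists_separator ha hax
  obtain ⟨Z', -, hαZ', hxZ', htZ', hout'⟩ := h.exists_separator hα hαx
  have := h.eq_of_not_out (Z ∩ Z') (Set.inter_subset_left.trans hZR) ⟨t, htZ ht, htZ' ht⟩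
    fun u hu w hw huw => by
      rcases hout u hu.1 w hw huw with h1 | h1 <;> rcases hout' u hu.2 w hw huw with h2 | h2
      · exact ⟨h1, h2⟩
      · exact absurd (h2.2 ▸ h1) hxZ
      · exact absurd (h1.2 ▸ h2) hxZ'
      · exact absurd (h1.1.symm.trans h2.1) hne
  have hx := h.x_mem
  rw [← this] at hx
  exact hxZ hx.1

/-- `Y` is the smallest set containing the tokens and avoiding `x` whose only exit in `R` is `x`.
The rest of `R` is reachable from `x` without entering `Y`, so it can be contracted together with
`q` into `x`. Minimality of `Y` makes proper nonempty subsets have exits inside `Y`. -/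
theorem exists_hubConfig [Finite V] (h : TokenConfig E R q x tok) :
    ∃ Q Y Heavy, HubConfig Q Y x Heavy := by
  obtain ⟨t, ht, -⟩ := h.tok_ne x
  obtain ⟨α, hα, hαx, huniq⟩ := h.exists_unique_adj
  have hqx : E.Adj q x := (h.adj_q x).mpr rfl
  set P : Set V → Prop := fun X => X ⊆ R ∧ x ∉ X ∧ tok ⊆ X ∧
    ∀ u ∈ X, ∀ w ∈ R, E.Adj u w → w ∈ X ∨ w = x with hP
  obtain ⟨Z, hZ⟩ : ∃ Z, P Z := by
    obtain ⟨Z, hZR, -, hxZ, htZ, hout⟩ := h.exists_separator hα hαx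
    exact ⟨Z, hZR, hxZ, htZ, fun u hu w hw huw => (hout u hu w hw huw).imp id And.right⟩
  set Y : Set V := {y | ∀ X, P X → y ∈ X} with hY
  have hYR : Y ⊆ R := fun y hy => hZ.1 (hy Z hZ)
  have hxY : x ∉ Y := fun hx => hZ.2.1 (hx Z hZ)
  have htY : tok ⊆ Y := fun u hu X hX => hX.2.2.1 hu
  have hYout : ∀ u ∈ Y, ∀ w ∈ R, E.Adj u w → w ∈ Y ∨ w = x := by
    intro u hu w hw huw
    by_cases hwx : w = x
    · exact Or.inr hwx
    · exact Or.inl fun X hX => (hX.2.2.2 u (hu X hX) w hw huw).resolve_right hwx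
  have hqY : q ∉ Y := fun hq => h.q_notMem (hYR hq)
  have hαY : α ∈ Y := by
    by_contra hαY
    have := h.eq_of_not_out Y hYR ⟨t, htY ht⟩ fun u hu w hw huw => by
      refine (hYout u hu w hw huw).resolve_right ?_
      rintro rfl
      exact hαY (huniq u (hYR hu) huw ▸ hu)
    exact hxY (this ▸ h.x_mem)
  have hM : ∀ m ∈ R \ Y, E.Reach (R \ Y) x m := by
    intro m hm
    have := (h.eq_of_closed {w | (w ∈ Y ∨ w = q) ∨ (w ∈ R \ Y ∧ E.Reach (R \ Y) x w)} ?_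
      ⟨q, Or.inl (Or.inr rfl)⟩ ?_).2 hm.1
    · rcases this with (h1 | h1) | h1
      exacts [absurd h1 hm.2, absurd (h1 ▸ hm.1) h.q_notMem, h1.2]
    · rintro u ((h1 | h1) | h1)
      exacts [Or.inl (hYR h1), Or.inr h1, Or.inl h1.1.1]
    · have hx : x ∈ R \ Y ∧ E.Reach (R \ Y) x x := ⟨⟨h.x_mem, hxY⟩, Reach.refl⟩
      rintro u ((h1 | rfl) | h1) w huw
      · rcases h.head u w huw with hw | hw
        · rcases hYout u h1 w hw huw with h2 | rfl
          exacts [Or.inl (Or.inl h2), Or.inr hx]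
        · exact Or.inl (Or.inr hw)
      · rw [(h.adj_q w).mp huw]
        exact Or.inr hx
      · by_cases hwY : w ∈ Y
        · exact Or.inl (Or.inl hwY)
        · rcases h.head u w huw with hw | hw
          · exact Or.inr ⟨⟨hw, hwY⟩, h1.2.tail huw ⟨hw, hwY⟩⟩
          · exact Or.inl (Or.inr hw)
  set Q : Digraph V := ⟨fun u w => (u ∈ Y ∧ w ∈ Y ∧ E.Adj u w) ∨ ((u ∈ tok ∨ u = α) ∧ w = x) ∨
    (u = x ∧ w ∈ Y ∧ ∃ m ∈ R \ Y, E.Adj m w)⟩ with hQ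
  have hK : ∀ u, u ∈ tok ∨ u = α → u ∈ Y := by
    rintro u (hu | rfl)
    exacts [htY hu, hαY]
  have hQY : ∀ u ∈ Y, ∀ w ∈ Y, E.Adj u w ↔ Q.Adj u w := by
    intro u hu w hw
    constructor
    · exact fun e => Or.inl ⟨hu, hw, e⟩
    · rintro (e | e | e)
      exacts [e.2.2, absurd (e.2 ▸ hw) hxY, absurd (e.1 ▸ hu) hxY]
  have hsim : ∀ u w, Q.Adj u w → E.Adj u w ∨ ((u = x ∨ w = x) ∧
      E.Reach (insert w (insert q (R \ Y))) u w) := by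
    rintro u w (e | ⟨e | rfl, rfl⟩ | ⟨rfl, hw, m, hm, hmw⟩)
    · exact Or.inl e.2.2
    · exact Or.inr ⟨Or.inr rfl, Reach.head ((h.adj_to_q u).mpr e) (by simp)
        (Reach.of_adj hqx (by simp))⟩
    · exact Or.inl hαx
    · refine Or.inr ⟨Or.inl rfl, ((hM m hm).mono fun z hz => ?_).tail hmw (by simp)⟩
      exact Or.inr (Or.inr hz)
  have hreach : ∀ X ⊆ Y, ∀ u v, Q.Reach Xᶜ u v → E.Reach Xᶜ u v := by
    intro X hX u v huv
    refine (Reach.simulate (A := Set.univ) huv trivial fun a _ w hw haw => ⟨trivial, ?_⟩).2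
    rcases hsim a w haw with e | ⟨-, e⟩
    · exact Reach.of_adj e hw
    · refine e.mono ?_
      rintro z (rfl | rfl | hz)
      exacts [hw, fun e => hqY (hX e), fun e => hz.2 (hX e)]
  have htail : ∀ u w, Q.Adj u w → u ∈ Y ∨ u = x := by
    rintro u w (e | e | e)
    exacts [Or.inl e.1, Or.inl (hK u e.1), Or.inr e.1]
  have hhead : ∀ u w, Q.Adj u w → w ∈ Y ∨ w = x := by
    rintro u w (e | e | e)
    exacts [Or.inl e.2.1, Or.inr e.2, Or.inl e.2.1]
  have hto : ∀ u, u ∈ tok ∨ u = α → Q.Adj u x := fun u hu => Or.inr (Or.inl ⟨hu, rfl⟩)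
  have hfrom : ∀ m ∈ R \ Y, ∀ w ∈ Y, E.Adj m w → Q.Adj x w := fun m hm w hw e =>
    Or.inr (Or.inr ⟨rfl, hw, m, hm, e⟩)
  have hEY : ∀ u ∈ Y, ∀ w, E.Adj u w → (w ∈ Y ∧ Q.Adj u w) ∨ (w = q ∧ u ∈ tok) ∨
      (w = x ∧ u = α) := by
    intro u hu w huw
    rcases h.head u w huw with hw | rfl
    · rcases hYout u hu w hw huw with e | rfl
      · exact Or.inl ⟨e, (hQY u hu w e).mp huw⟩
      · exact Or.inr (Or.inr ⟨rfl, huniq u (hYR hu) huw⟩)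
    · exact Or.inr (Or.inl ⟨rfl, (h.adj_to_q u).mp huw⟩)
  -- Heavy means containing all tokens, or `α` and some token; any two such sets meet. A set that is
  -- not heavy is governed by `not_out_two` if it contains `α`, and by `not_reach` if not.
  refine ⟨Q, Y, fun X => tok ⊆ X ∨ (α ∈ X ∧ (X ∩ tok).Nonempty), hxY, htail, hhead, ?_, ?_, ?_,
    ?_, ?_, ?_, ?_, ?_⟩
  · rintro w (e | e | e)
    exacts [e.2.1, absurd (hK x e.1) hxY, e.2.1]
  · intro a ha d hd had
    have hdx : x ≠ d := fun e => hxY (e ▸ hd)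
    have hW : insert q (R \ Y) ⊆ insert q (R \ Y) \ {d} := by
      intro z hz
      refine ⟨hz, ?_⟩
      rintro rfl
      rcases hz with rfl | hz
      exacts [hqY hd, hz.2 hd]
    have hxW : x ∈ insert q (R \ Y) := Or.inr ⟨h.x_mem, hxY⟩
    refine h.not_hasTransitive a (hYR ha) d (hYR hd) (had.lift (W := insert q (R \ Y))
      ((hQY a ha d hd).mpr had.2.1) ?_ ?_ ?_)
    · rintro (rfl | e)
      exacts [hqY ha, e.2 ha]
    · have key : ∀ T, Q.Thick a d T → (T ∩ insert q (R \ Y)).Nonempty → x ∈ T := by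
        rintro T hT ⟨w, hw, hw'⟩
        obtain ⟨u, hu⟩ := hT.exists_in hw
        rcases hhead u w hu with e | rfl
        · rcases hw' with rfl | hw'
          exacts [absurd e hqY, absurd e hw'.2]
        · exact hw
      exact fun T₁ T₂ hT hT₁ hT₂ h1 h2 =>
        Set.disjoint_left.mp hT (key T₁ hT₁ h1) (key T₂ hT₂ h2)
    · intro u w hud hwa huw
      rcases hsim u w huw with e | ⟨e, e'⟩
      · exact Or.inl e
      · refine Or.inr ⟨?_, e'.mono (Set.insert_subset_insert hW)⟩
        rcases e with rfl | rfl
        exacts [Or.inl hxW, Or.inr ⟨hxW, hdx⟩]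
  · intro K hKY hKn hout
    have hxK : x ∈ K := by
      by_contra hxK
      have hKY' : K ⊆ Y := fun u hu => (hKY u hu).resolve_right fun e => hxK (e ▸ hu)
      refine hxK ((h.eq_of_closed K (fun u hu => Or.inl (hYR (hKY' hu))) hKn ?_).2 h.x_mem)
      intro u hu w huw
      rcases hEY u (hKY' hu) w huw with e | e | e
      · exact hout u hu w e.2
      · exact absurd (hout u hu x (hto u (Or.inl e.2))) hxK
      · exact absurd (hout u hu x (hto u (Or.inr e.2))) hxK
    refine ⟨hxK, fun y hy => ?_⟩
    have := (h.eq_of_closed (K ∪ insert q (R \ Y)) ?_ hKn.inl ?_).2 (hYR hy)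
    · rcases this with e | rfl | e
      exacts [e, absurd hy hqY, absurd hy e.2]
    · rintro u (hu | rfl | hu)
      · rcases hKY u hu with e | rfl
        exacts [Or.inl (hYR e), Or.inl h.x_mem]
      · exact Or.inr rfl
      · exact Or.inl hu.1
    · have hMw : ∀ u ∈ R \ Y, ∀ w, E.Adj u w → w ∈ K ∪ insert q (R \ Y) := by
        intro u hu w huw
        rcases h.head u w huw with hw | hw
        · by_cases hwY : w ∈ Y
          · exact Or.inl (hout x hxK w (hfrom u hu w hwY huw))
          · exact Or.inr (Or.inr ⟨hw, hwY⟩)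
        · exact Or.inr (Or.inl hw)
      rintro u (hu | rfl | hu) w huw
      · rcases hKY u hu with hu' | rfl
        · rcases hEY u hu' w huw with e | e | e
          · exact Or.inl (hout u hu w e.2)
          · exact Or.inr (Or.inl e.1)
          · exact Or.inl (e.1 ▸ hxK)
        · exact hMw u ⟨h.x_mem, hxY⟩ w huw
      · exact Or.inl ((h.adj_q w).mp huw ▸ hxK)
      · exact hMw u hu w huw
  · intro z
    by_contra hcon
    refine h.not_out_one (R \ Y) Set.sdiff_subset ⟨x, h.x_mem, hxY⟩
      (Set.disjoint_left.mpr fun u hu hut => hu.2 (htY hut)) z fun u hu w huw => ?_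
    rcases h.head u w huw with hw | rfl
    · by_cases hwY : w ∈ Y
      · right
        by_contra hwz
        exact hcon ⟨w, hfrom u hu w hwY huw, hwz⟩
      · exact Or.inl ⟨hw, hwY⟩
    · exact absurd (htY ((h.adj_to_q u).mp huw)) hu.2
  · rintro X X' (h1 | ⟨h1, s, hs, hst⟩) (h2 | ⟨h2, s', hs', hst'⟩)
    exacts [⟨t, h1 ht, h2 ht⟩, ⟨s', h1 hst', hs'⟩, ⟨s, hs, h2 hst⟩, ⟨α, h1, h2⟩]
  · intro X hXY hX hout
    have hout' : ∀ u ∈ X, ∀ w ∈ R, E.Adj u w → w ∈ X ∨ w = x := by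
      intro u hu w hw huw
      rcases hEY u (hXY hu) w huw with e | e | e
      exacts [Or.inl (hout u hu w e.1 e.2), absurd (e.1 ▸ hw) h.q_notMem, Or.inr e.1]
    by_cases ht : tok ⊆ X
    · exact hXY.antisymm fun y hy => hy X ⟨hXY.trans hYR, fun e => hxY (hXY e), ht, hout'⟩
    · have hqx' : E.Reach Xᶜ q x := Reach.of_adj hqx fun e => hxY (hXY e)
      exact absurd hqx' (h.not_reach X (hXY.trans hYR) hX ht x hout')
  · intro X hXY hX y hy hout hxy
    have hxX : x ∉ X := fun e => hxY (hXY e)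
    have hxy' := hreach X hXY x y hxy
    by_contra hcon
    push Not at hcon
    by_cases hαX : α ∈ X
    · have hdis : Disjoint X tok := Set.disjoint_iff_inter_eq_empty.mpr (hcon.2 hαX)
      refine h.not_out_two X (hXY.trans hYR) hX hdis x y (fun u hu w huw => ?_) hxy'
      rcases hEY u (hXY hu) w huw with e | e | e
      · exact (hout u hu w e.1 e.2).imp id Or.inr
      · exact absurd e.2 (Set.disjoint_left.mp hdis hu)
      · exact Or.inr (Or.inl e.1)
    · refine h.not_reach X (hXY.trans hYR) hX hcon.1 y (fun u hu w hw huw => ?_)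
        (Reach.head hqx hxX hxy')
      rcases hEY u (hXY hu) w huw with e | e | e
      · exact hout u hu w e.1 e.2
      · exact absurd (e.1 ▸ hw) h.q_notMem
      · exact absurd (e.2 ▸ hu) hαX
  · intro X hXY hX hnot y z hout hyz
    refine h.not_out_two X (hXY.trans hYR) hX (Set.disjoint_left.mpr fun u hu hut =>
      hnot u hu (hto u (Or.inl hut))) y z (fun u hu w huw => ?_) (hreach X hXY y z hyz)
    rcases hEY u (hXY hu) w huw with e | e | e
    · exact hout u hu w e.2
    · exact absurd (hto u (Or.inl e.2)) (hnot u hu)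
    · exact absurd (hto u (Or.inr e.2)) (hnot u hu)

end TokenConfig

end Hub

end Digraph

namespace Digraph

/-! ### Single-entry parts and the double count -/

section Parts

variable {V : Type*} {Q : Digraph V} {Y S S' Ω Z Z₁ Z₂ : Set V} {Heavy : Set V → Prop}
  {a a₁ a₂ a₃ d e o u v w y z z₁ z₂ : V}

/-- All arcs that enter `S` have the same head. -/
def SingleEntry (Q : Digraph V) (Y S : Set V) : Prop :=
  S ⊆ Y ∧ S.Nonempty ∧ ∃ e, ∀ u ∉ S, ∀ w ∈ S, Q.Adj u w → w = e

/-- A maximal set with a single entry. -/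
def IsPart (Q : Digraph V) (Y Ω : Set V) : Prop :=
  Q.SingleEntry Y Ω ∧ ∀ S, Q.SingleEntry Y S → (S ∩ Ω).Nonempty → S ⊆ Ω

/-- The only arcs leaving `Z ∋ a`, apart from that from `a` to `d`, go to `z`. -/
def Separates (Q : Digraph V) (a d : V) (Z : Set V) (z : V) : Prop :=
  a ∈ Z ∧ d ∉ Z ∧ z ≠ d ∧ ∀ u ∈ Z, ∀ w, Q.Adj u w → w ∈ Z ∨ w = z ∨ (u = a ∧ w = d)

theorem Separates.eq_of_adj (h : Q.Separates a d Z z) (hu : u ∈ Z) (hud : Q.Adj u d) : u = a := by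
  obtain ⟨-, hd, hz, hout⟩ := h
  rcases hout u hu d hud with e | e | e
  exacts [absurd e hd, absurd e.symm hz, e.1]

theorem IsPart.eq (h : Q.IsPart Y S) (h' : Q.IsPart Y S') (hu : u ∈ S) (hu' : u ∈ S') : S = S' :=
  (h'.2 S h.1 ⟨u, hu, hu'⟩).antisymm (h.2 S' h'.1 ⟨u, hu', hu⟩)

namespace HubConfig

theorem exists_entry (h : HubConfig Q Y o Heavy) (hS : S ⊆ Y) (hSn : S.Nonempty) :
    ∃ u ∉ S, ∃ w ∈ S, Q.Adj u w := by
  by_contra hcon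
  obtain ⟨y, hy⟩ := hSn
  refine absurd hy ((h.eq_of_closed {u | (u ∈ Y ∨ u = o) ∧ u ∉ S} (fun u hu => hu.1)
    ⟨o, Or.inr rfl, fun e => h.notMem (hS e)⟩ fun u hu w huw => ⟨h.head u w huw, fun hw =>
      hcon ⟨u, hu.2, w, hw, huw⟩⟩).2 (hS hy)).2

/-- If the entry of one set lies in the other, the other's entry serves the union. If neither does,
no arc can enter the intersection, contradicting `exists_entry`. -/
theorem union (h : HubConfig Q Y o Heavy) (hS : Q.SingleEntry Y S) (hS' : Q.SingleEntry Y S')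
    (hn : (S ∩ S').Nonempty) : Q.SingleEntry Y (S ∪ S') := by
  obtain ⟨hSY, hSn, e, he⟩ := hS
  obtain ⟨hSY', hSn', e', he'⟩ := hS'
  refine ⟨Set.union_subset hSY hSY', hSn.inl, ?_⟩
  by_cases h1 : e ∈ S'
  · refine ⟨e', fun u hu w hw huw => ?_⟩
    rcases hw with hw | hw
    · obtain rfl := he u (fun e => hu (Or.inl e)) w hw huw
      exact he' u (fun e => hu (Or.inr e)) w h1 huw
    · exact he' u (fun e => hu (Or.inr e)) w hw huw
  by_cases h2 : e' ∈ S
  · refine ⟨e, fun u hu w hw huw => ?_⟩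
    rcases hw with hw | hw
    · exact he u (fun e => hu (Or.inl e)) w hw huw
    · obtain rfl := he' u (fun e => hu (Or.inr e)) w hw huw
      exact he u (fun e => hu (Or.inl e)) w h2 huw
  obtain ⟨u, hu, w, hw, huw⟩ := h.exists_entry (S := S ∩ S') (Set.inter_subset_left.trans hSY) hn
  by_cases huS : u ∈ S
  · exact absurd (he' u (fun e => hu ⟨huS, e⟩) w hw.2 huw ▸ hw.1) h2
  · exact absurd (he u huS w hw.1 huw ▸ hw.2) h1

theorem exists_part [Finite V] (h : HubConfig Q Y o Heavy) (hy : y ∈ Y) :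
    ∃ Ω, Q.IsPart Y Ω ∧ y ∈ Ω := by
  have : Nonempty {S : Set V // Q.SingleEntry Y S ∧ y ∈ S} :=
    ⟨⟨{y}, ⟨Set.singleton_subset_iff.mpr hy, ⟨y, rfl⟩, y, fun _ _ _ hw _ => hw⟩, rfl⟩⟩
  obtain ⟨⟨Ω, hΩ, hyΩ⟩, hmax⟩ := Finite.exists_max
    fun S : {S : Set V // Q.SingleEntry Y S ∧ y ∈ S} => S.1.ncard
  refine ⟨Ω, ⟨hΩ, fun S hS hn => ?_⟩, hyΩ⟩
  have := hmax ⟨S ∪ Ω, h.union hS hΩ hn, Or.inr hyΩ⟩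
  rw [Set.eq_of_subset_of_ncard_le Set.subset_union_right this (Set.toFinite _)]
  exact Set.subset_union_left

/-- The vertices of `Y` not reached from `o` without `a` have the single entry `a`. If `d` were
among them, maximality would put them, and so `a`, into `Ω`. -/
theorem mem_reach_of_part (h : HubConfig Q Y o Heavy) (hΩ : Q.IsPart Y Ω) (hd : d ∈ Ω)
    (ha : a ∈ Y) (haΩ : a ∉ Ω) : Q.Reach {a}ᶜ o d := by
  by_contra hcon
  have hoa : o ≠ a := fun e => h.notMem (e ▸ ha)
  have haK : ¬ Q.Reach {a}ᶜ o a := fun e => e.mem_of_mem (T := {a}ᶜ) hoa rfl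
  refine haΩ (hΩ.2 {u | u ∈ Y ∧ ¬ Q.Reach {a}ᶜ o u} ⟨fun u hu => hu.1, ⟨a, ha, haK⟩, a, ?_⟩
    ⟨d, ⟨hΩ.1.1 hd, hcon⟩, hd⟩ ⟨ha, haK⟩)
  intro u hu w hw huw
  by_contra hwa
  refine hw.2 (Reach.tail ?_ huw hwa)
  by_contra hu'
  rcases h.tail u w huw with e | rfl
  · exact hu ⟨e, hu'⟩
  · exact hu' Reach.refl

/-- Suppose the hub is outside `Z`. If the exit is the hub, it must reach `d` outside `Z ∩ Y`, which
makes that set heavy. If it is another vertex, adding what it reaches gives a hub-free set left only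
by `a → d`, against `not_out_two`. -/
theorem exists_separates [Finite V] (h : HubConfig Q Y o Heavy) (hΩ : Q.IsPart Y Ω) (hd : d ∈ Ω)
    (ha : a ∈ Y) (haΩ : a ∉ Ω) (had : Q.Adj a d) :
    ∃ Z z, Q.Separates a d Z z ∧ (o ∈ Z ∨ (o ∉ Z ∧ z = o ∧ Heavy (Z ∩ Y))) := by
  have hdY := hΩ.1.1 hd
  have hne : a ≠ d := fun e => haΩ (e ▸ hd)
  have hoa : o ≠ a := fun e => h.notMem (e ▸ ha)
  have hod : o ≠ d := fun e => h.notMem (e ▸ hdY)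
  have H2 := h.mem_reach_of_part hΩ hd ha haΩ
  obtain ⟨Z, z, haZ, hdZ, hzd, hout, -⟩ := exists_separator (U := {w | w ∈ Y ∨ w = o}) (o := o)
    (h.not_hasTransitive a ha d hdY) hne had h.head (by
      intro X hXU hX haX hdX hoX hout
      refine h.not_out_two X (fun u hu => (hXU hu).resolve_right fun e => hoX (e ▸ hu)) hX
        (fun u hu huo => ?_) a d hout (Reach.of_adj had hdX)
      rcases hout u hu o huo with e | e | e
      exacts [hoX e, hoa e, hod e]) hoa hod H2
  refine ⟨Z, z, ⟨haZ, hdZ, hzd, hout⟩, ?_⟩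
  by_cases hoZ : o ∈ Z
  · exact Or.inl hoZ
  refine Or.inr ⟨hoZ, ?_⟩
  have hX : (Z ∩ Y).Nonempty := ⟨a, haZ, ha⟩
  have hXY : Z ∩ Y ⊆ Y := Set.inter_subset_right
  have hout' : ∀ u ∈ Z ∩ Y, ∀ w, Q.Adj u w → w ∈ Z ∩ Y ∨ w = z ∨ (u = a ∧ w = d) := by
    intro u hu w huw
    rcases hout u hu.1 w huw with e | e | e
    · exact Or.inl ⟨e, (h.head u w huw).resolve_right fun e' => hoZ (e' ▸ e)⟩
    · exact Or.inr (Or.inl e)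
    · exact Or.inr (Or.inr e)
  -- a set that can be left only from `a` to `d` does not contain the hub
  have hleave : ∀ W : Set V, d ∉ W →
      (∀ u ∈ W, ∀ w, Q.Adj u w → w ∈ W ∨ (u = a ∧ w = d)) → o ∉ W := by
    intro W hdW hW hoW
    refine hdW (H2.mem_of_closed (A := W ∩ {a}ᶜ) ⟨hoW, hoa⟩ ?_).1
    rintro u ⟨hu, hua⟩ w hwa huw
    rcases hW u hu w huw with e | e
    exacts [⟨e, hwa⟩, absurd e.1 hua]
  by_cases hzo : z = o
  · subst hzo
    refine ⟨rfl, h.heavy _ hXY hX d hdY (fun u hu w hw huw => ?_) ?_⟩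
    · rcases hout' u hu w huw with e | e | e
      exacts [Or.inl e, absurd (e ▸ hw) h.notMem, Or.inr e.2]
    · by_contra hcon
      refine hleave (Z ∩ Y ∪ {w | Q.Reach (Z ∩ Y)ᶜ z w}) ?_ ?_ (Or.inr Reach.refl)
      · rintro (e | e)
        exacts [hdZ e.1, hcon e]
      · rintro u (hu | hu) w huw
        · rcases hout' u hu w huw with e | rfl | e
          exacts [Or.inl (Or.inl e), Or.inl (Or.inr Reach.refl), Or.inr e]
        · by_cases hw : w ∈ Z ∩ Y
          · exact Or.inl (Or.inl hw)
          · exact Or.inl (Or.inr (Reach.tail hu huw hw))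
  · exfalso
    have hno : ∀ u ∈ Z ∩ Y, ¬ Q.Adj u o := by
      intro u hu huo
      rcases hout' u hu o huo with e | e | e
      exacts [hoZ e.1, hzo e.symm, hod e.2]
    have hzdR := h.not_out_two (Z ∩ Y) hXY hX hno z d
      fun u hu w huw => (hout' u hu w huw).imp id (Or.imp id And.right)
    set W := Z ∩ Y ∪ {w | (w ∈ Y ∨ w = o) ∧ Q.Reach (Z ∩ Y)ᶜ z w} with hWdef
    have hdW : d ∉ W := by
      rintro (e | e)
      exacts [hdZ e.1, hzdR e.2]
    have hW : ∀ u ∈ W, ∀ w, Q.Adj u w → w ∈ W ∨ (u = a ∧ w = d) := by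
      rintro u (hu | hu) w huw
      · rcases hout' u hu w huw with e | rfl | e
        exacts [Or.inl (Or.inl e), Or.inl (Or.inr ⟨h.head u w huw, Reach.refl⟩), Or.inr e]
      · by_cases hw : w ∈ Z ∩ Y
        · exact Or.inl (Or.inl hw)
        · exact Or.inl (Or.inr ⟨h.head u w huw, hu.2.tail huw hw⟩)
    have hoW := hleave W hdW hW
    refine h.not_out_two W ?_ hX.inl (fun u hu huo => ?_) d d (fun u hu w huw => ?_) Reach.refl
    · rintro u (hu | hu)
      · exact hu.2
      · exact hu.1.resolve_right fun e => hoW (Or.inr (e ▸ hu))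
    · rcases hW u hu o huo with e | e
      exacts [hoW e, hod e.2]
    · rcases hW u hu w huw with e | e
      exacts [Or.inl e, Or.inr (Or.inl e.2)]

/-- The intersection is nonempty and has no exit in `Y`: an arc to `d` would have to start at both
`a₁` and `a₂`. -/
theorem not_both_heavy (h : HubConfig Q Y o Heavy) (h₁ : Q.Separates a₁ d Z₁ o)
    (h₂ : Q.Separates a₂ d Z₂ o) (hH₁ : Heavy (Z₁ ∩ Y)) (hH₂ : Heavy (Z₂ ∩ Y)) (hd : d ∈ Y)
    (hne : a₁ ≠ a₂) : False := by
  have := h.eq_of_not_out (Z₁ ∩ Y ∩ (Z₂ ∩ Y)) (Set.inter_subset_left.trans Set.inter_subset_right)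
    (h.heavy_inter _ _ hH₁ hH₂) fun u hu w hw huw => by
      have hwo : w ≠ o := fun e => h.notMem (e ▸ hw)
      have hwd : w ≠ d := by
        rintro rfl
        exact hne ((h₁.eq_of_adj hu.1.1 huw).symm.trans (h₂.eq_of_adj hu.2.1 huw))
      refine ⟨⟨?_, hw⟩, ?_, hw⟩
      · exact (h₁.2.2.2 u hu.1.1 w huw).resolve_right (by simp [hwo, hwd])
      · exact (h₂.2.2.2 u hu.2.1 w huw).resolve_right (by simp [hwo, hwd])
  rw [← this] at hd
  exact h₁.2.1 hd.1.1

/-- Uncrossing, with single-entry sets as outcome. Either the complement of `Z₁ ∪ Z₂` has the sole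
entry `d` and contains `a₃`, or the complement of `Z₁ ∩ Z₂` has one entry and contains `a₁`. Both
contain `d`, so maximality of `Ω` is violated. -/
theorem not_three_hub (h : HubConfig Q Y o Heavy) (hΩ : Q.IsPart Y Ω) (hd : d ∈ Ω)
    (h₁ : Q.Separates a₁ d Z₁ z₁) (h₂ : Q.Separates a₂ d Z₂ z₂) (ho₁ : o ∈ Z₁) (ho₂ : o ∈ Z₂)
    (ha₁ : a₁ ∈ Y) (ha₁Ω : a₁ ∉ Ω) (had₁ : Q.Adj a₁ d) (hne : a₁ ≠ a₂)
    (ha₃ : a₃ ∈ Y) (ha₃Ω : a₃ ∉ Ω) (had₃ : Q.Adj a₃ d) (hne₁ : a₃ ≠ a₁) (hne₂ : a₃ ≠ a₂) :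
    False := by
  have hdY := hΩ.1.1 hd
  by_cases hz : z₁ ∈ Z₂ ∧ z₂ ∈ Z₁
  · refine ha₃Ω (hΩ.2 (Y \ (Z₁ ∪ Z₂)) ⟨Set.sdiff_subset, ⟨d, hdY, ?_⟩, d, ?_⟩
      ⟨d, ⟨hdY, ?_⟩, hd⟩ ⟨ha₃, ?_⟩)
    · rintro (e | e)
      exacts [h₁.2.1 e, h₂.2.1 e]
    · intro u hu w hw huw
      have hu' : u ∈ Z₁ ∪ Z₂ := by
        by_contra hu'
        rcases h.tail u w huw with e | rfl
        exacts [hu ⟨e, hu'⟩, hu' (Or.inl ho₁)]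
      rcases hu' with hu' | hu'
      · rcases h₁.2.2.2 u hu' w huw with e | e | e
        exacts [absurd (Or.inl e) hw.2, absurd (Or.inr (e ▸ hz.1)) hw.2, e.2]
      · rcases h₂.2.2.2 u hu' w huw with e | e | e
        exacts [absurd (Or.inr e) hw.2, absurd (Or.inl (e ▸ hz.2)) hw.2, e.2]
    · rintro (e | e)
      exacts [h₁.2.1 e, h₂.2.1 e]
    · rintro (e | e)
      exacts [hne₁ (h₁.eq_of_adj e had₃), hne₂ (h₂.eq_of_adj e had₃)]
  · have key : ∀ u ∈ Z₁ ∩ Z₂, ∀ w, Q.Adj u w → (w ∈ Z₁ ∨ w = z₁) ∧ (w ∈ Z₂ ∨ w = z₂) := by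
      intro u hu w huw
      have hwd : w ≠ d := by
        rintro rfl
        exact hne ((h₁.eq_of_adj hu.1 huw).symm.trans (h₂.eq_of_adj hu.2 huw))
      constructor
      · rcases h₁.2.2.2 u hu.1 w huw with e | e | e
        exacts [Or.inl e, Or.inr e, absurd e.2 hwd]
      · rcases h₂.2.2.2 u hu.2 w huw with e | e | e
        exacts [Or.inl e, Or.inr e, absurd e.2 hwd]
    obtain ⟨z, hz⟩ : ∃ z, ∀ u ∈ Z₁ ∩ Z₂, ∀ w, Q.Adj u w → w ∈ Z₁ ∩ Z₂ ∨ w = z := by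
      by_cases hz1 : z₁ ∈ Z₂
      · have hz2 : z₂ ∉ Z₁ := fun h => hz ⟨hz1, h⟩
        refine ⟨z₁, fun u hu w huw => ?_⟩
        obtain ⟨h1 | h1, h2 | h2⟩ := key u hu w huw
        exacts [Or.inl ⟨h1, h2⟩, absurd (h2 ▸ h1) hz2, Or.inr h1, Or.inr h1]
      · refine ⟨z₂, fun u hu w huw => ?_⟩
        obtain ⟨h1 | h1, h2 | h2⟩ := key u hu w huw
        exacts [Or.inl ⟨h1, h2⟩, Or.inr h2, absurd (h1 ▸ h2) hz1, Or.inr h2]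
    have hdS : d ∈ Y \ (Z₁ ∩ Z₂) := ⟨hdY, fun e => h₁.2.1 e.1⟩
    refine ha₁Ω (hΩ.2 (Y \ (Z₁ ∩ Z₂)) ⟨Set.sdiff_subset, ⟨d, hdS⟩, z, ?_⟩ ⟨d, hdS, hd⟩
      ⟨ha₁, fun e => hne (h₂.eq_of_adj e.2 had₁)⟩)
    intro u hu w hw huw
    have hu' : u ∈ Z₁ ∩ Z₂ := by
      by_contra hu'
      rcases h.tail u w huw with e | rfl
      exacts [hu ⟨e, hu'⟩, hu' ⟨ho₁, ho₂⟩]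
    exact (hz u hu' w huw).resolve_left hw.2

/-- The entry of a part has at most two in-neighbours outside. -/
theorem ncard_entering_le [Finite V] (h : HubConfig Q Y o Heavy) (hΩ : Q.IsPart Y Ω)
    (hd : d ∈ Ω) : {u | u ∉ Ω ∧ Q.Adj u d}.ncard ≤ 2 := by
  by_contra hcon
  have hdY := hΩ.1.1 hd
  rw [not_le, Set.two_lt_ncard_iff] at hcon
  obtain ⟨u, v, w, ⟨hu, hud⟩, ⟨hv, hvd⟩, ⟨hw, hwd⟩, huv, huw, hvw⟩ := hcon
  have hsep : ∀ a ∉ Ω, Q.Adj a d → a ≠ o → a ∈ Y ∧ ∃ Z z, Q.Separates a d Z z ∧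
      (o ∈ Z ∨ (o ∉ Z ∧ z = o ∧ Heavy (Z ∩ Y))) := by
    intro a ha had hao
    have haY := (h.tail a d had).resolve_right hao
    exact ⟨haY, h.exists_separates hΩ hd haY ha had⟩
  -- If the hub itself precedes `d`, it cannot lie in a separator of another in-neighbour, so both
  -- separators are heavy.
  have htwo : ∀ a₁ ∉ Ω, ∀ a₂ ∉ Ω, a₁ ≠ a₂ → Q.Adj a₁ d → Q.Adj a₂ d → a₁ ≠ o → a₂ ≠ o →
      Q.Adj o d → False := by
    intro a₁ ha₁ a₂ ha₂ hne had₁ had₂ h1 h2 hod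
    obtain ⟨-, Z₁, z₁, hZ₁, hc₁⟩ := hsep a₁ ha₁ had₁ h1
    obtain ⟨-, Z₂, z₂, hZ₂, hc₂⟩ := hsep a₂ ha₂ had₂ h2
    rcases hc₁ with e | ⟨-, rfl, hH₁⟩
    · exact h1 (hZ₁.eq_of_adj e hod).symm
    rcases hc₂ with e | ⟨-, rfl, hH₂⟩
    · exact h2 (hZ₂.eq_of_adj e hod).symm
    exact h.not_both_heavy hZ₁ hZ₂ hH₁ hH₂ hdY hne
  by_cases huo : u = o
  · subst huo
    exact htwo v hv w hw hvw hvd hwd huv.symm huw.symm hud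
  by_cases hvo : v = o
  · subst hvo
    exact htwo u hu w hw huw hud hwd huv hvw.symm hvd
  by_cases hwo : w = o
  · subst hwo
    exact htwo u hu v hv huv hud hvd huw hvw hwd
  obtain ⟨huY, Z₁, z₁, hZ₁, hc₁⟩ := hsep u hu hud huo
  obtain ⟨hvY, Z₂, z₂, hZ₂, hc₂⟩ := hsep v hv hvd hvo
  obtain ⟨hwY, Z₃, z₃, hZ₃, hc₃⟩ := hsep w hw hwd hwo
  -- Of three separators, two contain the hub or two are heavy.
  rcases hc₁ with e₁ | ⟨-, rfl, hH₁⟩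
  · rcases hc₂ with e₂ | ⟨-, rfl, hH₂⟩
    · exact h.not_three_hub hΩ hd hZ₁ hZ₂ e₁ e₂ huY hu hud huv hwY hw hwd huw.symm hvw.symm
    · rcases hc₃ with e₃ | ⟨-, rfl, hH₃⟩
      · exact h.not_three_hub hΩ hd hZ₁ hZ₃ e₁ e₃ huY hu hud huw hvY hv hvd huv.symm hvw
      · exact h.not_both_heavy hZ₂ hZ₃ hH₂ hH₃ hdY hvw
  · rcases hc₂ with e₂ | ⟨-, rfl, hH₂⟩
    · rcases hc₃ with e₃ | ⟨-, rfl, hH₃⟩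
      · exact h.not_three_hub hΩ hd hZ₂ hZ₃ e₂ e₃ hvY hv hvd hvw huY hu hud huv huw
      · exact h.not_both_heavy hZ₁ hZ₃ hH₁ hH₃ hdY huw
    · exact h.not_both_heavy hZ₁ hZ₂ hH₁ hH₂ hdY huv

/-- A part with at most one out-neighbour in `Y` is heavy. -/
theorem heavy_of_part (h : HubConfig Q Y o Heavy) (hΩ : Q.IsPart Y Ω) (hy : y ∈ Y) (hyΩ : y ∉ Ω)
    (hout : ∀ u ∈ Ω, ∀ w ∈ Y, Q.Adj u w → w ∈ Ω ∨ w = y) : Heavy Ω := by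
  obtain ⟨⟨hΩY, hΩn, e, he⟩, hmax⟩ := id hΩ
  have hoΩ : o ∉ Ω := fun e => h.notMem (hΩY e)
  refine h.heavy Ω hΩY hΩn y hy hout ?_
  by_contra hcon
  have hnot : ∀ u ∈ Ω, ¬ Q.Reach Ωᶜ o u := fun u hu hou =>
    hou.mem_of_mem (T := Ωᶜ) hoΩ hu
  obtain ⟨v, hv⟩ := hΩn
  -- Otherwise the vertices the hub cannot reach outside `Ω` have the same entry as `Ω` but include
  -- `y` as well.
  refine hyΩ (hmax {u | u ∈ Y ∧ ¬ Q.Reach Ωᶜ o u} ⟨fun u hu => hu.1, ⟨y, hy, hcon⟩, e, ?_⟩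
    ⟨v, ⟨hΩY hv, hnot v hv⟩, hv⟩ ⟨hy, hcon⟩)
  intro u hu w hw huw
  have hu' : Q.Reach Ωᶜ o u := by
    by_contra hu'
    rcases h.tail u w huw with e | rfl
    exacts [hu ⟨e, hu'⟩, hu' Reach.refl]
  have hwΩ : w ∈ Ω := by
    by_contra hwΩ
    exact hw.2 (hu'.tail huw hwΩ)
  exact he u (fun huΩ => hnot u huΩ hu') w hwΩ huw

theorem _root_.Finset.two_mul_card_le_sum_add_one {ι : Type*} [DecidableEq ι] {s : Finset ι}
    {f : ι → ℕ} (h1 : ∀ i ∈ s, 1 ≤ f i) (h2 : ∀ i ∈ s, ∀ j ∈ s, f i < 2 → f j < 2 → i = j) :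
    2 * s.card ≤ ∑ i ∈ s, f i + 1 := by
  by_cases h : ∃ i ∈ s, f i < 2
  · obtain ⟨i, hi, hi2⟩ := h
    have h3 : (s.erase i).card * 2 ≤ ∑ j ∈ s.erase i, f j := by
      rw [← smul_eq_mul]
      refine Finset.card_nsmul_le_sum _ _ _ fun j hj => ?_
      by_contra hj2
      exact (Finset.mem_erase.mp hj).1 (h2 j (Finset.mem_of_mem_erase hj) i hi (by omega) hi2)
    have h4 := Finset.card_erase_add_one hi
    have h5 := Finset.add_sum_erase s f hi
    have h6 := h1 i hi
    omega
  · push Not at h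
    have h3 : s.card * 2 ≤ ∑ j ∈ s, f j := by
      rw [← smul_eq_mul]
      exact Finset.card_nsmul_le_sum _ _ _ h
    omega

/-- Count pairs of a source and an entry it leads to, the sources being the hub and the entries,
each standing for its part. An entry occurs in at most two pairs, so there are at most `2 * Δ.card`.
A source occurs in at least two, except that one heavy part may occur in only one, so there are at
least `2 * (Δ.card + 1) - 1`. -/
theorem false [Finite V] (h : HubConfig Q Y o Heavy) : False := by
  classical
  have := Fintype.ofFinite V
  -- The singleton outside `Y` makes the hub a class of its own.
  have hpart : ∀ y, ∃ Ω : Set V, y ∈ Ω ∧ (y ∈ Y → Q.IsPart Y Ω) ∧ (y ∉ Y → Ω = {y}) := by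
    intro y
    by_cases hy : y ∈ Y
    · obtain ⟨Ω, hΩ, hyΩ⟩ := h.exists_part hy
      exact ⟨Ω, hyΩ, fun _ => hΩ, fun e => absurd hy e⟩
    · exact ⟨{y}, rfl, fun e => absurd e hy, fun _ => rfl⟩
  choose Ω hmem hΩ hΩo using hpart
  have hΩo := hΩo o h.notMem
  set Δ : Finset V := Finset.univ.filter fun d => d ∈ Y ∧ ∃ u ∉ Ω d, Q.Adj u d with hΔ
  have hΔ' : ∀ d, d ∈ Δ ↔ d ∈ Y ∧ ∃ u ∉ Ω d, Q.Adj u d := by simp [hΔ]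
  have hoΔ : o ∉ Δ := fun e => h.notMem ((hΔ' o).mp e).1
  -- distinct sources have disjoint classes
  have huniq : ∀ σ ∈ insert o Δ, ∀ σ' ∈ insert o Δ, ∀ u ∈ Ω σ, u ∈ Ω σ' → σ = σ' := by
    have h1 : ∀ σ ∈ Δ, ∀ u ∈ Ω σ, u ≠ o := by
      rintro σ hσ u hu rfl
      exact h.notMem ((hΩ σ ((hΔ' σ).mp hσ).1).1.1 hu)
    intro σ hσ σ' hσ' u hu hu'
    rcases Finset.mem_insert.mp hσ with rfl | hm <;> rcases Finset.mem_insert.mp hσ' with rfl | hm'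
    · rfl
    · rw [hΩo] at hu
      exact absurd hu (h1 σ' hm' u hu')
    · rw [hΩo] at hu'
      exact absurd hu' (h1 σ hm u hu)
    · obtain ⟨hY, v, hv, hvσ⟩ := (hΔ' σ).mp hm
      obtain ⟨hY', v', hv', hvσ'⟩ := (hΔ' σ').mp hm'
      have heq := (hΩ σ hY).eq (hΩ σ' hY') hu hu'
      obtain ⟨e, he⟩ := (hΩ σ hY).1.2.2
      rw [he v hv σ (hmem σ) hvσ]
      rw [← heq] at hv'
      exact (he v' hv' σ' (heq ▸ hmem σ') hvσ').symm
  set r : V → V → Prop := fun σ d => ∃ u ∈ Ω σ, u ∉ Ω d ∧ Q.Adj u d with hr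
  have hcount := Finset.sum_card_bipartiteAbove_eq_sum_card_bipartiteBelow (s := insert o Δ)
    (t := Δ) r
  have hbelow : ∀ d ∈ Δ, ((insert o Δ).bipartiteBelow r d).card ≤ 2 := by
    intro d hd
    have hdY := ((hΔ' d).mp hd).1
    refine le_trans ?_ (h.ncard_entering_le (hΩ d hdY) (hmem d))
    rw [← Set.ncard_coe_finset]
    have hch : ∀ σ ∈ (insert o Δ).bipartiteBelow r d, ∃ u ∈ Ω σ, u ∉ Ω d ∧ Q.Adj u d :=
      fun σ hσ => (Finset.mem_bipartiteBelow _).mp hσ |>.2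
    choose! g hg hg' using hch
    refine Set.ncard_le_ncard_of_injOn g (fun σ hσ => hg' σ hσ) (fun σ hσ σ' hσ' e => ?_)
      (Set.toFinite _)
    have h1 := (Finset.mem_bipartiteBelow _).mp hσ
    have h2 := (Finset.mem_bipartiteBelow _).mp hσ'
    exact huniq σ h1.1 σ' h2.1 (g σ) (hg σ hσ) (e ▸ hg σ' hσ')
  have hle : ∑ d ∈ Δ, ((insert o Δ).bipartiteBelow r d).card ≤ Δ.card * 2 := by
    rw [← smul_eq_mul]
    exact Finset.sum_le_card_nsmul _ _ _ hbelow
  -- arcs leaving a class lead to entries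
  have hent : ∀ σ ∈ insert o Δ, ∀ u ∈ Ω σ, ∀ w ∈ Y, Q.Adj u w → w ∉ Ω σ →
      w ∈ (Δ.bipartiteAbove r σ) := by
    intro σ hσ u hu w hw huw hwσ
    have huw' : u ∉ Ω w := by
      intro hu'
      rcases Finset.mem_insert.mp hσ with rfl | hσ
      · rw [hΩo] at hu
        obtain rfl : u = σ := hu
        exact h.notMem ((hΩ w hw).1.1 hu')
      · exact hwσ ((hΩ σ ((hΔ' σ).mp hσ).1).eq (hΩ w hw) hu hu' ▸ hmem w)
    rw [Finset.mem_bipartiteAbove, hΔ']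
    exact ⟨⟨hw, u, huw', huw⟩, u, hu, huw', huw⟩
  have hoY : ∀ w, Q.Adj o w → w ∈ Y ∧ w ∉ Ω o := by
    intro w hw
    refine ⟨h.adj_hub w hw, fun e => ?_⟩
    rw [hΩo] at e
    exact h.notMem (e ▸ h.adj_hub w hw)
  have hhub : 2 ≤ (Δ.bipartiteAbove r o).card := by
    obtain ⟨v, hv, -⟩ := h.exists_adj_ne o
    obtain ⟨w, hw, hwv⟩ := h.exists_adj_ne v
    have hmem' : ∀ w, Q.Adj o w → w ∈ Δ.bipartiteAbove r o := fun w hw =>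
      hent o (Finset.mem_insert_self _ _) o (hmem o) w (hoY w hw).1 hw (hoY w hw).2
    exact Finset.one_lt_card.mpr ⟨w, hmem' w hw, v, hmem' v hv, hwv⟩
  have hpos : ∀ σ ∈ insert o Δ, 1 ≤ (Δ.bipartiteAbove r σ).card := by
    intro σ hσ
    rcases Finset.mem_insert.mp hσ with rfl | hσΔ
    · omega
    by_contra hcon
    have hempty : Δ.bipartiteAbove r σ = ∅ := by
      rw [← Finset.card_eq_zero]; omega
    have hσY := ((hΔ' σ).mp hσΔ).1
    have hpt := hΩ σ hσY
    have hY := h.eq_of_not_out (Ω σ) hpt.1.1 hpt.1.2.1 fun u hu w hw huw => by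
      by_contra hwσ
      have := hent σ hσ u hu w hw huw hwσ
      rw [hempty] at this
      simp at this
    obtain ⟨e, he⟩ := hpt.1.2.2
    obtain ⟨w, hw, hwe⟩ := h.exists_adj_ne e
    refine hwe (he o (fun e => h.notMem (hY ▸ e)) w ?_ hw)
    rw [hY]
    exact h.adj_hub w hw
  have hheavy : ∀ σ ∈ insert o Δ, (Δ.bipartiteAbove r σ).card < 2 → Heavy (Ω σ) := by
    intro σ hσ hlt
    rcases Finset.mem_insert.mp hσ with rfl | hσΔ
    · omega
    have h1 := hpos σ hσ
    obtain ⟨d, hd⟩ := Finset.card_eq_one.mp (show (Δ.bipartiteAbove r σ).card = 1 by omega)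
    have hdm : d ∈ Δ.bipartiteAbove r σ := by simp [hd]
    rw [Finset.mem_bipartiteAbove] at hdm
    obtain ⟨hdΔ, u, hu, hud, -⟩ := hdm
    have hdY := ((hΔ' d).mp hdΔ).1
    have hpt := hΩ σ ((hΔ' σ).mp hσΔ).1
    refine h.heavy_of_part hpt hdY (fun e => ?_) fun u hu w hw huw => ?_
    · exact hud (hpt.eq (hΩ d hdY) e (hmem d) ▸ hu)
    · by_cases hwσ : w ∈ Ω σ
      · exact Or.inl hwσ
      · have := hent σ hσ u hu w hw huw hwσ
        rw [hd] at this
        exact Or.inr (Finset.mem_singleton.mp this)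
  have hge := Finset.two_mul_card_le_sum_add_one hpos fun σ hσ σ' hσ' h1 h2 => by
    obtain ⟨u, hu, hu'⟩ := h.heavy_inter _ _ (hheavy σ hσ h1) (hheavy σ' hσ' h2)
    exact huniq σ hσ σ' hσ' u hu hu'
  rw [Finset.card_insert_of_notMem hoΔ] at hge
  omega

end HubConfig

/-- Every configuration contains a subdivided transitive tournament. -/
theorem Config.exists_hasTransitive [Finite V] {D : Digraph V} {R : Set V} {p q x : V}
    (h : D.Config R p q x) : ∃ a d, D.HasTransitive a d := by
  induction hn : R.ncard using Nat.strong_induction_on generalizing D R p q x with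
  | _ n ih =>
  subst hn
  by_contra hcon
  push Not at hcon
  have hmin : D.MinConfig R p q x := ⟨h, hcon, fun D' X p q x h' hlt => ih _ hlt h' rfl⟩
  obtain ⟨E, tok, hE⟩ := hmin.exists_tokenConfig
  obtain ⟨Q, Y, Heavy, hQ⟩ := hE.exists_hubConfig
  exact hQ.false

/-- Deleting all arcs out of `p` and `q` other than those of a path `p → q → x` turns `G` into a
configuration. -/
theorem hasModel_transitive [Finite V] [Nonempty V] {G : Digraph V} (hG : G.Loopless)
    (h3 : ∀ u, G.ThreeOut u) : G.HasModel transitiveArcs := by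
  obtain ⟨p⟩ := ‹Nonempty V›
  obtain ⟨q, hpq, -⟩ := h3 p p p
  obtain ⟨x, hqx, hxp, hxq⟩ := h3 q p q
  have hne : p ≠ q := by rintro rfl; exact hG _ hpq
  set D : Digraph V := ⟨fun u w => (u ∉ ({p, q} : Set V) ∧ G.Adj u w) ∨ (u = p ∧ w = q) ∨
    (u = q ∧ w = x)⟩ with hD
  have hDG : ∀ u w, D.Adj u w → G.Adj u w := by
    rintro u w (h | ⟨rfl, rfl⟩ | ⟨rfl, rfl⟩)
    exacts [h.2, hpq, hqx]
  have hall : ∀ u : V, u ∈ ({p, q}ᶜ : Set V) ∨ u = p ∨ u = q := by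
    intro u
    by_cases h : u ∈ ({p, q} : Set V)
    exacts [Or.inr h, Or.inl h]
  have hconf : D.Config {p, q}ᶜ p q x := by
    refine ⟨hne, by simp, by simp, by simp [hxp, hxq], ?_, ?_, fun u _ _ => hall u,
      fun _ w _ => hall w, fun u _ h => hG u (hDG u u h), fun u hu y z => ?_⟩
    · intro w
      simp [hD, hne]
    · intro w
      simp [hD, hne.symm]
    · obtain ⟨w, hw⟩ := h3 u y z
      exact ⟨w, Or.inl ⟨hu, hw.1⟩, hw.2⟩
  obtain ⟨a, d, had⟩ := hconf.exists_hasTransitive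
  exact (had.mono hDG).hasModel

end Parts

end Digraph

theorem mainTheorem11 {V : Type*} [Finite V] [Nonempty V] (G : Digraph V)
    (hG : G.Loopless)
    (hout : ∀ v, 3 ≤ G.outDegree v)
    (hin : ∀ v, 3 ≤ G.inDegree v)
    (H : Digraph (Fin 4)) (hH : H.IsOrientation (⊤ : SimpleGraph (Fin 4))) :
    G.ContainsSubdivision H := by
  obtain ⟨k, τ, hτ, h⟩ := hH.classification
  have h3 : ∀ u, G.ThreeOut u := fun u => Digraph.threeOut_of_outDegree (hout u)
  have h3' : ∀ u, G.reversed.ThreeOut u := fun u => Digraph.threeOut_of_outDegree (hin u)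
  have hne : ∀ k i, (Digraph.fourTournaments k i).1 ≠ (Digraph.fourTournaments k i).2 := by
    decide
  suffices hk : ∀ k, G.HasModel (Digraph.fourTournaments k) from
    (hk k).containsSubdivision (hne k) hτ h
  intro k
  fin_cases k
  · exact Digraph.hasModel_transitive hG h3
  · exact (Digraph.hasModel_strong_source hG h3).1
  · exact (Digraph.hasModel_strong_source hG h3).2
  -- The triangle with a sink is the reversed source tournament; the in-degrees of `G` are the
  -- out-degrees of `G.reversed`.
  · exact (Digraph.hasModel_strong_source (G := G.reversed) hG h3').2.of_reversed (hne 2)
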